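/- **Setting.** Let $S$ be a scheme, $s\in\Gamma(S,\mathcal O_S)$, and let $n,d\ge 1$ and $0\le r<d$ be integers. Let $E_\bullet=(E_i,f_i,f^i)$ be an *$s$-linked* chain: vector bundles $E_1,\dots,E_n$ of rank $d$ on $S$ with homomorphisms $f_i:E_i\to E_{i+1}$ and $f^i:E_{i+1}\to E_i$ for $1\le i\le n-1$ such that $f_i f^i=s\cdot\mathrm{id}$ and $f^i f_i=s\cdot\mathrm{id}$, and such that on the fibres at every point of $S$ where $s=0$ one has $\ker f^i=\operatorname{im} f_i$ and $\ker f_i=\operatorname{im} f^i$ for $1\le i\le n-1$, and $\operatorname{im} f_i\cap\ker f_{i+1}=0$ and $\operatorname{im} f^{i+1}\cap\ker f^i=0$ for $1\le i\le n-2$. A *linked subbundle* of rank $r$ of $E_\bullet$ consists of subbundles (locally direct summands) $F_i\subseteq E_i$ of rank $r$ with $f_iF_i\subseteq F_{i+1}$ and $f^iF_{i+1}\subseteq F_i$. The *linked Grassmannian* $LG(r,E_\bullet)$ is the $S$-scheme representing the functor that sends $T\to S$ to the set of linked subbundles of rank $r$ of $E_\bullet|_T$. Let $m\in\frac12\mathbb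 Z$ with $1\le m\le n$. A *linked alternating form* of index $m$ on $E_\bullet$ is a collection of bilinear pairings $\langle\,,\rangle_{i,j}:E_i\times E_j\to\mathcal O_S$ for $1\le i,j\le n$ such that, whenever the indices make sense, $$\langle f_{i-1}x,y\rangle_{i,j}=s^{\epsilon_{i,j}}\langle x,y\rangle_{i-1,j},\qquad \langle x,f_{j-1}y\rangle_{i,j}=s^{\epsilon_{i,j}}\langle x,y\rangle_{i,j-1},$$ $$\langle f^{i}x,y\rangle_{i,j}=s^{\epsilon^{i,j}}\langle x,y\rangle_{i+1,j},\qquad \langle x,f^{j}y\rangle_{i,j}=s^{\epsilon^{i,j}}\langle x,y\rangle_{i,j+1},$$ where $\epsilon_{i,j}=1$ if $i+j>2m$ and $0$ otherwise, and $\epsilon^{i,j}=1$ if $i+j<2m$ and $0$ otherwise; and such that every $\langle\,,\rangle_{i,i}$ is alternating and $\langle x,y\rangle_{i,j}=-\langle y,x\rangle_{j,i}$ for $i\ne j$. The *linked alternating Grassmannian* $LAG(r,E_\bullet,\langle\,,\rangle_\bullet)$ is the closed subscheme of $LG(r,E_\bullet)$ parametrizing the linked subbundles $F_\bullet$ that are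 isotropic, i.e. such that for all $i,j$ (including $i\neq j$) the pairing $\langle\,,\rangle_{i,j}$ vanishes on $F_i\times F_j$. **Theorem.** Let $z\in LAG(r,E_\bullet,\langle\,,\rangle_\bullet)$ be a point at which $LG(r,E_\bullet)$ is smooth over $S$. Then, locally at $z$, $LAG(r,E_\bullet,\langle\,,\rangle_\bullet)$ is cut out by $\binom r2$ equations in $LG(r,E_\bullet)$: there are an affine open neighbourhood $U$ of $z$ in $LG(r,E_\bullet)$ and functions $g_1,\dots,g_N\in\Gamma(U,\mathcal O)$, $N=\binom r2$, that generate the ideal of $LAG(r,E_\bullet,\langle\,,\rangle_\bullet)\cap U$ in $U$. -/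

import Mathlib

open CategoryTheory AlgebraicGeometry
open scoped AlgebraicGeometry

universe u

noncomputable section

namespace LinkedGrassmannian

/-! ### Sections of `𝒪`-modules, frames, vector bundles, subbundles -/

/-- Restriction of a section of an `𝒪_X`-module to a smaller open set. -/
def res {X : Scheme.{u}} {M : X.Modules} {U V : X.Opens} (h : V ≤ U) (x : Γ(M, U)) : Γ(M, V) :=
  M.presheaf.map (homOfLE h).op x

/-- Restriction of a function to a smaller open set. -/
def resFun {X : Scheme.{u}} {U V : X.Opens} (h : V ≤ U) (a : Γ(X, U)) : Γ(X, V) :=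
  X.presheaf.map (homOfLE h).op a

/-- Restriction of a global function to an open set. -/
def resTop {X : Scheme.{u}} (s : Γ(X, ⊤)) (U : X.Opens) : Γ(X, U) :=
  resFun le_top s

/-- A finite family of sections of `M` over `U` is a frame if over every open `V ≤ U` its
restriction is a basis of `Γ(M, V)` over `Γ(X, V)`, i.e. if it defines an isomorphism
`𝒪_U ^ ι ≅ M|_U`. -/
def IsFrame {X : Scheme.{u}} {M : X.Modules} {U : X.Opens} {ι : Type} [Fintype ι]
    (e : ι → Γ(M, U)) : Prop :=
  ∀ (V : X.Opens) (h : V ≤ U),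
    Function.Bijective (fun a : ι → Γ(X, V) => ∑ k, a k • res h (e k))

/-- `M` is a vector bundle of rank `d`: it is locally isomorphic to `𝒪 ^ d`. -/
def IsVectorBundle {X : Scheme.{u}} (M : X.Modules) (d : ℕ) : Prop :=
  ∀ x : X, ∃ (U : X.Opens) (_ : x ∈ U) (e : Fin d → Γ(M, U)), IsFrame e

/-- A subbundle of rank `r` of an `𝒪_X`-module `M` (in practice, of a vector bundle): a subsheaf
of `𝒪_X`-submodules `F ⊆ M` that locally is the span of the first `r` elements of a frame of `M`
(so that locally `F` is a free direct summand of rank `r`). -/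
@[ext]
structure SubBundle {X : Scheme.{u}} (M : X.Modules) (r : ℕ) where
  /-- the sections over `U` -/
  sec : ∀ U : X.Opens, Submodule Γ(X, U) Γ(M, U)
  res_mem : ∀ {U V : X.Opens} (h : V ≤ U) (x : Γ(M, U)), x ∈ sec U → res h x ∈ sec V
  mem_of_local : ∀ {U : X.Opens} (x : Γ(M, U)),
    (∀ p ∈ U, ∃ (V : X.Opens) (h : V ≤ U), p ∈ V ∧ res h x ∈ sec V) → x ∈ sec U
  exists_frame : ∀ p : X, ∃ (U : X.Opens) (_ : p ∈ U) (q : ℕ) (e : Fin r ⊕ Fin q → Γ(M, U)),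
    IsFrame e ∧ ∀ (V : X.Opens) (h : V ≤ U),
      sec V = Submodule.span Γ(X, V) (Set.range fun k : Fin r => res h (e (Sum.inl k)))

/-! ### Pullback -/

/-- The pullback `φ^* M`. -/
abbrev pb {X Y : Scheme.{u}} (φ : X ⟶ Y) (M : Y.Modules) : X.Modules :=
  (Scheme.Modules.pullback φ).obj M

/-- The pullback of a morphism of modules. -/
abbrev pbMap {X Y : Scheme.{u}} (φ : X ⟶ Y) {M N : Y.Modules} (f : M ⟶ N) : pb φ M ⟶ pb φ N :=
  (Scheme.Modules.pullback φ).map f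

/-- The pullback `φ^* x` of a section `x`. -/
def pbSec {X Y : Scheme.{u}} (φ : X ⟶ Y) {M : Y.Modules} {U : Y.Opens} (x : Γ(M, U)) :
    Γ(pb φ M, φ ⁻¹ᵁ U) :=
  ((Scheme.Modules.pullbackPushforwardAdjunction φ).unit.app M).app U x

/-- The canonical isomorphism `ψ^* φ^* M ≅ φ'^* M` for `φ' = φ ∘ ψ`. -/
def pbCompHom {X Y Z : Scheme.{u}} (ψ : X ⟶ Y) (φ : Y ⟶ Z) {φ' : X ⟶ Z} (h : ψ ≫ φ = φ')
    (M : Z.Modules) : pb ψ (pb φ M) ⟶ pb φ' M :=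
  (Scheme.Modules.pullbackComp ψ φ).hom.app M ≫ (Scheme.Modules.pullbackCongr h).hom.app M

/-- The pullback of a section of `φ^* M` along `ψ`, seen as a section of `φ'^* M`, where
`φ' = φ ∘ ψ`. -/
def pbSecComp {X Y Z : Scheme.{u}} (ψ : X ⟶ Y) (φ : Y ⟶ Z) {φ' : X ⟶ Z} (h : ψ ≫ φ = φ')
    {M : Z.Modules} {V : Y.Opens} (y : Γ(pb φ M, V)) : Γ(pb φ' M, ψ ⁻¹ᵁ V) :=
  (pbCompHom ψ φ h M).app (ψ ⁻¹ᵁ V) (pbSec ψ y)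

/-- For `φ' = φ ∘ ψ`: the subbundle `F' ⊆ φ'^* M` is the pullback along `ψ` of the subbundle
`F ⊆ φ^* M`, i.e. it is the submodule generated by the pullbacks of the sections of `F`. -/
def SubBundle.IsPullback {X Y Z : Scheme.{u}} (ψ : X ⟶ Y) (φ : Y ⟶ Z) {φ' : X ⟶ Z}
    (h : ψ ≫ φ = φ') {M : Z.Modules} {r : ℕ}
    (F : SubBundle (pb φ M) r) (F' : SubBundle (pb φ' M) r) : Prop :=
  ∀ (W : X.Opens) (x : Γ(pb φ' M, W)), x ∈ F'.sec W ↔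
    ∀ p ∈ W, ∃ (V : Y.Opens) (W' : X.Opens) (h₁ : W' ≤ W) (h₂ : W' ≤ ψ ⁻¹ᵁ V), p ∈ W' ∧
      res h₁ x ∈ Submodule.span Γ(X, W')
        {t | ∃ y ∈ F.sec V, t = res h₂ (pbSecComp ψ φ h y)}

/-! ### Linked bundles -/

/-- The fibre `M(p) = M_p ⊗ κ(p)`, realized as the global sections of the pullback of `M` to
`Spec κ(p)`. -/
abbrev Fibre {X : Scheme.{u}} (p : X) (M : X.Modules) :=
  Γ(pb (X.fromSpecResidueField p) M, ⊤)

/-- The map induced on fibres by a morphism of modules. -/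
def fibreMap {X : Scheme.{u}} (p : X) {M N : X.Modules} (f : M ⟶ N) (v : Fibre p M) :
    Fibre p N :=
  (pbMap (X.fromSpecResidueField p) f).app ⊤ v

/-- An `s`-linked chain of `n` vector bundles of rank `d` on `S`. The bundle usually denoted
`E_k`, with `1 ≤ k ≤ n`, has index `⟨k - 1, _⟩ : Fin n`. For `j` the successor of `i`, `up` is
the map `f_i : E_i ⟶ E_j` and `down` is the map `f^i : E_j ⟶ E_i`. -/
structure LinkedBundle (S : Scheme.{u}) (s : Γ(S, ⊤)) (n d : ℕ) where
  /-- the bundles -/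
  E : Fin n → S.Modules
  isVectorBundle : ∀ i, IsVectorBundle (E i) d
  /-- the maps `f_i` -/
  up : ∀ {i j : Fin n}, i.val + 1 = j.val → (E i ⟶ E j)
  /-- the maps `f^i` -/
  down : ∀ {i j : Fin n}, i.val + 1 = j.val → (E j ⟶ E i)
  up_down : ∀ {i j : Fin n} (h : i.val + 1 = j.val) (U : S.Opens) (x : Γ(E j, U)),
    (up h).app U ((down h).app U x) = resTop s U • x
  down_up : ∀ {i j : Fin n} (h : i.val + 1 = j.val) (U : S.Opens) (x : Γ(E i, U)),
    (down h).app U ((up h).app U x) = resTop s U • x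
  /-- `ker f^i = im f_i` on fibres where `s = 0` -/
  exact_up_down : ∀ {i j : Fin n} (h : i.val + 1 = j.val) (p : S), S.Γevaluation p s = 0 →
    Function.Exact (fibreMap p (up h)) (fibreMap p (down h))
  /-- `ker f_i = im f^i` on fibres where `s = 0` -/
  exact_down_up : ∀ {i j : Fin n} (h : i.val + 1 = j.val) (p : S), S.Γevaluation p s = 0 →
    Function.Exact (fibreMap p (down h)) (fibreMap p (up h))
  /-- `im f_i ∩ ker f_{i+1} = 0` on fibres where `s = 0` -/
  up_up : ∀ {i j k : Fin n} (h : i.val + 1 = j.val) (h' : j.val + 1 = k.val) (p : S),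
    S.Γevaluation p s = 0 → ∀ v : Fibre p (E i),
      fibreMap p (up h') (fibreMap p (up h) v) = 0 → fibreMap p (up h) v = 0
  /-- `im f^{i+1} ∩ ker f^i = 0` on fibres where `s = 0` -/
  down_down : ∀ {i j k : Fin n} (h : i.val + 1 = j.val) (h' : j.val + 1 = k.val) (p : S),
    S.Γevaluation p s = 0 → ∀ v : Fibre p (E k),
      fibreMap p (down h) (fibreMap p (down h') v) = 0 → fibreMap p (down h') v = 0

/-- A linked subbundle of rank `r` of the pullback `φ^* E_•` of a linked bundle to `T`. -/
structure LinkedSubBundle {S : Scheme.{u}} {s : Γ(S, ⊤)} {n d : ℕ} (𝓔 : LinkedBundle S s n d)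
    (r : ℕ) {T : Scheme.{u}} (φ : T ⟶ S) where
  /-- the subbundles `F_i ⊆ φ^* E_i` -/
  F : ∀ i, SubBundle (pb φ (𝓔.E i)) r
  up_mem : ∀ {i j : Fin n} (h : i.val + 1 = j.val) (U : T.Opens) (x : Γ(pb φ (𝓔.E i), U)),
    x ∈ (F i).sec U → (pbMap φ (𝓔.up h)).app U x ∈ (F j).sec U
  down_mem : ∀ {i j : Fin n} (h : i.val + 1 = j.val) (U : T.Opens) (x : Γ(pb φ (𝓔.E j), U)),
    x ∈ (F j).sec U → (pbMap φ (𝓔.down h)).app U x ∈ (F i).sec U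

/-- The linked subbundle `𝓕'` is the pullback `ψ^* 𝓕`. -/
def LinkedSubBundle.IsPullback {S : Scheme.{u}} {s : Γ(S, ⊤)} {n d : ℕ}
    {𝓔 : LinkedBundle S s n d} {r : ℕ} {T T' : Scheme.{u}} (ψ : T' ⟶ T) {φ : T ⟶ S} {φ' : T' ⟶ S}
    (h : ψ ≫ φ = φ') (𝓕 : LinkedSubBundle 𝓔 r φ) (𝓕' : LinkedSubBundle 𝓔 r φ') : Prop :=
  ∀ i, SubBundle.IsPullback ψ φ h (𝓕.F i) (𝓕'.F i)

/-- The `S`-scheme `π : L ⟶ S` with universal linked subbundle `𝓤 ⊆ π^* E_•` is the linked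
Grassmannian `LG(r, E_•)`: it represents the functor of linked subbundles of rank `r`, i.e. for
every `φ : T ⟶ S`, the assignment `ψ ↦ ψ^* 𝓤` is a bijection from `S`-morphisms `T ⟶ L` to
linked subbundles of rank `r` of `φ^* E_•`. -/
structure IsLinkedGrassmannian {S : Scheme.{u}} {s : Γ(S, ⊤)} {n d : ℕ}
    (𝓔 : LinkedBundle S s n d) (r : ℕ) {L : Scheme.{u}} (π : L ⟶ S)
    (𝓤 : LinkedSubBundle 𝓔 r π) : Prop where
  existsUnique_pullback : ∀ {T : Scheme.{u}} (φ : T ⟶ S) (ψ : T ⟶ L) (h : ψ ≫ π = φ),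
    ∃! 𝓕 : LinkedSubBundle 𝓔 r φ, 𝓤.IsPullback ψ h 𝓕
  existsUnique_hom : ∀ {T : Scheme.{u}} (φ : T ⟶ S) (𝓕 : LinkedSubBundle 𝓔 r φ),
    ∃! ψ : T ⟶ L, ∃ h : ψ ≫ π = φ, 𝓤.IsPullback ψ h 𝓕

/-! ### Linked alternating forms -/

/-- An `𝒪_X`-bilinear pairing `M × N → 𝒪_X`. -/
structure Pairing {X : Scheme.{u}} (M N : X.Modules) where
  /-- the pairing on sections -/
  pair : ∀ U : X.Opens, Γ(M, U) →ₗ[Γ(X, U)] Γ(N, U) →ₗ[Γ(X, U)] Γ(X, U)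
  pair_res : ∀ {U V : X.Opens} (h : V ≤ U) (x : Γ(M, U)) (y : Γ(N, U)),
    pair V (res h x) (res h y) = resFun h (pair U x y)

/-- The pairing `B'` on `φ^* M × φ^* N` is the pullback of the pairing `B` on `M × N`:
`B'(φ^* x, φ^* y) = φ^* (B(x, y))`. -/
def Pairing.IsPullback {X Y : Scheme.{u}} (φ : X ⟶ Y) {M N : Y.Modules} (B : Pairing M N)
    (B' : Pairing (pb φ M) (pb φ N)) : Prop :=
  ∀ (U : Y.Opens) (x : Γ(M, U)) (y : Γ(N, U)),
    B'.pair (φ ⁻¹ᵁ U) (pbSec φ x) (pbSec φ y) = φ.app U (B.pair U x y)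

/-- The exponent `ε_{i,j}`, where `c = 2m` is twice the index (the positions of `i` and `j` in the
chain, counted from `1`, are `i + 1` and `j + 1`). -/
def epsLower {n : ℕ} (c : ℕ) (i j : Fin n) : ℕ :=
  if c < (i.val + 1) + (j.val + 1) then 1 else 0

/-- The exponent `ε^{i,j}`, where `c = 2m` is twice the index. -/
def epsUpper {n : ℕ} (c : ℕ) (i j : Fin n) : ℕ :=
  if (i.val + 1) + (j.val + 1) < c then 1 else 0

/-- A linked alternating form of index `m = c / 2` on `E_•`, where `1 ≤ m ≤ n` is an integer or a
half-integer. -/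
structure LinkedAlternatingForm {S : Scheme.{u}} {s : Γ(S, ⊤)} {n d : ℕ}
    (𝓔 : LinkedBundle S s n d) (c : ℕ) where
  two_le : 2 ≤ c
  le_two_mul : c ≤ 2 * n
  /-- the pairings `⟨ , ⟩_{i,j}` -/
  B : ∀ i j : Fin n, Pairing (𝓔.E i) (𝓔.E j)
  up_left : ∀ {i i' : Fin n} (h : i.val + 1 = i'.val) (j : Fin n) (U : S.Opens)
    (x : Γ(𝓔.E i, U)) (y : Γ(𝓔.E j, U)),
    (B i' j).pair U ((𝓔.up h).app U x) y =
      resTop s U ^ epsLower c i' j * (B i j).pair U x y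
  up_right : ∀ (i : Fin n) {j j' : Fin n} (h : j.val + 1 = j'.val) (U : S.Opens)
    (x : Γ(𝓔.E i, U)) (y : Γ(𝓔.E j, U)),
    (B i j').pair U x ((𝓔.up h).app U y) =
      resTop s U ^ epsLower c i j' * (B i j).pair U x y
  down_left : ∀ {i i' : Fin n} (h : i.val + 1 = i'.val) (j : Fin n) (U : S.Opens)
    (x : Γ(𝓔.E i', U)) (y : Γ(𝓔.E j, U)),
    (B i j).pair U ((𝓔.down h).app U x) y =
      resTop s U ^ epsUpper c i j * (B i' j).pair U x y
  down_right : ∀ (i : Fin n) {j j' : Fin n} (h : j.val + 1 = j'.val) (U : S.Opens)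
    (x : Γ(𝓔.E i, U)) (y : Γ(𝓔.E j', U)),
    (B i j).pair U x ((𝓔.down h).app U y) =
      resTop s U ^ epsUpper c i j * (B i j').pair U x y
  alternating : ∀ (i : Fin n) (U : S.Opens) (x : Γ(𝓔.E i, U)), (B i i).pair U x x = 0
  antisymm : ∀ i j : Fin n, i ≠ j → ∀ (U : S.Opens) (x : Γ(𝓔.E i, U)) (y : Γ(𝓔.E j, U)),
    (B i j).pair U x y = -(B j i).pair U y x

/-- A linked subbundle `𝓕 ⊆ φ^* E_•` is isotropic if for all `i, j` the pullback to `φ^* E_•` of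
the pairing `⟨ , ⟩_{i,j}` vanishes on `F_i × F_j`. -/
def LinkedSubBundle.IsIsotropic {S : Scheme.{u}} {s : Γ(S, ⊤)} {n d : ℕ}
    {𝓔 : LinkedBundle S s n d} {r : ℕ} {T : Scheme.{u}} {φ : T ⟶ S}
    (𝓕 : LinkedSubBundle 𝓔 r φ) {c : ℕ} (ω : LinkedAlternatingForm 𝓔 c) : Prop :=
  ∀ i j : Fin n, ∃ B' : Pairing (pb φ (𝓔.E i)) (pb φ (𝓔.E j)), (ω.B i j).IsPullback φ B' ∧
    ∀ (U : T.Opens), ∀ x ∈ (𝓕.F i).sec U, ∀ y ∈ (𝓕.F j).sec U, B'.pair U x y = 0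

/-- The closed subscheme `ι : A ⟶ L` of the linked Grassmannian `L` is the linked alternating
Grassmannian `LAG(r, E_•, ⟨ , ⟩_•)`: a morphism `ψ : T ⟶ L` factors through `A` if and only if
the linked subbundle `ψ^* 𝓤` is isotropic. -/
structure IsLinkedAlternatingGrassmannian {S : Scheme.{u}} {s : Γ(S, ⊤)} {n d : ℕ}
    {𝓔 : LinkedBundle S s n d} {c : ℕ} (ω : LinkedAlternatingForm 𝓔 c) {r : ℕ} {L : Scheme.{u}}
    {π : L ⟶ S} (𝓤 : LinkedSubBundle 𝓔 r π) {A : Scheme.{u}} (ι : A ⟶ L) : Prop where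
  isClosedImmersion : IsClosedImmersion ι
  factors_iff : ∀ {T : Scheme.{u}} (ψ : T ⟶ L) (𝓕 : LinkedSubBundle 𝓔 r (ψ ≫ π)),
    𝓤.IsPullback ψ rfl 𝓕 → ((∃ χ : T ⟶ A, χ ≫ ι = ψ) ↔ 𝓕.IsIsotropic ω)

/-! ### Smooth points, equations -/

/-- The point `p` of `X` is a smooth point of `X` over `S`: some open neighbourhood of `p` is
smooth over `S`. -/
def IsSmoothPoint {X S : Scheme.{u}} (π : X ⟶ S) (p : X) : Prop :=
  ∃ U : X.Opens, p ∈ U ∧ Smooth (U.ι ≫ π)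

/-- Locally at `p`, the closed subscheme `ι : A ⟶ X` is cut out by `N` equations: on some affine
open neighbourhood of `p`, its ideal is generated by `N` functions. -/
def IsLocallyCutOutBy {A X : Scheme.{u}} (ι : A ⟶ X) (p : X) (N : ℕ) : Prop :=
  ∃ (U : X.affineOpens) (_ : p ∈ U.1) (g : Fin N → Γ(X, U.1)),
    RingHom.ker (ι.app U.1).hom = Ideal.span (Set.range g)

end LinkedGrassmannian

end

open LinkedGrassmannian

/-! Near a point where the linked Grassmannian is smooth, the universal linked subbundle is
generated by only `r` sections `b k`, each living at its own position `pos k` of the chain: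
transporting them along the maps `f_i` and `f^i` to any position `j` gives generators of `F_j`. The
axioms of a linked form say that moving an argument by one step multiplies the form by a power of
`s`. Hence every pairing of transported generators is a multiple of a pairing of the original ones
(`exists_gramForm_transportM`), and a pullback of the universal subbundle is isotropic as soon as
all `⟨b k, b l⟩` at positions `pos k`, `pos l` vanish. By antisymmetry the pairs `k < l` suffice,
which gives `r.choose 2` equations (`LinkedSubBundle.IsGeneratedBy.isLocallyCutOutBy`).

Generators are first found in the fibre at the point. If `s ≠ 0` there, the chain maps are
invertible and a basis at position `0` works. If `s = 0`, suppose that the fibre is exact, meaning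
that inside the chain `F` the kernel of each map is the image of the opposite map. Then complements
of "image from below plus image from above" in the spaces `F_i` generate everything, and a
telescoping dimension count shows that their dimensions add up to `r`
(`IsExactChain.exists_generators`). Generators in the fibre extend to a neighbourhood because the
determinant comparing them with a local basis is nonzero at the point (`SubBundle.exists_span_eq`).

Exactness is where smoothness enters (`isExactChain_of_smooth`). If it fails between `i` and `i +
1`, there are `v ∈ F_i` killed by `f_i` but not in `f^i F_{i+1}`, and, by counting dimensions, `v' ∈
F_{i+1}` killed by `f^i` but not in `f_i F_i`. Ambient exactness gives `v' = f_i t` and `v = f^i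
t'`. There is a first order deformation of `F` that moves `v` in direction `t` and `v'` in direction
`t'` (`IsAmbientChain.exists_obstructed_deformation`). By smoothness it lifts to `κ[ε]/(ε³)`.
Applying `f_i` to the lift of `v` and subtracting `ε` times the lift of `v'` leaves an element `ε²
(f_i y - t')` of the lifted `F_{i+1}`. So `f_i y₀ - t' ∈ F_{i+1}`, where `y₀` is `y` modulo `ε`, and
applying `-f^i` gives `v ∈ f^i F_{i+1}`, a contradiction (`false_of_lift`).

The remaining work translates sheaves into linear algebra. The pullback of a frame is a frame
(`IsFrame.pb`), so subbundles, maps and forms become submodules of coordinate vectors and matrices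
over rings of functions. -/

noncomputable section

namespace LinkedGrassmannian

/-! ### Sections of modules: restriction and pullback. -/

section ModuleSections

variable {X Y Z : Scheme.{u}}

section Res

variable {M N : X.Modules} {U V W : X.Opens}

@[simp] lemma res_res (h : V ≤ U) (h' : W ≤ V) (x : Γ(M, U)) :
    res h' (res h x) = res (h'.trans h) x := by
  simp only [res, ← ConcreteCategory.comp_apply, ← Functor.map_comp]; rfl

@[simp] lemma res_self (x : Γ(M, U)) : res le_rfl x = x := by
  simp [res]

@[simp] lemma res_smul (h : V ≤ U) (a : Γ(X, U)) (x : Γ(M, U)) :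
    res h (a • x) = resFun h a • res h x :=
  Scheme.Modules.map_smul _ _ _ _

@[simp] lemma res_add (h : V ≤ U) (x y : Γ(M, U)) : res h (x + y) = res h x + res h y :=
  map_add (M.presheaf.map (homOfLE h).op).hom _ _

@[simp] lemma res_zero (h : V ≤ U) : res h (0 : Γ(M, U)) = 0 :=
  map_zero (M.presheaf.map (homOfLE h).op).hom

@[simp] lemma res_sum {ι : Type*} (s : Finset ι) (h : V ≤ U) (x : ι → Γ(M, U)) :
    res h (∑ k ∈ s, x k) = ∑ k ∈ s, res h (x k) :=
  map_sum (M.presheaf.map (homOfLE h).op).hom _ _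

lemma res_app (f : M ⟶ N) (h : V ≤ U) (x : Γ(M, U)) :
    res h (f.app U x) = f.app V (res h x) :=
  (ConcreteCategory.congr_hom (f.mapPresheaf.naturality (homOfLE h).op) x).symm

/-- Restriction of functions as a ring homomorphism. -/
def resHom (h : V ≤ U) : Γ(X, U) →+* Γ(X, V) := (X.presheaf.map (homOfLE h).op).hom

lemma resFun_eq (h : V ≤ U) (a : Γ(X, U)) : resFun h a = resHom h a := rfl

@[simp] lemma resFun_resFun (h : V ≤ U) (h' : W ≤ V) (x : Γ(X, U)) :
    resFun h' (resFun h x) = resFun (h'.trans h) x := by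
  simp only [resFun, ← ConcreteCategory.comp_apply, ← Functor.map_comp]; rfl

@[simp] lemma resFun_self (x : Γ(X, U)) : resFun le_rfl x = x := by
  simp [resFun]

/-- A morphism of `𝒪`-modules from compatible linear maps on sections. -/
def mkHom (f : ∀ U : X.Opens, Γ(M, U) →+ Γ(N, U))
    (hsmul : ∀ (U : X.Opens) (a : Γ(X, U)) (x : Γ(M, U)), f U (a • x) = a • f U x)
    (hres : ∀ (U V : X.Opens) (h : V ≤ U) (x : Γ(M, U)), f V (res h x) = res h (f U x)) :
    M ⟶ N :=
  SheafOfModules.Hom.mk (PresheafOfModules.homMk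
    { app := fun U => AddCommGrpCat.ofHom (f U.unop)
      naturality := fun U V i => by
        ext x
        exact hres U.unop V.unop (leOfHom i.unop) x }
    (fun U a x => hsmul U.unop a x))

lemma hom_sum {ι : Type*} (s : Finset ι) (f : M ⟶ N) (x : ι → Γ(M, U)) :
    f.app U (∑ k ∈ s, x k) = ∑ k ∈ s, f.app U (x k) :=
  map_sum (f.app U).hom x s

end Res

section PullbackSections

variable {M N : Y.Modules} (φ : X ⟶ Y)

lemma res_pbSec {U V : Y.Opens} (h : V ≤ U) (x : Γ(M, U)) (h' : φ ⁻¹ᵁ V ≤ φ ⁻¹ᵁ U) :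
    res h' (pbSec φ x) = pbSec φ (res h x) :=
  res_app ((Scheme.Modules.pullbackPushforwardAdjunction φ).unit.app M) h x

lemma pbSec_smul {U : Y.Opens} (a : Γ(Y, U)) (x : Γ(M, U)) :
    pbSec φ (a • x) = φ.app U a • pbSec φ x :=
  Scheme.Modules.Hom.app_smul ((Scheme.Modules.pullbackPushforwardAdjunction φ).unit.app M) a x

lemma pbSec_sum {ι : Type*} (s : Finset ι) {U : Y.Opens} (x : ι → Γ(M, U)) :
    pbSec φ (∑ k ∈ s, x k) = ∑ k ∈ s, pbSec φ (x k) :=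
  hom_sum s _ x

lemma pbMap_pbSec (f : M ⟶ N) {U : Y.Opens} (x : Γ(M, U)) :
    (pbMap φ f).app (φ ⁻¹ᵁ U) (pbSec φ x) = pbSec φ (f.app U x) :=
  (congr_arg (fun g => Scheme.Modules.Hom.app g U x)
    ((Scheme.Modules.pullbackPushforwardAdjunction φ).unit.naturality f)).symm

/-- Under the adjunction a morphism out of `φ^* M` corresponds to its composite with the unit, and
the unit is `pbSec`. So pulled back sections suffice to test equality, although they are far from
being all sections. -/
lemma pb_hom_ext {P : X.Modules} {f g : pb φ M ⟶ P}
    (h : ∀ (U : Y.Opens) (x : Γ(M, U)),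
      f.app (φ ⁻¹ᵁ U) (pbSec φ x) = g.app (φ ⁻¹ᵁ U) (pbSec φ x)) : f = g := by
  apply ((Scheme.Modules.pullbackPushforwardAdjunction φ).homEquiv _ _).injective
  rw [Adjunction.homEquiv_unit, Adjunction.homEquiv_unit]
  ext U x
  exact h U x

/-- The morphism `φ^* M ⟶ P` adjoint to a morphism `M ⟶ φ_* P`. -/
def pbDesc {P : X.Modules} (f : M ⟶ (Scheme.Modules.pushforward φ).obj P) : pb φ M ⟶ P :=
  ((Scheme.Modules.pullbackPushforwardAdjunction φ).homEquiv _ _).symm f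

lemma pbDesc_pbSec {P : X.Modules} (f : M ⟶ (Scheme.Modules.pushforward φ).obj P)
    {U : Y.Opens} (x : Γ(M, U)) : (pbDesc φ f).app (φ ⁻¹ᵁ U) (pbSec φ x) = f.app U x := by
  have := (Adjunction.homEquiv_unit (Scheme.Modules.pullbackPushforwardAdjunction φ)
    (f := pbDesc φ f)).symm.trans (Equiv.apply_symm_apply _ f)
  exact congr_arg (fun g => Scheme.Modules.Hom.app g U x) this

/-- `pullbackComp` is defined as the conjugate of the identification of direct images, so it matches
the units of the two adjunctions. This makes the canonical isomorphism computable on pulled back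
sections. -/
lemma pbCompHom_pbSec (ψ : X ⟶ Y) (φ : Y ⟶ Z) {φ' : X ⟶ Z} (h : ψ ≫ φ = φ') {M : Z.Modules}
    {U : Z.Opens} (x : Γ(M, U)) (h' : φ' ⁻¹ᵁ U = ψ ⁻¹ᵁ φ ⁻¹ᵁ U) :
    pbSecComp ψ φ h (pbSec φ x) = res h'.ge (pbSec φ' x) := by
  subst h
  have key := unit_conjugateEquiv
    ((Scheme.Modules.pullbackPushforwardAdjunction φ).comp
      (Scheme.Modules.pullbackPushforwardAdjunction ψ))
    (Scheme.Modules.pullbackPushforwardAdjunction (ψ ≫ φ)) (Scheme.Modules.pullbackComp ψ φ).inv M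
  rw [Scheme.Modules.conjugateEquiv_pullbackComp_inv] at key
  have key2 : pbSec ψ (pbSec φ x) =
      ((Scheme.Modules.pullbackComp ψ φ).inv.app M).app _ (pbSec (ψ ≫ φ) x) :=
    congr_arg (fun g => Scheme.Modules.Hom.app g U x) key
  have e1 : (Scheme.Modules.pullbackCongr (rfl : ψ ≫ φ = ψ ≫ φ)).hom.app M = 𝟙 _ := rfl
  have e2 : res h'.ge (pbSec (ψ ≫ φ) x) = pbSec (ψ ≫ φ) x := res_self _
  have e3 : (Scheme.Modules.pullbackComp ψ φ).inv.app M ≫ pbCompHom ψ φ rfl M = 𝟙 _ := by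
    rw [pbCompHom, e1, Category.comp_id, Iso.inv_hom_id_app]
  rw [e2]
  have e4 := congr_arg (fun g => Scheme.Modules.Hom.app g (ψ ⁻¹ᵁ φ ⁻¹ᵁ U) (pbSec (ψ ≫ φ) x)) e3
  rw [pbSecComp, key2]
  exact e4

end PullbackSections

end ModuleSections

/-! ### The sheaf `j_* j^* M` for an open immersion `j`. -/

section RestrictionToOpen

variable {X Y Z : Scheme.{u}}

section OnOpen

variable (W : X.Opens)

/-- The sheaf `V ↦ Γ(M, V ∩ W)`. -/
abbrev onOpen (M : X.Modules) : X.Modules :=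
  (Scheme.Modules.pushforward W.ι).obj (M.restrict W.ι)

/-- The open subset `V ∩ W`, in the form in which it occurs in `onOpen`. -/
abbrev cut (V : X.Opens) : X.Opens := W.ι ''ᵁ W.ι ⁻¹ᵁ V

lemma cut_le_left (V : X.Opens) : cut W V ≤ V := W.ι.image_preimage_le V

lemma cut_le_right (V : X.Opens) : cut W V ≤ W := by
  rintro _ ⟨x, -, rfl⟩; exact x.2

lemma cut_mono {V V' : X.Opens} (h : V ≤ V') : cut W V ≤ cut W V' :=
  Set.image_mono (fun _ hx => h hx)

lemma le_cut {V : X.Opens} (h : V ≤ W) : V ≤ cut W V :=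
  fun x hx => ⟨⟨x, h hx⟩, hx, rfl⟩

variable {W} {M : X.Modules} {V : X.Opens}

/-- A section of `onOpen W M` as a section of `M`. -/
def onOpenSec : Γ(onOpen W M, V) →+ Γ(M, cut W V) := AddMonoidHom.id Γ(M, cut W V)

/-- A section of `M` as a section of `onOpen W M`. -/
def toOnOpen : Γ(M, cut W V) →+ Γ(onOpen W M, V) := AddMonoidHom.id Γ(M, cut W V)

lemma onOpenSec_toOnOpen (x : Γ(M, cut W V)) : onOpenSec (toOnOpen x) = x := rfl

/-- The scalar acts through the identification of functions on the open subscheme with functions on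
its image; composed with pullback along `W.ι`, this identification is plain restriction. -/
lemma onOpenSec_smul (a : Γ(X, V)) (x : Γ(onOpen W M, V)) :
    onOpenSec (a • x) = resFun (cut_le_left W V) a • onOpenSec x := by
  have h := ConcreteCategory.congr_hom (W.ι.app_appIso_inv V) a
  have : resFun (cut_le_left W V) a = (W.ι.appIso (W.ι ⁻¹ᵁ V)).inv (W.ι.app V a) := h.symm
  rw [this]
  rfl

lemma onOpenSec_res {V' : X.Opens} (h : V' ≤ V) (x : Γ(onOpen W M, V)) :
    onOpenSec (res h x) = res (cut_mono W h) (onOpenSec x) := rfl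

lemma toOnOpen_res {V' : X.Opens} (h : V' ≤ V) (x : Γ(M, cut W V)) :
    res h (toOnOpen (W := W) (V := V) x) = toOnOpen (res (cut_mono W h) x) := rfl

lemma toOnOpen_smul (a : Γ(X, V)) (x : Γ(M, cut W V)) :
    a • toOnOpen (W := W) x = toOnOpen (resFun (cut_le_left W V) a • x) := by
  change toOnOpen (onOpenSec (a • toOnOpen (W := W) x)) = _
  rw [onOpenSec_smul]; rfl

end OnOpen

end RestrictionToOpen

/-! ### Frames, and the pullback of a frame. -/

section Frames

variable {X Y Z : Scheme.{u}}

section Frame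

variable {M : X.Modules} {U V V' : X.Opens} {ι : Type} [Fintype ι] {e : ι → Γ(M, U)}

/-- The coordinate isomorphism given by a frame. -/
def IsFrame.vec (he : IsFrame e) (h : V ≤ U) : (ι → Γ(X, V)) ≃ₗ[Γ(X, V)] Γ(M, V) :=
  LinearEquiv.ofBijective
    { toFun := fun a => ∑ k, a k • res h (e k)
      map_add' := fun a b => by simp [add_smul, Finset.sum_add_distrib]
      map_smul' := fun a b => by simp [Finset.smul_sum, mul_smul] } (he V h)

lemma IsFrame.vec_apply (he : IsFrame e) (h : V ≤ U) (a : ι → Γ(X, V)) :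
    he.vec h a = ∑ k, a k • res h (e k) := rfl

lemma IsFrame.res_vec (he : IsFrame e) (h : V ≤ U) (h' : V' ≤ V) (a : ι → Γ(X, V)) :
    res h' (he.vec h a) = he.vec (h'.trans h) (fun k => resFun h' (a k)) := by
  simp [IsFrame.vec_apply]

lemma IsFrame.vec_symm_res (he : IsFrame e) (h : V ≤ U) (h' : V' ≤ V) (x : Γ(M, V)) :
    (he.vec (h'.trans h)).symm (res h' x) = fun k => resFun h' ((he.vec h).symm x k) := by
  rw [LinearEquiv.symm_apply_eq, ← he.res_vec h h', LinearEquiv.apply_symm_apply]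

lemma IsFrame.restrict (he : IsFrame e) (h : V ≤ U) : IsFrame fun k => res h (e k) := by
  intro V' h'
  simpa using he V' (h'.trans h)

end Frame

lemma preimage_le (φ : X ⟶ Y) {U V : Y.Opens} (h : V ≤ U) : φ ⁻¹ᵁ V ≤ φ ⁻¹ᵁ U :=
  fun _ hx => h hx

lemma sum_app {M N : X.Modules} {ι : Type*} (s : Finset ι) (f : ι → (M ⟶ N)) (V : X.Opens)
    (y : Γ(M, V)) : (∑ k ∈ s, f k).app V y = ∑ k ∈ s, (f k).app V y := by
  classical
  induction s using Finset.induction_on with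
  | empty => rfl
  | insert a s ha ih => rw [Finset.sum_insert ha, Finset.sum_insert ha, ← ih]; rfl

lemma app_resFun (φ : X ⟶ Y) {U V : Y.Opens} (h : V ≤ U) (h' : φ ⁻¹ᵁ V ≤ φ ⁻¹ᵁ U) (a : Γ(Y, U)) :
    φ.app V (resFun h a) = resFun h' (φ.app U a) :=
  ConcreteCategory.congr_hom (φ.naturality (homOfLE h).op) a

section PullbackFrame

variable (X) in
/-- The structure sheaf as a module. -/
abbrev unitMod : X.Modules := SheafOfModules.unit X.ringCatSheaf

/-- A function as a section of the structure sheaf. -/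
def ofFun {V : X.Opens} : Γ(X, V) →+ Γ(unitMod X, V) := AddMonoidHom.id Γ(X, V)

/-- A section of the structure sheaf as a function. -/
def toFun {V : X.Opens} : Γ(unitMod X, V) →+ Γ(X, V) := AddMonoidHom.id Γ(X, V)

lemma toFun_smul {V : X.Opens} (a : Γ(X, V)) (x : Γ(unitMod X, V)) :
    toFun (a • x) = a * toFun x := rfl

lemma res_ofFun {V V' : X.Opens} (h : V' ≤ V) (a : Γ(X, V)) :
    res h (ofFun a) = ofFun (resFun h a) := rfl

lemma toFun_res {V V' : X.Opens} (h : V' ≤ V) (x : Γ(unitMod X, V)) :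
    toFun (res h x) = resFun h (toFun x) := rfl

/-- The action of `mulSec` on sections. -/
def mulSecFun {N : X.Modules} {W : X.Opens} (t : Γ(N, W)) (V : X.Opens) :
    Γ(onOpen W (unitMod X), V) →+ Γ(onOpen W N, V) :=
  (toOnOpen (W := W) (V := V)).comp
    (((smulAddHom Γ(X, cut W V) Γ(N, cut W V)).flip (res (cut_le_right W V) t)).comp
      (toFun.comp onOpenSec))

lemma mulSecFun_apply {N : X.Modules} {W : X.Opens} (t : Γ(N, W)) (V : X.Opens)
    (a : Γ(onOpen W (unitMod X), V)) : mulSecFun t V a =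
      toOnOpen (W := W) (V := V) (toFun (onOpenSec a) • res (cut_le_right W V) t) := rfl

/-- A section of `N` over `W` gives a morphism `𝒪|_W ⟶ N|_W`. -/
def mulSec {N : X.Modules} {W : X.Opens} (t : Γ(N, W)) : onOpen W (unitMod X) ⟶ onOpen W N :=
  mkHom (mulSecFun t)
    (fun V a x => by
      rw [mulSecFun_apply, mulSecFun_apply, toOnOpen_smul, onOpenSec_smul, toFun_smul, mul_smul])
    (fun V V' h x => by
      rw [mulSecFun_apply, mulSecFun_apply, toOnOpen_res, onOpenSec_res, toFun_res, res_smul,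
        res_res])

variable {M : Y.Modules} {U : Y.Opens} {ι : Type} [Fintype ι] {e : ι → Γ(M, U)} (φ : X ⟶ Y)

lemma cut_preimage_le (V : Y.Opens) : cut (φ ⁻¹ᵁ U) (φ ⁻¹ᵁ V) ≤ φ ⁻¹ᵁ (V ⊓ U) :=
  le_inf (cut_le_left _ _) (cut_le_right _ _)

/-- The action of `coordPush` on sections. -/
def IsFrame.coordFun (he : IsFrame e) (k : ι) (V : Y.Opens) :
    Γ(M, V) →+ Γ(onOpen (φ ⁻¹ᵁ U) (unitMod X), φ ⁻¹ᵁ V) :=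
  (toOnOpen (W := φ ⁻¹ᵁ U) (V := φ ⁻¹ᵁ V)).comp (ofFun.comp
    ((resHom (cut_preimage_le φ V)).toAddMonoidHom.comp
      ((φ.app (V ⊓ U)).hom.toAddMonoidHom.comp ((Pi.evalAddMonoidHom _ k).comp
        ((he.vec inf_le_right).symm.toLinearMap.toAddMonoidHom.comp
          (M.presheaf.map (homOfLE (inf_le_left : V ⊓ U ≤ V)).op).hom)))))

lemma IsFrame.coordFun_apply (he : IsFrame e) (k : ι) (V : Y.Opens) (x : Γ(M, V)) :
    he.coordFun φ k V x = toOnOpen (W := φ ⁻¹ᵁ U) (V := φ ⁻¹ᵁ V)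
        (ofFun (resFun (cut_preimage_le φ V) (φ.app (V ⊓ U)
          ((he.vec inf_le_right).symm (res inf_le_left x) k)))) := rfl

lemma ofFun_mul {V : X.Opens} (a b : Γ(X, V)) : ofFun (a * b) = a • ofFun b := rfl

/-- The coordinate functions of a frame, as morphisms to the direct image. -/
def IsFrame.coordPush (he : IsFrame e) (k : ι) :
    M ⟶ (Scheme.Modules.pushforward φ).obj (onOpen (φ ⁻¹ᵁ U) (unitMod X)) :=
  mkHom (he.coordFun φ k)
    (fun V a x => by
      have : he.coordFun φ k V (a • x) = (φ.app V a) • he.coordFun φ k V x := by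
        rw [coordFun_apply, coordFun_apply, toOnOpen_smul, res_smul, map_smul, Pi.smul_apply,
          smul_eq_mul, map_mul, app_resFun φ inf_le_left (preimage_le φ inf_le_left)]
        rw [resFun_eq (cut_preimage_le φ V), map_mul, ofFun_mul, ← resFun_eq, resFun_resFun]
        rfl
      exact this)
    (fun V V' h x => by
      have h1 := he.vec_symm_res (V := V ⊓ U) (V' := V' ⊓ U) inf_le_right
        (inf_le_inf_right _ h) (res inf_le_left x)
      rw [res_res] at h1
      have : he.coordFun φ k V' (res h x) =
          res (preimage_le φ h) (he.coordFun φ k V x) := by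
        rw [coordFun_apply, coordFun_apply, res_res, h1, toOnOpen_res,
          app_resFun φ (inf_le_inf_right _ h) (preimage_le φ (inf_le_inf_right _ h)), resFun_resFun,
          res_ofFun, resFun_resFun]
      exact this)

lemma IsFrame.coordPush_app (he : IsFrame e) (k : ι) (V : Y.Opens) (x : Γ(M, V)) :
    (he.coordPush φ k).app V x = toOnOpen (W := φ ⁻¹ᵁ U) (V := φ ⁻¹ᵁ V)
        (ofFun (resFun (cut_preimage_le φ V) (φ.app (V ⊓ U)
          ((he.vec inf_le_right).symm (res inf_le_left x) k)))) := rfl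

/-- The pullback of a frame is a frame. -/
theorem IsFrame.pb (he : IsFrame e) : IsFrame fun k => pbSec φ (e k) := by
  classical
  set W := φ ⁻¹ᵁ U with hW
  -- The coordinate functions of `e` are defined only over `U`, hence the target `𝒪` restricted to
  -- `W`. Their adjoints `β k` are the coordinates for the pulled back family, dual to it by `hβ`.
  let β : ∀ k, LinkedGrassmannian.pb φ M ⟶ onOpen W (unitMod X) :=
    fun k => pbDesc φ (he.coordPush φ k)
  have hβ : ∀ k l, onOpenSec ((β k).app W (pbSec φ (e l))) =
      ofFun (if k = l then 1 else 0) := by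
    intro k l
    change onOpenSec ((pbDesc φ (he.coordPush φ k)).app (φ ⁻¹ᵁ U) (pbSec φ (e l))) = _
    rw [pbDesc_pbSec, he.coordPush_app, onOpenSec_toOnOpen]
    congr 1
    have : (he.vec inf_le_right).symm (res (inf_le_left : U ⊓ U ≤ U) (e l)) =
        Pi.single l 1 := by
      rw [LinearEquiv.symm_apply_eq, IsFrame.vec_apply]
      simp [Pi.single_apply]
    rw [this, Pi.single_apply]
    split_ifs <;> simp [resFun]
  intro V h
  constructor
  · intro a b hab
    -- For `V ≤ W` the open set `cut W V` is `V` itself, so nothing is lost by this restriction.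
    have hres : Function.Injective (resFun (cut_le_left W V)) := by
      intro x y hxy
      simpa using congr_arg (resFun (le_cut W h)) hxy
    funext k
    apply hres
    have key : ∀ c : ι → Γ(X, V), toFun (onOpenSec ((β k).app V
        (∑ l, c l • res h (pbSec φ (e l))))) = resFun (cut_le_left W V) (c k) := by
      intro c
      rw [hom_sum, map_sum, map_sum, Finset.sum_eq_single k]
      · rw [Scheme.Modules.Hom.app_smul, onOpenSec_smul, toFun_smul, ← res_app, onOpenSec_res,
          toFun_res, hβ]
        have : (toFun (ofFun (if k = k then 1 else 0)) : Γ(X, cut W W)) = 1 := if_pos rfl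
        rw [this]
        simp [resFun]
      · intro l _ hl
        rw [Scheme.Modules.Hom.app_smul, onOpenSec_smul, toFun_smul, ← res_app, onOpenSec_res,
          toFun_res, hβ]
        have : (toFun (ofFun (if k = l then 1 else 0)) : Γ(X, cut W W)) = 0 := if_neg hl.symm
        rw [this]
        simp [resFun]
      · simp
    have := congr_arg (fun x => toFun (onOpenSec ((β k).app V x))) hab
    rwa [key, key] at this
  -- Surjectivity: restriction to `W` is compared with the expansion `∑ β k • e k`, both seen as
  -- morphisms out of `φ^* M`. They agree on pulled back sections, where the expansion is the one in
  -- `M`, hence everywhere.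
  · let ρ : LinkedGrassmannian.pb φ M ⟶ onOpen W (LinkedGrassmannian.pb φ M) :=
      (Scheme.Modules.restrictAdjunction W.ι).unit.app _
    have hρ : ∀ (V : X.Opens) (y : Γ(LinkedGrassmannian.pb φ M, V)),
        onOpenSec (ρ.app V y) = res (cut_le_left W V) y := fun _ _ => rfl
    let σ : LinkedGrassmannian.pb φ M ⟶ onOpen W (LinkedGrassmannian.pb φ M) :=
      ∑ k, β k ≫ mulSec (pbSec φ (e k))
    have hσ : ∀ (V : X.Opens) (y : Γ(LinkedGrassmannian.pb φ M, V)), onOpenSec (σ.app V y) =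
        ∑ k, toFun (onOpenSec ((β k).app V y)) • res (cut_le_right W V) (pbSec φ (e k)) := by
      intro V y
      rw [sum_app, map_sum]
      rfl
    have hρσ : ρ = σ := by
      apply pb_hom_ext
      intro V x
      have : onOpenSec (ρ.app _ (pbSec φ x)) = onOpenSec (σ.app _ (pbSec φ x)) := by
        rw [hρ, hσ]
        have hx : res inf_le_left x = ∑ k, (he.vec inf_le_right).symm
            (res (inf_le_left : V ⊓ U ≤ V) x) k • res inf_le_right (e k) := by
          rw [← he.vec_apply, LinearEquiv.apply_symm_apply]
        have h2 : res (cut_le_left W (φ ⁻¹ᵁ V)) (pbSec φ x) =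
            res (cut_preimage_le φ V) (pbSec φ (res (inf_le_left : V ⊓ U ≤ V) x)) := by
          rw [← res_pbSec φ inf_le_left x (preimage_le φ inf_le_left), res_res]
        rw [h2, hx, pbSec_sum, res_sum]
        refine Finset.sum_congr rfl fun k _ => ?_
        rw [pbSec_smul, res_smul, ← res_pbSec φ inf_le_right _ (preimage_le φ inf_le_right),
          res_res,
          pbDesc_pbSec, he.coordPush_app]
        rfl
      exact this
    intro y
    refine ⟨fun k => resFun (le_cut W h) (toFun (onOpenSec ((β k).app V y))), ?_⟩
    have h1 := (hρ V y).symm.trans ((congr_arg (fun g => onOpenSec (Scheme.Modules.Hom.app g V y))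
      hρσ).trans (hσ V y))
    have h2 := congr_arg (res (le_cut W h)) h1
    simp only [res_res, res_sum, res_smul, res_self] at h2
    exact h2.symm

end PullbackFrame

end Frames

/-! ### Transport along a chain of maps. -/

section Transport

variable {A B : Type*} [Monoid A] [Monoid B] (u w : ℕ → A)

/-- The product of `m` consecutive steps upwards, starting at position `i`. -/
def stepsUp (i : ℕ) : ℕ → A
  | 0 => 1
  | m + 1 => u (i + m) * stepsUp i m

/-- The product of `m` consecutive steps downwards, ending at position `j`. -/
def stepsDown : ℕ → ℕ → A
  | _, 0 => 1
  | j, m + 1 => w j * stepsDown (j + 1) m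

/-- The transport from position `i` to position `j` of a chain. -/
def transport (i j : ℕ) : A :=
  if i ≤ j then stepsUp u i (j - i) else stepsDown w j (i - j)

@[simp] lemma transport_self (i : ℕ) : transport u w i i = 1 := by
  simp [transport, stepsUp]

lemma transport_succ {i j : ℕ} (h : i ≤ j) :
    transport u w i (j + 1) = u j * transport u w i j := by
  rw [transport, transport, if_pos h, if_pos (h.trans (Nat.le_succ j)),
    show j + 1 - i = (j - i) + 1 by omega, stepsUp, show i + (j - i) = j by omega]

lemma transport_pred {i j : ℕ} (h : j < i) :
    transport u w i j = w j * transport u w i (j + 1) := by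
  rw [transport, if_neg h.not_ge, show i - j = (i - (j + 1)) + 1 by omega, stepsDown]
  rcases eq_or_lt_of_le (Nat.succ_le_of_lt h) with h' | h'
  · subst h'; simp [stepsDown]
  · rw [transport, if_neg h'.not_ge]

lemma stepsDown_succ (j m : ℕ) : stepsDown w j (m + 1) = stepsDown w j m * w (j + m) := by
  induction m generalizing j with
  | zero => simp [stepsDown]
  | succ m ih =>
    rw [stepsDown, ih, stepsDown, mul_assoc, show j + 1 + m = j + (m + 1) by omega]

/-- Peels a step off the source, while `transport_pred` peels one off the target. The deformations
built below contain the transport to position `0` as a function of the source, which is why this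
form is needed. -/
lemma transport_succ_zero (j : ℕ) :
    transport u w (j + 1) 0 = transport u w j 0 * w j := by
  rcases Nat.eq_zero_or_pos j with rfl | h
  · rw [transport_pred u w (Nat.zero_lt_one)]; simp
  · rw [transport, transport, if_neg (by omega), if_neg (by omega), Nat.sub_zero, Nat.sub_zero,
      stepsDown_succ, zero_add]

lemma map_transport (f : A →* B) (i j : ℕ) :
    f (transport u w i j) = transport (fun k => f (u k)) (fun k => f (w k)) i j := by
  have h1 : ∀ m, f (stepsUp u i m) = stepsUp (fun k => f (u k)) i m := by
    intro m
    induction m with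
    | zero => simp [stepsUp]
    | succ m ih => simp [stepsUp, ih]
  have h2 : ∀ m j, f (stepsDown w j m) = stepsDown (fun k => f (w k)) j m := by
    intro m
    induction m with
    | zero => simp [stepsDown]
    | succ m ih => simp [stepsDown, ih]
  simp only [transport]
  split_ifs
  · exact h1 _
  · exact h2 _ _

/-- Any property stable under single steps inside the chain passes to transports in either
direction. It serves for membership in subchains as well as for identities between matrices. -/
lemma transport_induction {n i : ℕ} (hi : i < n) {P : ℕ → A → Prop} (h1 : P i 1)
    (hu : ∀ j a, j + 1 < n → P j a → P (j + 1) (u j * a))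
    (hw : ∀ j a, j + 1 < n → P (j + 1) a → P j (w j * a)) {j : ℕ} (hj : j < n) :
    P j (transport u w i j) := by
  rcases le_total i j with h | h
  · induction j, h using Nat.le_induction with
    | base => simpa
    | succ j h ih =>
      rw [transport_succ u w h]
      exact hu _ _ hj (ih (by omega))
  · obtain ⟨m, hm⟩ := Nat.exists_eq_add_of_le h
    induction m generalizing j with
    | zero => obtain rfl : i = j := by omega
              simpa
    | succ m ih =>
      rw [transport_pred u w (by omega)]
      exact hw _ _ (by omega) (ih (j := j + 1) (by omega) (by omega) (by omega))

end Transport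

/-! ### Linear algebra: generators of an exact chain of subspaces. -/

section Generators

variable {κ V : Type*} [Field κ] [AddCommGroup V] [Module κ V]

/-- A sequence of subspaces preserved by the maps of a chain of length `n`. -/
structure IsSubchain (n : ℕ) (u w : ℕ → Module.End κ V) (F : ℕ → Submodule κ V) : Prop where
  up : ∀ {i}, i + 1 < n → ∀ {x}, x ∈ F i → u i x ∈ F (i + 1)
  down : ∀ {i}, i + 1 < n → ∀ {x}, x ∈ F (i + 1) → w i x ∈ F i

variable {n r : ℕ} {u w : ℕ → Module.End κ V} {F : ℕ → Submodule κ V}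

/-- Rank-nullity for the restriction of `f` to `P`. -/
lemma finrank_map_add_finrank_ker_inf [FiniteDimensional κ V] (f : Module.End κ V)
    (P : Submodule κ V) :
    Module.finrank κ (P.map f) + Module.finrank κ (LinearMap.ker f ⊓ P : Submodule κ V) =
      Module.finrank κ P := by
  have h := LinearMap.finrank_range_add_finrank_ker (f.domRestrict P)
  rw [LinearMap.range_domRestrict] at h
  rw [← h, LinearMap.ker_domRestrict]
  congr 1
  rw [inf_comm]
  exact (Submodule.finrank_map_subtype_eq P _).symm.trans
    (by rw [Submodule.map_comap_subtype]) |>.symm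

lemma IsSubchain.transport_mem (hF : IsSubchain n u w F) {i j : ℕ} (hi : i < n) (hj : j < n)
    {x : V} (hx : x ∈ F i) : transport u w i j x ∈ F j := by
  exact transport_induction u w (P := fun j a => a x ∈ F j) hi (by simpa)
    (fun j a hj h => hF.up hj h) (fun j a hj h => hF.down hj h) hj

/-- The chain of subspaces is exact, and the images and kernels are independent. -/
structure IsExactChain (n : ℕ) (u w : ℕ → Module.End κ V) (F : ℕ → Submodule κ V) : Prop
    extends IsSubchain n u w F where
  up_down : ∀ {i}, i + 1 < n → ∀ x, u i (w i x) = 0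
  down_up : ∀ {i}, i + 1 < n → ∀ x, w i (u i x) = 0
  exists_down : ∀ {i}, i + 1 < n → ∀ {x}, x ∈ F i → u i x = 0 → ∃ y ∈ F (i + 1), w i y = x
  exists_up : ∀ {i}, i + 1 < n → ∀ {x}, x ∈ F (i + 1) → w i x = 0 → ∃ y ∈ F i, u i y = x
  up_up : ∀ {i}, i + 2 < n → ∀ {x}, x ∈ F i → u (i + 1) (u i x) = 0 → u i x = 0

/-- The image from below. -/
def fromBelow (u : ℕ → Module.End κ V) (F : ℕ → Submodule κ V) : ℕ → Submodule κ V
  | 0 => ⊥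
  | i + 1 => (F i).map (u i)

/-- The image from above in a chain of length `n`. -/
def fromAbove (n : ℕ) (w : ℕ → Module.End κ V) (F : ℕ → Submodule κ V) (i : ℕ) :
    Submodule κ V :=
  if i + 1 < n then (F (i + 1)).map (w i) else ⊥

/-- A vector coming from above is killed by the next upward map, and `up_up` says that a vector
coming from below is killed by it only if it is zero. -/
lemma IsExactChain.disjoint (hF : IsExactChain n u w F) {i : ℕ} (hi : i < n) :
    Disjoint (fromBelow u F i) (fromAbove n w F i) := by
  rw [Submodule.disjoint_def]
  intro x hx hx'
  rw [fromAbove] at hx'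
  split_ifs at hx' with h
  · cases i with
    | zero => exact hx
    | succ i =>
      obtain ⟨y, hy, rfl⟩ := hx
      obtain ⟨z, hz, hzy⟩ := hx'
      refine hF.up_up h hy ?_
      rw [← hzy, hF.up_down h]
  · exact hx'

lemma IsExactChain.fromAbove_eq (hF : IsExactChain n u w F) {i : ℕ} (hi : i + 1 < n) :
    fromAbove n w F i = LinearMap.ker (u i) ⊓ F i := by
  rw [fromAbove, if_pos hi]
  ext x
  constructor
  · rintro ⟨y, hy, rfl⟩
    exact ⟨hF.up_down hi y, hF.down hi hy⟩
  · rintro ⟨hx, hx'⟩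
    exact hF.exists_down hi hx' hx

lemma IsExactChain.le (hF : IsExactChain n u w F) {i : ℕ} (hi : i < n) :
    fromBelow u F i ⊔ fromAbove n w F i ≤ F i := by
  apply sup_le
  · cases i with
    | zero => exact bot_le
    | succ i => rintro _ ⟨y, hy, rfl⟩; exact hF.up hi hy
  · rw [fromAbove]
    split_ifs with h
    · rintro _ ⟨y, hy, rfl⟩; exact hF.down h hy
    · exact bot_le

/-- What a space receives from below is generated by the complements below it: on moving up, the
part that came from above dies because it is the kernel. The same holds in the other direction, so
nothing beyond the complements is needed. -/
lemma IsExactChain.le_iSup (hF : IsExactChain n u w F) {C : ℕ → Submodule κ V}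
    (hC : ∀ i < n, C i ⊔ (fromBelow u F i ⊔ fromAbove n w F i) = F i) {j : ℕ} (hj : j < n) :
    F j ≤ ⨆ i, ⨆ (_ : i < n), (C i).map (transport u w i j) := by
  have hup : ∀ j < n, fromBelow u F j ≤ ⨆ i, ⨆ (_ : i < j), (C i).map (transport u w i j) := by
    intro j hj
    induction j with
    | zero => exact bot_le
    | succ j ih =>
      rw [fromBelow, ← hC j (by omega), Submodule.map_sup, Submodule.map_sup]
      refine sup_le ?_ (sup_le ?_ ?_)
      · refine le_iSup₂_of_le j (Nat.lt_succ_self j) ?_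
        rw [transport_succ u w le_rfl, transport_self, mul_one]
      · refine (Submodule.map_mono (ih (by omega))).trans ?_
        rw [Submodule.map_iSup]
        refine iSup_le fun i => ?_
        rw [Submodule.map_iSup]
        refine iSup_le fun hi => le_iSup₂_of_le i (by omega) ?_
        rw [transport_succ u w hi.le, ← Submodule.map_comp]
        rfl
      · rw [hF.fromAbove_eq hj]
        rintro _ ⟨y, hy, rfl⟩
        rw [show u j y = 0 from hy.1]
        exact zero_mem _
  -- `m` counts the positions above `j`, so this is induction from the top of the chain downwards.
  have hdown : ∀ m j, j + m + 1 = n → fromAbove n w F j ≤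
      ⨆ i, ⨆ (_ : j < i ∧ i < n), (C i).map (transport u w i j) := by
    intro m
    induction m with
    | zero =>
      intro j hj
      rw [fromAbove, if_neg (by omega)]
      exact bot_le
    | succ m ih =>
      intro j hj
      have hj' : j + 1 < n := by omega
      rw [fromAbove, if_pos hj', ← hC (j + 1) hj', Submodule.map_sup, Submodule.map_sup]
      refine sup_le ?_ (sup_le ?_ ?_)
      · refine le_iSup₂_of_le (j + 1) ⟨by omega, hj'⟩ ?_
        rw [transport_pred u w (by omega), transport_self, mul_one]
      · rintro _ ⟨_, ⟨y, hy, rfl⟩, rfl⟩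
        rw [hF.down_up hj']
        exact zero_mem _
      · refine (Submodule.map_mono (ih (j + 1) (by omega))).trans ?_
        rw [Submodule.map_iSup]
        refine iSup_le fun i => ?_
        rw [Submodule.map_iSup]
        refine iSup_le fun hi => le_iSup₂_of_le i (by omega) ?_
        rw [transport_pred u w (show j < i by omega), ← Submodule.map_comp]
        rfl
  rw [← hC j hj]
  refine sup_le ?_ (sup_le ((hup j hj).trans ?_) ((hdown (n - 1 - j) j (by omega)).trans ?_))
  · refine le_iSup₂_of_le j hj ?_
    rw [transport_self]
    exact (Submodule.map_id _).ge
  · exact iSup_le fun i => iSup_le fun hi => le_iSup₂_of_le i (by omega) le_rfl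
  · exact iSup_le fun i => iSup_le fun hi => le_iSup₂_of_le i hi.2 le_rfl

/-- By `h1` and `h2` the dimension of `C i` is the growth of the dimension of the image from below
between positions `i` and `i + 1`, so the sum telescopes. At the last position nothing comes from
above, which makes the total `r`. -/
lemma IsExactChain.sum_finrank [FiniteDimensional κ V] (hF : IsExactChain n u w F)
    (hr : ∀ i < n, Module.finrank κ (F i) = r) {C : ℕ → Submodule κ V}
    (hC : ∀ i < n, C i ⊔ (fromBelow u F i ⊔ fromAbove n w F i) = F i)
    (hC' : ∀ i < n, Disjoint (C i) (fromBelow u F i ⊔ fromAbove n w F i)) (hn : 0 < n) :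
    ∑ i ∈ Finset.range n, Module.finrank κ (C i) = r := by
  have h1 : ∀ i < n, Module.finrank κ (C i) + (Module.finrank κ (fromBelow u F i) +
      Module.finrank κ (fromAbove n w F i)) = r := by
    intro i hi
    have a := Submodule.finrank_sup_add_finrank_inf_eq (fromBelow u F i) (fromAbove n w F i)
    have b := Submodule.finrank_sup_add_finrank_inf_eq (C i)
      (fromBelow u F i ⊔ fromAbove n w F i)
    rw [(hF.disjoint hi).eq_bot, finrank_bot, add_zero] at a
    rw [(hC' i hi).eq_bot, finrank_bot, add_zero, hC i hi, hr i hi] at b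
    omega
  have h2 : ∀ i, i + 1 < n → Module.finrank κ (fromBelow u F (i + 1)) +
      Module.finrank κ (fromAbove n w F i) = r := by
    intro i hi
    rw [hF.fromAbove_eq hi, fromBelow, finrank_map_add_finrank_ker_inf, hr i (by omega)]
  have h3 : ∀ m < n, ∑ i ∈ Finset.range m, Module.finrank κ (C i) =
      Module.finrank κ (fromBelow u F m) := by
    intro m hm
    induction m with
    | zero =>
      rw [Finset.range_zero, Finset.sum_empty]
      exact (finrank_bot κ V).symm
    | succ m ih =>
      rw [Finset.sum_range_succ, ih (by omega)]
      have := h1 m (by omega)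
      have := h2 m hm
      omega
  obtain ⟨m, rfl⟩ : ∃ m, n = m + 1 := ⟨n - 1, by omega⟩
  rw [Finset.sum_range_succ, h3 m (by omega)]
  have := h1 m (by omega)
  have h4 : fromAbove (m + 1) w F m = ⊥ := by rw [fromAbove, if_neg (by omega)]
  rw [h4, finrank_bot] at this
  omega

/-- An exact chain of `r`-dimensional spaces is generated by `r` vectors at suitable positions. -/
theorem IsExactChain.exists_generators [FiniteDimensional κ V] (hF : IsExactChain n u w F)
    (hr : ∀ i < n, Module.finrank κ (F i) = r) (hn : 0 < n) :
    ∃ (pos : Fin r → ℕ) (v : Fin r → V), (∀ k, pos k < n) ∧ (∀ k, v k ∈ F (pos k)) ∧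
      ∀ j < n, F j = Submodule.span κ (Set.range fun k => transport u w (pos k) j (v k)) := by
  have hC : ∀ i, ∃ C : Submodule κ V, i < n →
      C ⊔ (fromBelow u F i ⊔ fromAbove n w F i) = F i ∧
        Disjoint C (fromBelow u F i ⊔ fromAbove n w F i) := by
    intro i
    by_cases hi : i < n
    · obtain ⟨C, hC⟩ := exists_isCompl (fromBelow u F i ⊔ fromAbove n w F i)
      refine ⟨C ⊓ F i, fun _ => ⟨?_, hC.disjoint.symm.mono_left inf_le_left⟩⟩
      rw [sup_comm, ← sup_inf_assoc_of_le _ (hF.le hi), hC.sup_eq_top, top_inf_eq]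
    · exact ⟨⊥, fun h => absurd h hi⟩
  choose C hC using hC
  have hCF : ∀ i < n, C i ≤ F i := fun i hi => le_sup_left.trans (hC i hi).1.le
  -- The union of bases of the complements has exactly `r` elements, so it can be indexed by `Fin
  -- r`.
  have hcard : Fintype.card (Σ i : Fin n, Fin (Module.finrank κ (C i))) = r := by
    rw [Fintype.card_sigma]
    simp only [Fintype.card_fin]
    rw [Fin.sum_univ_eq_sum_range (fun i => Module.finrank κ (C i))]
    exact hF.sum_finrank hr (fun i hi => (hC i hi).1) (fun i hi => (hC i hi).2) hn
  let e := (Fintype.equivFinOfCardEq hcard).symm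
  refine ⟨fun k => (e k).1, fun k => Module.finBasis κ (C (e k).1) (e k).2, fun k => (e k).1.2,
    fun k => hCF _ (e k).1.2 (SetLike.coe_mem _), fun j hj => le_antisymm ?_ ?_⟩
  · refine (hF.le_iSup (fun i hi => (hC i hi).1) hj).trans (iSup_le fun i => iSup_le fun hi => ?_)
    have hspan : C i = Submodule.span κ
        (Set.range fun l => (Module.finBasis κ (C i) l : V)) := by
      have := congr_arg (Submodule.map (C i).subtype) (Module.finBasis κ (C i)).span_eq
      rw [Submodule.map_span, Submodule.map_top, Submodule.range_subtype, ← Set.range_comp] at this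
      exact this.symm
    rw [hspan, Submodule.map_span, Submodule.span_le]
    rintro _ ⟨_, ⟨l, rfl⟩, rfl⟩
    refine Submodule.subset_span ⟨e.symm ⟨⟨i, hi⟩, l⟩, ?_⟩
    have h := e.apply_symm_apply ⟨⟨i, hi⟩, l⟩
    beta_reduce
    generalize e (e.symm ⟨⟨i, hi⟩, l⟩) = p at h ⊢
    subst h
    rfl
  · rw [Submodule.span_le]
    rintro _ ⟨k, rfl⟩
    exact hF.transport_mem (e k).1.2 hj (hCF _ (e k).1.2 (SetLike.coe_mem _))

/-- If the maps of the chain are invertible, a basis at position `0` generates. -/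
theorem IsSubchain.exists_generators_of_isUnit [FiniteDimensional κ V] (hF : IsSubchain n u w F)
    {s : κ} (hs : s ≠ 0) (hdu : ∀ i, i + 1 < n → ∀ x, w i (u i x) = s • x)
    (hr : ∀ i < n, Module.finrank κ (F i) = r) (hn : 0 < n) :
    ∃ (pos : Fin r → ℕ) (v : Fin r → V), (∀ k, pos k < n) ∧ (∀ k, v k ∈ F (pos k)) ∧
      ∀ j < n, F j = Submodule.span κ (Set.range fun k => transport u w (pos k) j (v k)) := by
  have hr0 := hr 0 hn
  subst hr0
  -- Since `w j ∘ u j` is multiplication by `s ≠ 0`, each `u j` is injective, and equality of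
  -- dimensions turns `u j (F j) ≤ F (j + 1)` into an equality.
  have hmap : ∀ j < n, F j = (F 0).map (transport u w 0 j) := by
    intro j hj
    induction j with
    | zero => rw [transport_self]; exact (Submodule.map_id _).symm
    | succ j ih =>
      rw [transport_succ u w (Nat.zero_le j)]
      have : (F 0).map (u j * transport u w 0 j) = (F j).map (u j) := by
        rw [ih (by omega), ← Submodule.map_comp]; rfl
      rw [this]
      symm
      apply Submodule.eq_of_le_of_finrank_eq
      · rintro _ ⟨y, hy, rfl⟩; exact hF.up hj hy
      · have hinj : Function.Injective (u j) := by
          intro x y hxy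
          have := congr_arg (w j) hxy
          rw [hdu j hj, hdu j hj] at this
          exact smul_right_injective V hs this
        rw [hr _ hj, ← hr j (by omega)]
        exact (Submodule.equivMapOfInjective (u j) hinj (F j)).finrank_eq.symm
  refine ⟨fun _ => 0, fun k => Module.finBasis κ (F 0) k, fun _ => hn,
    fun k => SetLike.coe_mem _, fun j hj => ?_⟩
  have hspan : F 0 = Submodule.span κ (Set.range fun l => (Module.finBasis κ (F 0) l : V)) := by
    have := congr_arg (Submodule.map (F 0).subtype) (Module.finBasis κ (F 0)).span_eq
    rw [Submodule.map_span, Submodule.map_top, Submodule.range_subtype, ← Set.range_comp] at this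
    exact this.symm
  rw [hmap j hj]
  conv_lhs => rw [hspan]
  rw [Submodule.map_span, ← Set.range_comp]
  rfl

end Generators

/-! ### Obstructed first order deformations at non-exact points. -/

section Obstruction

variable {κ V : Type*} [Field κ] [AddCommGroup V] [Module κ V]

/-- The ambient chain on fibres where `s = 0`. -/
structure IsAmbientChain (n : ℕ) (u w : ℕ → Module.End κ V) : Prop where
  up_down : ∀ {i}, i + 1 < n → ∀ x, u i (w i x) = 0
  down_up : ∀ {i}, i + 1 < n → ∀ x, w i (u i x) = 0
  exists_down : ∀ {i}, i + 1 < n → ∀ {x}, u i x = 0 → ∃ y, w i y = x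
  exists_up : ∀ {i}, i + 1 < n → ∀ {x}, w i x = 0 → ∃ y, u i y = x
  up_up : ∀ {i}, i + 2 < n → ∀ {x}, u (i + 1) (u i x) = 0 → u i x = 0
  down_down : ∀ {i}, i + 2 < n → ∀ {x}, w i (w (i + 1) x) = 0 → w (i + 1) x = 0

/-- The chain read backwards. -/
def rev (n : ℕ) (u : ℕ → Module.End κ V) (i : ℕ) : Module.End κ V := u (n - 2 - i)

variable {n r : ℕ} {u w : ℕ → Module.End κ V} {F : ℕ → Submodule κ V}

/-- The axioms are symmetric under reversal. Position `i` becomes `n - 1 - i`, so the step between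
`i` and `i + 1` becomes step `n - 2 - i`. -/
lemma IsAmbientChain.rev (h : IsAmbientChain n u w) :
    IsAmbientChain n (rev n w) (rev n u) where
  up_down hi x := h.down_up (by omega) x
  down_up hi x := h.up_down (by omega) x
  exists_down hi _ hx := h.exists_up (by omega) hx
  exists_up hi _ hx := h.exists_down (by omega) hx
  up_up {i} hi x hx := by
    have := @IsAmbientChain.down_down _ _ _ _ _ _ _ _ h (n - 2 - (i + 1)) (by omega) x
    rw [show n - 2 - (i + 1) + 1 = n - 2 - i by omega] at this
    exact this hx
  down_down {i} hi x hx := by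
    have := @IsAmbientChain.up_up _ _ _ _ _ _ _ _ h (n - 2 - (i + 1)) (by omega) x
    rw [show n - 2 - (i + 1) + 1 = n - 2 - i by omega] at this
    exact this hx

/-- A family of endomorphisms that is compatible with the chain modulo `F`, i.e. a first order
deformation of `F` as a linked subspace. -/
structure IsDeformation (n : ℕ) (u w : ℕ → Module.End κ V) (F : ℕ → Submodule κ V)
    (φ : ℕ → Module.End κ V) : Prop where
  up : ∀ {j}, j + 1 < n → ∀ {x}, x ∈ F j → u j (φ j x) - φ (j + 1) (u j x) ∈ F (j + 1)
  down : ∀ {j}, j + 1 < n → ∀ {x}, x ∈ F (j + 1) → w j (φ (j + 1) x) - φ j (w j x) ∈ F j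

lemma IsDeformation.add {φ ψ : ℕ → Module.End κ V} (hφ : IsDeformation n u w F φ)
    (hψ : IsDeformation n u w F ψ) : IsDeformation n u w F (fun j => φ j + ψ j) where
  up hj x hx := by
    have := add_mem (hφ.up hj hx) (hψ.up hj hx)
    simp only [LinearMap.add_apply, map_add]
    rwa [add_sub_add_comm]
  down hj x hx := by
    have := add_mem (hφ.down hj hx) (hψ.down hj hx)
    simp only [LinearMap.add_apply, map_add]
    rwa [add_sub_add_comm]

/-- By `down_down` a vector already in the image of a downward map is never killed by further
downward maps unless it is zero. Hence linear relations among such vectors can be read off at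
position `0`. -/
lemma IsAmbientChain.transport_zero_injOn (h : IsAmbientChain n u w) {j : ℕ} (hj : j + 1 < n)
    (y : V) (hy : transport u w j 0 (w j y) = 0) : w j y = 0 := by
  induction j generalizing y with
  | zero => simpa using hy
  | succ j ih =>
    rw [transport_succ_zero] at hy
    exact h.down_down hj (ih (by omega) _ hy)

/-- One functional `l` at position `0`, zero on the transport of `w i (F (i + 1))` and nonzero on
that of `v`, controls all positions `j ≤ i`: a vector is measured by `l` after transport to `0` and
sent to a multiple of the transport of `t`. Above `i` the deformation is zero, which leaves room for
a second one built from the other end. -/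
lemma IsAmbientChain.exists_deformation (h : IsAmbientChain n u w) {i : ℕ}
    (hi : i + 1 < n) {v t : V} (hv : u i v = 0) (hv' : v ∉ (F (i + 1)).map (w i))
    (ht : u i t ∈ F (i + 1)) :
    ∃ φ : ℕ → Module.End κ V, IsDeformation n u w F φ ∧ φ i v = t ∧ ∀ j, i < j → φ j = 0 := by
  obtain ⟨v', rfl⟩ := h.exists_down hi hv
  have hD : transport u w i 0 (w i v') ∉
      ((F (i + 1)).map (w i)).map (transport u w i 0) := by
    rintro ⟨_, ⟨x, hx, rfl⟩, hx'⟩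
    refine hv' ⟨x, hx, ?_⟩
    rw [← sub_eq_zero, ← map_sub]
    apply h.transport_zero_injOn hi
    rw [map_sub, map_sub, hx', sub_self]
  obtain ⟨l, hl, hl'⟩ := Submodule.exists_le_ker_of_notMem hD
  let φ : ℕ → Module.End κ V := fun j => if j ≤ i then
    (l ∘ₗ transport u w j 0).smulRight ((l (transport u w i 0 (w i v')))⁻¹ • transport u w i j t)
    else 0
  have hφ : ∀ j ≤ i, ∀ x, φ j x = l (transport u w j 0 x) •
      ((l (transport u w i 0 (w i v')))⁻¹ • transport u w i j t) := by
    intro j hj x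
    simp [φ, hj]
  have hφ' : ∀ j, i < j → φ j = 0 := fun j hj => if_neg hj.not_ge
  refine ⟨φ, ⟨?_, ?_⟩, ?_, hφ'⟩
  -- Below `i` both terms vanish because a step down followed or preceded by the opposite step up is
  -- zero. At `j = i` the result is a multiple of `u i t`, which lies in `F (i + 1)`.
  · intro j hj x hx
    rcases lt_trichotomy j i with hji | rfl | hji
    · rw [hφ _ hji.le, hφ _ (Nat.succ_le_of_lt hji), transport_succ_zero, Module.End.mul_apply,
        h.down_up hj, transport_pred u w hji, map_smul, map_smul, Module.End.mul_apply,
        h.up_down hj]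
      simp
    · rw [hφ _ le_rfl, hφ' _ (Nat.lt_succ_self j), transport_self]
      simp only [map_smul, LinearMap.zero_apply, sub_zero]
      exact Submodule.smul_mem _ _ (Submodule.smul_mem _ _ ht)
    · rw [hφ' _ hji, hφ' _ (hji.trans (Nat.lt_succ_self j))]
      simp
  -- Below `i` the family commutes with the downward maps exactly. At `j = i` the choice of `l`
  -- kills the images of `F (i + 1)`.
  · intro j hj x hx
    rcases lt_trichotomy j i with hji | rfl | hji
    · rw [hφ _ hji.le, hφ _ (Nat.succ_le_of_lt hji), transport_succ_zero, Module.End.mul_apply,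
        transport_pred u w hji, map_smul, map_smul, Module.End.mul_apply, sub_self]
      exact zero_mem _
    · rw [hφ _ le_rfl, hφ' _ (Nat.lt_succ_self j)]
      have : l (transport u w j 0 (w j x)) = 0 := hl' ⟨_, ⟨x, hx, rfl⟩, rfl⟩
      simp [this]
    · rw [hφ' _ hji, hφ' _ (hji.trans (Nat.lt_succ_self j))]
      simp
  · rw [hφ _ le_rfl, transport_self, Module.End.one_apply, smul_smul, mul_inv_cancel₀ hl, one_smul]

/-- Exactness at the images of the downward maps suffices. -/
lemma IsSubchain.isExactChain [FiniteDimensional κ V] (hF : IsSubchain n u w F)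
    (h : IsAmbientChain n u w) (hr : ∀ i < n, Module.finrank κ (F i) = r)
    (hdown : ∀ {i}, i + 1 < n → ∀ {v}, v ∈ F i → u i v = 0 → v ∈ (F (i + 1)).map (w i)) :
    IsExactChain n u w F where
  toIsSubchain := hF
  up_down := h.up_down
  down_up := h.down_up
  exists_down hi _ hx hx0 := hdown hi hx hx0
  exists_up {i} hi x hx hx0 := by
    have h1 := finrank_map_add_finrank_ker_inf (u i) (F i)
    have h2 := finrank_map_add_finrank_ker_inf (w i) (F (i + 1))
    rw [hr i (by omega)] at h1
    rw [hr _ hi] at h2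
    -- Both spaces have dimension `r`, so by rank-nullity exactness at `F i` forces `u i (F i)` to
    -- have at least the dimension of the kernel of `w i` on `F (i + 1)`, in which it is contained.
    have h3 : (LinearMap.ker (u i) ⊓ F i : Submodule κ V) ≤ (F (i + 1)).map (w i) :=
      fun x hx => hdown hi hx.2 hx.1
    have h4 : (F i).map (u i) ≤ (LinearMap.ker (w i) ⊓ F (i + 1) : Submodule κ V) := by
      rintro _ ⟨y, hy, rfl⟩
      exact ⟨h.down_up hi y, hF.up hi hy⟩
    have h5 := Submodule.finrank_mono h3
    have h6 := Submodule.eq_of_le_of_finrank_le h4 (by omega)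
    exact h6.ge ⟨hx0, hx⟩
  up_up hi _ _ hx := h.up_up hi hx

/-- At a point where exactness fails there is an obstructed first order deformation. -/
theorem IsAmbientChain.exists_obstructed_deformation [FiniteDimensional κ V]
    (h : IsAmbientChain n u w) (hF : IsSubchain n u w F)
    (hr : ∀ i < n, Module.finrank κ (F i) = r) {i : ℕ} (hi : i + 1 < n) {v : V} (hv : v ∈ F i)
    (hv0 : u i v = 0) (hv' : v ∉ (F (i + 1)).map (w i)) :
    ∃ φ : ℕ → Module.End κ V, IsDeformation n u w F φ ∧
      ∃ v' ∈ F (i + 1), u i (φ i v) = v' ∧ w i (φ (i + 1) v') = v := by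
  -- Failure on one side forces failure on the other: otherwise the two rank-nullity equations, both
  -- with total `r`, would contradict the strict inclusion of `w i (F (i + 1))` in the kernel of `u
  -- i` on `F i`.
  obtain ⟨v', hv'F, hv'0, hv''⟩ : ∃ v' ∈ F (i + 1), w i v' = 0 ∧ v' ∉ (F i).map (u i) := by
    by_contra! hcon
    have h1 := finrank_map_add_finrank_ker_inf (u i) (F i)
    have h2 := finrank_map_add_finrank_ker_inf (w i) (F (i + 1))
    rw [hr i (by omega)] at h1
    rw [hr _ hi] at h2
    have h3 : Module.finrank κ (LinearMap.ker (w i) ⊓ F (i + 1) : Submodule κ V) ≤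
        Module.finrank κ ((F i).map (u i)) :=
      Submodule.finrank_mono fun x hx => hcon x hx.2 hx.1
    have h4 : Module.finrank κ ((F (i + 1)).map (w i)) <
        Module.finrank κ (LinearMap.ker (u i) ⊓ F i : Submodule κ V) := by
      apply Submodule.finrank_lt_finrank_of_lt
      refine lt_of_le_of_ne ?_ fun heq => hv' (heq ▸ ⟨hv0, hv⟩)
      rintro _ ⟨x, hx, rfl⟩
      exact ⟨h.up_down hi x, hF.down hi hx⟩
    omega
  obtain ⟨t, rfl⟩ := h.exists_up hi hv'0
  obtain ⟨t', rfl⟩ := h.exists_down hi hv0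
  obtain ⟨φ, hφ, hφv, hφ0⟩ := h.exists_deformation (F := F) hi hv0 hv' hv'F
  have hi' : n - 2 - (n - 2 - i) = i := by omega
  -- The same construction for the reversed chain gives a deformation living at positions `≥ i + 1`.
  -- It does not disturb `φ i v = t`, and `φ` does not disturb its value `t'` at `v'`, so the sum
  -- has both prescribed values.
  obtain ⟨ψ, hψ, hψv, hψ0⟩ := h.rev.exists_deformation (F := fun j => F (n - 1 - j))
    (i := n - 2 - i) (v := u i t) (t := t') (by omega)
    (by rw [LinkedGrassmannian.rev, hi', hv'0])
    (by
      rw [LinkedGrassmannian.rev, hi', show n - 1 - (n - 2 - i + 1) = i by omega]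
      exact hv'')
    (by
      rw [LinkedGrassmannian.rev, hi', show n - 1 - (n - 2 - i + 1) = i by omega]
      exact hv)
  refine ⟨fun j => φ j + ψ (n - 1 - j), hφ.add ⟨?_, ?_⟩, u i t, hv'F, ?_, ?_⟩
  · intro j hj x hx
    have := @IsDeformation.down _ _ _ _ _ _ _ _ _ _ hψ (n - 2 - j) (by omega) x
      (by rwa [show n - 1 - (n - 2 - j + 1) = j by omega])
    rw [LinkedGrassmannian.rev, show n - 2 - (n - 2 - j) = j by omega,
      show n - 2 - j + 1 = n - 1 - j by omega, show n - 1 - (n - 2 - j) = j + 1 by omega] at this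
    rwa [show n - 1 - (j + 1) = n - 2 - j by omega]
  · intro j hj x hx
    have := @IsDeformation.up _ _ _ _ _ _ _ _ _ _ hψ (n - 2 - j) (by omega) x
      (by rwa [show n - 1 - (n - 2 - j) = j + 1 by omega])
    rw [LinkedGrassmannian.rev, show n - 2 - (n - 2 - j) = j by omega,
      show n - 2 - j + 1 = n - 1 - j by omega, show n - 1 - (n - 1 - j) = j by omega] at this
    rwa [show n - 1 - (j + 1) = n - 2 - j by omega]
  · rw [LinearMap.add_apply, hφv, hψ0 _ (by omega)]
    simp
  · rw [LinearMap.add_apply, hφ0 _ (Nat.lt_succ_self i), show n - 1 - (i + 1) = n - 2 - i by omega,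
      hψv]
    simp

end Obstruction

/-! ### The second order obstruction. -/

section NoLift

variable {κ R : Type*} [Field κ] [CommRing R] {d : ℕ}

open Matrix in
/-- The obstructed deformation does not lift to second order. -/
theorem false_of_lift (c : κ →+* R) (q : R →+* κ) (hqc : ∀ a, q (c a) = a) {ε : R}
    (hε : ε ^ 3 = 0) (hq : ∀ a, ε ^ 2 * a = 0 → q a = 0)
    {u w : Matrix (Fin d) (Fin d) κ} {G : Submodule κ (Fin d → κ)}
    (hwu : ∀ x, w *ᵥ (u *ᵥ x) = 0) {F' G' : Submodule R (Fin d → R)}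
    (hup : ∀ x ∈ F', u.map c *ᵥ x ∈ G')
    (hG' : ∀ y : Fin d → R, ε ^ 2 • y ∈ G' → ∃ f ∈ G', ε ^ 2 • y = ε ^ 2 • f)
    (hG : ∀ f ∈ G', (fun k => q (f k)) ∈ G)
    {v v' t t' : Fin d → κ} (hv0 : u *ᵥ v = 0) (ht : u *ᵥ t = v') (ht' : w *ᵥ t' = v)
    (hv : ∃ y : Fin d → R, (fun k => c (v k)) + ε • (fun k => c (t k)) + ε ^ 2 • y ∈ F')
    (hv' : ∃ y : Fin d → R, (fun k => c (v' k)) + ε • (fun k => c (t' k)) + ε ^ 2 • y ∈ G')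
    (hvG : ∀ x ∈ G, w *ᵥ x ≠ v) : False := by
  obtain ⟨y, hy⟩ := hv
  obtain ⟨y', hy'⟩ := hv'
  have hc : ∀ x : Fin d → κ, u.map c *ᵥ (fun k => c (x k)) = fun k => c ((u *ᵥ x) k) := by
    intro x
    funext k
    exact (RingHom.map_mulVec c u x k).symm
  have h1 := hup _ hy
  rw [mulVec_add, mulVec_add, mulVec_smul, mulVec_smul, hc, hc, hv0, ht] at h1
  have h2 := G'.smul_mem ε hy'
  have h3 := G'.sub_mem h1 h2
  -- The terms of order one cancel because `u t = v'`, and `ε * ε ^ 2 * y'` vanishes because `ε ^ 3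
  -- = 0`.
  have h4 : ε ^ 2 • (u.map c *ᵥ y - fun k => c (t' k)) ∈ G' := by
    convert h3 using 1
    funext k
    simp only [Pi.smul_apply, Pi.sub_apply, Pi.add_apply, smul_eq_mul, Pi.zero_apply, map_zero]
    linear_combination (y' k) * hε
  obtain ⟨f, hf, hff⟩ := hG' _ h4
  have h5 : (fun k => q (f k)) = u *ᵥ (fun k => q (y k)) - t' := by
    funext k
    have h6 : q ((u.map c *ᵥ y - fun k => c (t' k)) k - f k) = 0 := by
      apply hq
      have := congr_fun hff k
      simp only [Pi.smul_apply, smul_eq_mul] at this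
      rw [mul_sub, this, sub_self]
    have h7 : q ((u.map c *ᵥ y) k) = (u *ᵥ (fun k => q (y k))) k := by
      simp [mulVec, dotProduct, hqc]
    rw [map_sub, Pi.sub_apply, map_sub, h7, hqc, sub_eq_zero] at h6
    rw [← h6, Pi.sub_apply]
  -- The negative of the reduction of `f` is `t' - u y₀`, with `y₀` the reduction of `y`. Applying
  -- `w` gives `w t' = v`, since `w u = 0`.
  have h8 := G.neg_mem (hG f hf)
  refine hvG _ h8 ?_
  rw [h5, neg_sub, mulVec_sub, ht', hwu, sub_zero]

end NoLift

/-! ### Pullback in coordinates: functions, maps and pairings. -/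

section PullbackOfFunctions

variable {X Y Z : Scheme.{u}}

section Pull

/-- The pullback of functions along `φ`. -/
def pull (φ : X ⟶ Y) {U : Y.Opens} {V : X.Opens} (h : V ≤ φ ⁻¹ᵁ U) : Γ(Y, U) →+* Γ(X, V) :=
  (φ.appLE U V h).hom

lemma pull_eq (φ : X ⟶ Y) {U : Y.Opens} {V : X.Opens} (h : V ≤ φ ⁻¹ᵁ U) (a : Γ(Y, U)) :
    pull φ h a = resFun h (φ.app U a) := by
  simp [pull, Scheme.Hom.appLE, resFun]

@[simp] lemma resFun_pull (φ : X ⟶ Y) {U : Y.Opens} {V V' : X.Opens} (h : V ≤ φ ⁻¹ᵁ U)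
    (h' : V' ≤ V) (a : Γ(Y, U)) : resFun h' (pull φ h a) = pull φ (h'.trans h) a := by
  simp [pull_eq]

@[simp] lemma pull_resFun (φ : X ⟶ Y) {U U' : Y.Opens} {V : X.Opens} (h : V ≤ φ ⁻¹ᵁ U')
    (h' : U' ≤ U) (a : Γ(Y, U)) :
    pull φ h (resFun h' a) = pull φ (h.trans (preimage_le φ h')) a := by
  simp only [pull_eq]
  rw [app_resFun φ h' (preimage_le φ h'), resFun_resFun]

lemma pull_pull (ψ : X ⟶ Y) (φ : Y ⟶ Z) {φ' : X ⟶ Z} (hφ : ψ ≫ φ = φ') {U : Z.Opens}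
    {V : Y.Opens} {W : X.Opens} (h : V ≤ φ ⁻¹ᵁ U) (h' : W ≤ ψ ⁻¹ᵁ V) (h'' : W ≤ φ' ⁻¹ᵁ U)
    (a : Γ(Z, U)) : pull ψ h' (pull φ h a) = pull φ' h'' a := by
  subst hφ
  have := Scheme.Hom.appLE_comp_appLE ψ φ U V W h h'
  exact ConcreteCategory.congr_hom this a

end Pull

section PullbackCoordinates

variable {M N : Z.Modules} {U : Z.Opens} {ι ι' : Type} [Fintype ι] [Fintype ι']
  {e : ι → Γ(M, U)} {e' : ι' → Γ(N, U)}

/-- The coordinates on the pullback of `M` with respect to the pullback of a frame. -/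
def IsFrame.pbVec (he : IsFrame e) (φ : Y ⟶ Z) {V : Y.Opens} (h : V ≤ φ ⁻¹ᵁ U) :
    (ι → Γ(Y, V)) ≃ₗ[Γ(Y, V)] Γ(LinkedGrassmannian.pb φ M, V) :=
  (he.pb φ).vec h

lemma IsFrame.pbVec_apply (he : IsFrame e) (φ : Y ⟶ Z) {V : Y.Opens} (h : V ≤ φ ⁻¹ᵁ U)
    (a : ι → Γ(Y, V)) : he.pbVec φ h a = ∑ k, a k • res h (pbSec φ (e k)) := rfl

lemma IsFrame.res_pbVec (he : IsFrame e) (φ : Y ⟶ Z) {V V' : Y.Opens} (h : V ≤ φ ⁻¹ᵁ U)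
    (h' : V' ≤ V) (a : ι → Γ(Y, V)) :
    res h' (he.pbVec φ h a) = he.pbVec φ (h'.trans h) (fun k => resFun h' (a k)) :=
  IsFrame.res_vec _ _ _ _

lemma IsFrame.res_pbSec_eq (he : IsFrame e) (φ : Y ⟶ Z) {V : Y.Opens} (h : V ≤ φ ⁻¹ᵁ U)
    (x : Γ(M, U)) : res h (pbSec φ x) =
      he.pbVec φ h (fun k => pull φ h ((he.vec le_rfl).symm x k)) := by
  conv_lhs => rw [← (he.vec le_rfl).apply_symm_apply x]
  rw [IsFrame.vec_apply, pbSec_sum, res_sum, IsFrame.pbVec_apply]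
  refine Finset.sum_congr rfl fun k _ => ?_
  rw [pbSec_smul, res_smul, res_self, pull_eq]

section

variable {N' : Y.Modules} {P : X.Modules} (ψ : X ⟶ Y) (f : pb ψ N' ⟶ P) {V V' : Y.Opens}

lemma app_pbSec_smul (a : Γ(Y, V)) (y : Γ(N', V)) :
    f.app (ψ ⁻¹ᵁ V) (pbSec ψ (a • y)) = ψ.app V a • f.app (ψ ⁻¹ᵁ V) (pbSec ψ y) := by
  rw [pbSec_smul, Scheme.Modules.Hom.app_smul]

lemma app_pbSec_sum {J : Type*} (s : Finset J) (y : J → Γ(N', V)) :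
    f.app (ψ ⁻¹ᵁ V) (pbSec ψ (∑ k ∈ s, y k)) = ∑ k ∈ s, f.app (ψ ⁻¹ᵁ V) (pbSec ψ (y k)) := by
  rw [pbSec_sum, hom_sum]

lemma res_app_pbSec (h : V' ≤ V) (y : Γ(N', V)) :
    res (preimage_le ψ h) (f.app (ψ ⁻¹ᵁ V) (pbSec ψ y)) =
      f.app (ψ ⁻¹ᵁ V') (pbSec ψ (res h y)) := by
  rw [res_app, res_pbSec ψ h]

end

lemma pbSecComp_eq (ψ : X ⟶ Y) (φ : Y ⟶ Z) {φ' : X ⟶ Z} (hφ : ψ ≫ φ = φ') {V : Y.Opens}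
    (y : Γ(pb φ M, V)) :
    pbSecComp ψ φ hφ y = (pbCompHom ψ φ hφ M).app (ψ ⁻¹ᵁ V) (pbSec ψ y) := rfl

lemma pbSecComp_smul (ψ : X ⟶ Y) (φ : Y ⟶ Z) {φ' : X ⟶ Z} (hφ : ψ ≫ φ = φ') {V : Y.Opens}
    (a : Γ(Y, V)) (y : Γ(pb φ M, V)) :
    pbSecComp ψ φ hφ (a • y) = ψ.app V a • pbSecComp ψ φ hφ y := by
  rw [pbSecComp_eq, pbSecComp_eq]
  exact app_pbSec_smul ψ _ a y

lemma pbSecComp_sum (ψ : X ⟶ Y) (φ : Y ⟶ Z) {φ' : X ⟶ Z} (hφ : ψ ≫ φ = φ') {V : Y.Opens}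
    {J : Type*} (s : Finset J) (y : J → Γ(pb φ M, V)) :
    pbSecComp ψ φ hφ (∑ k ∈ s, y k) = ∑ k ∈ s, pbSecComp ψ φ hφ (y k) := by
  simp only [pbSecComp_eq]
  exact app_pbSec_sum ψ _ s y

lemma res_pbSecComp (ψ : X ⟶ Y) (φ : Y ⟶ Z) {φ' : X ⟶ Z} (hφ : ψ ≫ φ = φ') {V V' : Y.Opens}
    (h : V' ≤ V) (y : Γ(pb φ M, V)) :
    res (preimage_le ψ h) (pbSecComp ψ φ hφ y) = pbSecComp ψ φ hφ (res h y) := by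
  rw [pbSecComp_eq, pbSecComp_eq]
  exact res_app_pbSec ψ _ h y

/-- In coordinates with respect to pulled back frames, the canonical isomorphism `ψ^* φ^* ≅ φ'^*`
disappears: pulling back a section is pulling back its coordinate functions. -/
lemma IsFrame.res_pbSecComp_pbVec (he : IsFrame e) (ψ : X ⟶ Y) (φ : Y ⟶ Z) {φ' : X ⟶ Z}
    (hφ : ψ ≫ φ = φ') {V : Y.Opens} {W : X.Opens} (h : V ≤ φ ⁻¹ᵁ U) (h' : W ≤ ψ ⁻¹ᵁ V)
    (h'' : W ≤ φ' ⁻¹ᵁ U) (a : ι → Γ(Y, V)) :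
    res h' (pbSecComp ψ φ hφ (he.pbVec φ h a)) = he.pbVec φ' h'' (fun k => pull ψ h' (a k)) := by
  rw [IsFrame.pbVec_apply, pbSecComp_sum, res_sum, IsFrame.pbVec_apply]
  refine Finset.sum_congr rfl fun k _ => ?_
  have hU : φ' ⁻¹ᵁ U = ψ ⁻¹ᵁ φ ⁻¹ᵁ U := by subst hφ; rfl
  rw [pbSecComp_smul, res_smul, ← pull_eq, ← res_pbSecComp, pbCompHom_pbSec ψ φ hφ _ hU, res_res,
    res_res]

/-- The matrix of a morphism with respect to frames. -/
def IsFrame.matrix (_he : IsFrame e) (he' : IsFrame e') (f : M ⟶ N) : Matrix ι' ι Γ(Z, U) :=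
  fun k l => (he'.vec le_rfl).symm (f.app U (e l)) k

lemma IsFrame.pbMap_pbVec (he : IsFrame e) (he' : IsFrame e') (f : M ⟶ N) (φ : Y ⟶ Z)
    {V : Y.Opens} (h : V ≤ φ ⁻¹ᵁ U) (a : ι → Γ(Y, V)) :
    (pbMap φ f).app V (he.pbVec φ h a) =
      he'.pbVec φ h (((he.matrix he' f).map (pull φ h)).mulVec a) := by
  have h1 : ∀ l, (pbMap φ f).app V (res h (pbSec φ (e l))) =
      he'.pbVec φ h (fun k => pull φ h (he.matrix he' f k l)) := by
    intro l
    rw [← res_app, pbMap_pbSec, he'.res_pbSec_eq]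
    rfl
  rw [IsFrame.pbVec_apply, hom_sum]
  simp only [Scheme.Modules.Hom.app_smul, h1]
  simp only [← map_smul]
  rw [← map_sum]
  congr 1
  funext k
  simp [Matrix.mulVec, dotProduct, mul_comm]

/-- The Gram matrix of a pairing with respect to frames. -/
def Pairing.gram (B : Pairing M N) (e : ι → Γ(M, U)) (e' : ι' → Γ(N, U)) :
    Matrix ι ι' Γ(Z, U) := fun k l => B.pair U (e k) (e' l)

lemma Pairing.IsPullback.pair_pbVec {φ : Y ⟶ Z} {B : Pairing M N}
    {B' : Pairing (pb φ M) (pb φ N)} (hB : B.IsPullback φ B') (he : IsFrame e)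
    (he' : IsFrame e') {V : Y.Opens} (h : V ≤ φ ⁻¹ᵁ U) (a : ι → Γ(Y, V)) (b : ι' → Γ(Y, V)) :
    B'.pair V (he.pbVec φ h a) (he'.pbVec φ h b) =
      dotProduct a (((B.gram e e').map (pull φ h)).mulVec b) := by
  have h1 : ∀ k l, B'.pair V (res h (pbSec φ (e k))) (res h (pbSec φ (e' l))) =
      pull φ h (B.gram e e' k l) := by
    intro k l
    rw [B'.pair_res, hB, pull_eq]; rfl
  simp only [IsFrame.pbVec_apply, map_sum, LinearMap.sum_apply, map_smul, LinearMap.smul_apply,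
    h1, dotProduct, Matrix.mulVec, Matrix.map_apply, smul_eq_mul, Finset.mul_sum]
  rw [Finset.sum_comm]
  refine Finset.sum_congr rfl fun k _ => Finset.sum_congr rfl fun l _ => ?_
  ring

lemma resFun_sum {V V' : X.Opens} (h : V' ≤ V) {J : Type*} (s : Finset J) (a : J → Γ(X, V)) :
    resFun h (∑ k ∈ s, a k) = ∑ k ∈ s, resFun h (a k) := by
  simp only [resFun_eq, map_sum]

lemma resFun_mul {V V' : X.Opens} (h : V' ≤ V) (a b : Γ(X, V)) :
    resFun h (a * b) = resFun h a * resFun h b := map_mul (resHom h) a b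

/-- The bilinear map with given Gram matrix in given coordinates. -/
def gramPairing {R P Q : Type*} [CommRing R] [AddCommGroup P] [Module R P] [AddCommGroup Q]
    [Module R Q] (f : (ι → R) ≃ₗ[R] P) (f' : (ι' → R) ≃ₗ[R] Q) (G : Matrix ι ι' R) :
    P →ₗ[R] Q →ₗ[R] R :=
  LinearMap.mk₂ R (fun x y => dotProduct (f.symm x) (G.mulVec (f'.symm y)))
    (by intros; simp [add_dotProduct]) (by intros; simp)
    (by intros; simp [Matrix.mulVec_add]) (by intros; simp [Matrix.mulVec_smul])

lemma gramPairing_apply {R P Q : Type*} [CommRing R] [AddCommGroup P] [Module R P]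
    [AddCommGroup Q] [Module R Q] (f : (ι → R) ≃ₗ[R] P) (f' : (ι' → R) ≃ₗ[R] Q)
    (G : Matrix ι ι' R) (a : ι → R) (b : ι' → R) :
    gramPairing f f' G (f a) (f' b) = dotProduct a (G.mulVec b) := by
  simp [gramPairing]

/-- The pullback of a pairing exists if the modules have frames on an open set that contains the
image of `φ`. -/
lemma Pairing.exists_isPullback (B : Pairing M N) (he : IsFrame e) (he' : IsFrame e') (φ : Y ⟶ Z)
    (hU : ⊤ ≤ φ ⁻¹ᵁ U) : ∃ B' : Pairing (pb φ M) (pb φ N), B.IsPullback φ B' := by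
  have hV : ∀ V : Y.Opens, V ≤ φ ⁻¹ᵁ U := fun V => le_top.trans hU
  let B' : Pairing (pb φ M) (pb φ N) :=
    { pair := fun V => gramPairing (he.pbVec φ (hV V)) (he'.pbVec φ (hV V))
        ((B.gram e e').map (pull φ (hV V)))
      pair_res := by
        intro V V' h x y
        obtain ⟨a, rfl⟩ := (he.pbVec φ (hV V)).surjective x
        obtain ⟨b, rfl⟩ := (he'.pbVec φ (hV V)).surjective y
        rw [he.res_pbVec, he'.res_pbVec, gramPairing_apply, gramPairing_apply]
        simp only [dotProduct, Matrix.mulVec, Matrix.map_apply, resFun_sum, resFun_mul,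
          resFun_pull] }
  have hB' : ∀ (V : Y.Opens) a b, B'.pair V (he.pbVec φ (hV V) a) (he'.pbVec φ (hV V) b) =
      dotProduct a (((B.gram e e').map (pull φ (hV V))).mulVec b) := by
    intro V a b
    exact gramPairing_apply _ _ _ _ _
  refine ⟨B', fun W x y => ?_⟩
  -- The image of `φ` lies in `U`, so replacing `W` by `W ⊓ U`, where the frames are available, does
  -- not change the preimage.
  have hW : φ ⁻¹ᵁ W ≤ φ ⁻¹ᵁ (W ⊓ U) := le_inf le_rfl (hV _)
  have hW' : φ ⁻¹ᵁ (W ⊓ U) ≤ φ ⁻¹ᵁ W := preimage_le φ inf_le_left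
  have inj : ∀ a b : Γ(Y, φ ⁻¹ᵁ W), resFun hW' a = resFun hW' b → a = b := by
    intro a b hab
    simpa using congr_arg (resFun hW) hab
  apply inj
  rw [← B'.pair_res, res_pbSec φ inf_le_left, res_pbSec φ inf_le_left,
    ← app_resFun φ inf_le_left, ← B.pair_res]
  obtain ⟨a, ha⟩ := (he.vec (inf_le_right : W ⊓ U ≤ U)).surjective (res inf_le_left x)
  obtain ⟨b, hb⟩ := (he'.vec (inf_le_right : W ⊓ U ≤ U)).surjective (res inf_le_left y)
  have h1 : pbSec φ (he.vec (inf_le_right : W ⊓ U ≤ U) a) =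
      he.pbVec φ (hV _) (fun k => φ.app _ (a k)) := by
    rw [IsFrame.vec_apply, pbSec_sum, IsFrame.pbVec_apply]
    refine Finset.sum_congr rfl fun k _ => ?_
    rw [pbSec_smul, ← res_pbSec φ inf_le_right _ (preimage_le φ inf_le_right)]
  have h2 : pbSec φ (he'.vec (inf_le_right : W ⊓ U ≤ U) b) =
      he'.pbVec φ (hV _) (fun k => φ.app _ (b k)) := by
    rw [IsFrame.vec_apply, pbSec_sum, IsFrame.pbVec_apply]
    refine Finset.sum_congr rfl fun k _ => ?_
    rw [pbSec_smul, ← res_pbSec φ inf_le_right _ (preimage_le φ inf_le_right)]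
  rw [← ha, ← hb, h1, h2, hB']
  simp only [IsFrame.vec_apply, map_sum, LinearMap.sum_apply, map_smul, LinearMap.smul_apply,
    B.pair_res, dotProduct, Matrix.mulVec, Matrix.map_apply, smul_eq_mul, Finset.mul_sum, map_mul]
  rw [Finset.sum_comm]
  refine Finset.sum_congr rfl fun k _ => Finset.sum_congr rfl fun l _ => ?_
  rw [app_resFun φ inf_le_right (preimage_le φ inf_le_right), pull_eq]
  simp only [Pairing.gram]
  ring

end PullbackCoordinates

end PullbackOfFunctions

/-! ### Subbundles and their pullbacks as modules of coordinate vectors. -/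

section CoordinateVectors

variable {X Y Z : Scheme.{u}}

section MapVec

variable {A B C ι : Type*} [CommRing A] [CommRing B] [CommRing C]

/-- The image of a vector under a ring homomorphism. -/
def mapVec (θ : A →+* B) (a : ι → A) : ι → B := fun k => θ (a k)

lemma mapVec_mapVec (θ : A →+* B) (η : B →+* C) (a : ι → A) :
    mapVec η (mapVec θ a) = mapVec (η.comp θ) a := rfl

lemma mapVec_add (θ : A →+* B) (a b : ι → A) :
    mapVec θ (a + b) = mapVec θ a + mapVec θ b := by
  funext k; simp [mapVec]

lemma mapVec_smul (θ : A →+* B) (t : A) (a : ι → A) :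
    mapVec θ (t • a) = θ t • mapVec θ a := by
  funext k; simp [mapVec]

lemma mapVec_zero (θ : A →+* B) : mapVec θ (0 : ι → A) = 0 := by
  funext k; simp [mapVec]

lemma mapVec_mem_span (θ : A →+* B) {S : Set (ι → A)} {a : ι → A}
    (ha : a ∈ Submodule.span A S) : mapVec θ a ∈ Submodule.span B (mapVec θ '' S) := by
  induction ha using Submodule.span_induction with
  | mem x hx => exact Submodule.subset_span ⟨x, hx, rfl⟩
  | zero => rw [mapVec_zero]; exact zero_mem _
  | add x y _ _ hx hy => rw [mapVec_add]; exact add_mem hx hy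
  | smul t x _ hx => rw [mapVec_smul]; exact Submodule.smul_mem _ _ hx

lemma mapVec_mulVec [Fintype ι] {ι' : Type*} (θ : A →+* B) (M : Matrix ι' ι A) (a : ι → A) :
    mapVec θ (M.mulVec a) = (M.map θ).mulVec (mapVec θ a) := by
  funext k
  exact RingHom.map_mulVec θ M a k

lemma map_dotProduct' [Fintype ι] (θ : A →+* B) (a b : ι → A) :
    θ (dotProduct a b) = dotProduct (mapVec θ a) (mapVec θ b) := by
  simp [dotProduct, mapVec]

end MapVec

section Coordinates

variable {M : Z.Modules} {U : Z.Opens} {ι : Type} [Fintype ι] {e : ι → Γ(M, U)} {r : ℕ}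

/-- The submodule of coordinate vectors of the sections of a subbundle. -/
def SubBundle.coord {φ : Y ⟶ Z} (F : SubBundle (pb φ M) r) (he : IsFrame e) {V : Y.Opens}
    (h : V ≤ φ ⁻¹ᵁ U) : Submodule Γ(Y, V) (ι → Γ(Y, V)) :=
  (F.sec V).comap (he.pbVec φ h).toLinearMap

variable {φ : Y ⟶ Z} {φ' : X ⟶ Z} {ψ : X ⟶ Y} {hφ : ψ ≫ φ = φ'}
  {F : SubBundle (pb φ M) r} {F' : SubBundle (pb φ' M) r} (he : IsFrame e)

lemma SubBundle.mem_coord {V : Y.Opens} {h : V ≤ φ ⁻¹ᵁ U} {a : ι → Γ(Y, V)} :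
    a ∈ F.coord he h ↔ he.pbVec φ h a ∈ F.sec V := Iff.rfl

lemma SubBundle.symm_mem_coord {V : Y.Opens} {h : V ≤ φ ⁻¹ᵁ U} {x : Γ(pb φ M, V)} :
    (he.pbVec φ h).symm x ∈ F.coord he h ↔ x ∈ F.sec V := by
  rw [SubBundle.mem_coord, LinearEquiv.apply_symm_apply]

lemma SubBundle.coord_res {V V' : Y.Opens} {h : V ≤ φ ⁻¹ᵁ U} (h' : V' ≤ V) {a : ι → Γ(Y, V)}
    (ha : a ∈ F.coord he h) : mapVec (resHom h') a ∈ F.coord he (h'.trans h) := by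
  have := F.res_mem h' _ ha
  rw [LinearEquiv.coe_coe, he.res_pbVec] at this
  exact this

lemma SubBundle.coord_of_local {V : Y.Opens} {h : V ≤ φ ⁻¹ᵁ U} {a : ι → Γ(Y, V)}
    (ha : ∀ p ∈ V, ∃ (V' : Y.Opens) (h' : V' ≤ V), p ∈ V' ∧
      mapVec (resHom h') a ∈ F.coord he (h'.trans h)) : a ∈ F.coord he h := by
  apply F.mem_of_local
  intro p hp
  obtain ⟨V', h', hp', ha'⟩ := ha p hp
  refine ⟨V', h', hp', ?_⟩
  rw [LinearEquiv.coe_coe, he.res_pbVec]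
  exact ha'

lemma IsFrame.mem_span_iff {V : Y.Opens} (h : V ≤ φ ⁻¹ᵁ U) (a : ι → Γ(Y, V))
    (S : Set (ι → Γ(Y, V))) :
    he.pbVec φ h a ∈ Submodule.span Γ(Y, V) (he.pbVec φ h '' S) ↔
      a ∈ Submodule.span Γ(Y, V) S := by
  have := Submodule.map_span (he.pbVec φ h).toLinearMap S
  rw [LinearEquiv.coe_coe] at this
  rw [← this]
  constructor
  · rintro ⟨b, hb, hb'⟩
    rwa [← (he.pbVec φ h).injective hb']
  · exact fun h => ⟨a, h, rfl⟩

lemma preimage_eq_of_comp_eq (hφ : ψ ≫ φ = φ') (U : Z.Opens) :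
    φ' ⁻¹ᵁ U = ψ ⁻¹ᵁ φ ⁻¹ᵁ U := by
  subst hφ; rfl

variable (F) in
/-- Near `p`, the vector `a` is a combination of pullbacks of sections of `F`. -/
def IsGenAt (ψ : X ⟶ Y) {W : X.Opens} (a : ι → Γ(X, W)) (p : X) : Prop :=
  ∃ (V : Y.Opens) (hV : V ≤ φ ⁻¹ᵁ U) (W' : X.Opens) (h₁ : W' ≤ W) (h₂ : W' ≤ ψ ⁻¹ᵁ V),
    p ∈ W' ∧ mapVec (resHom h₁) a ∈
      Submodule.span Γ(X, W') (mapVec (pull ψ h₂) '' (F.coord he hV : Set (ι → Γ(Y, V))))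

/-- The definition of pullback allows sections of `F` over any `V`; intersecting `V` with `φ ⁻¹ᵁ U`
makes coordinates available without changing anything near the point. -/
lemma isGenAt_iff (hφ : ψ ≫ φ = φ') {W : X.Opens} (hW : W ≤ φ' ⁻¹ᵁ U) (a : ι → Γ(X, W))
    (p : X) : (∃ (V : Y.Opens) (W' : X.Opens) (h₁ : W' ≤ W) (h₂ : W' ≤ ψ ⁻¹ᵁ V), p ∈ W' ∧
      res h₁ (he.pbVec φ' hW a) ∈ Submodule.span Γ(X, W')
        {t | ∃ y ∈ F.sec V, t = res h₂ (pbSecComp ψ φ hφ y)}) ↔ IsGenAt F he ψ a p := by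
  constructor
  · rintro ⟨V, W', h₁, h₂, hp', hx⟩
    have h₃ : W' ≤ ψ ⁻¹ᵁ (V ⊓ φ ⁻¹ᵁ U) :=
      le_inf h₂ ((h₁.trans hW).trans (preimage_eq_of_comp_eq hφ U).le)
    refine ⟨V ⊓ φ ⁻¹ᵁ U, inf_le_right, W', h₁, h₃, hp', ?_⟩
    rw [← he.mem_span_iff (φ := φ') (h₁.trans hW)]
    rw [he.res_pbVec] at hx
    refine Submodule.span_mono ?_ hx
    rintro _ ⟨y, hy, rfl⟩
    refine ⟨_, ⟨(he.pbVec φ inf_le_right).symm (res inf_le_left y), ?_, rfl⟩, ?_⟩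
    · exact (SubBundle.symm_mem_coord he).2 (F.res_mem _ _ hy)
    · have := he.res_pbSecComp_pbVec ψ φ hφ inf_le_right h₃ (h₁.trans hW)
        ((he.pbVec φ inf_le_right).symm (res inf_le_left y))
      rw [LinearEquiv.apply_symm_apply, ← res_pbSecComp, res_res] at this
      exact this.symm
  · rintro ⟨V, hV, W', h₁, h₂, hp', hx⟩
    refine ⟨V, W', h₁, h₂, hp', ?_⟩
    rw [← he.mem_span_iff (φ := φ') (h₁.trans hW)] at hx
    rw [he.res_pbVec]
    refine Submodule.span_mono ?_ hx
    rintro _ ⟨_, ⟨b, hb, rfl⟩, rfl⟩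
    exact ⟨_, hb, (he.res_pbSecComp_pbVec ψ φ hφ hV h₂ (h₁.trans hW) b).symm⟩

/-- Local description of the pullback in coordinates. -/
lemma SubBundle.IsPullback.mem_coord_iff (hF : SubBundle.IsPullback ψ φ hφ F F') {W : X.Opens}
    (hW : W ≤ φ' ⁻¹ᵁ U) (a : ι → Γ(X, W)) :
    a ∈ F'.coord he hW ↔ ∀ p ∈ W, IsGenAt F he ψ a p := by
  rw [SubBundle.mem_coord, hF]
  exact forall₂_congr fun p _ => isGenAt_iff he hφ hW a p

lemma SubBundle.isPullback_of_coord (hU : ⊤ ≤ φ' ⁻¹ᵁ U)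
    (H : ∀ (W : X.Opens) (a : ι → Γ(X, W)), a ∈ F'.coord he (le_top.trans hU) ↔
      ∀ p ∈ W, IsGenAt F he ψ a p) : SubBundle.IsPullback ψ φ hφ F F' := by
  intro W x
  have hW : W ≤ φ' ⁻¹ᵁ U := le_top.trans hU
  obtain ⟨a, rfl⟩ := (he.pbVec φ' hW).surjective x
  exact (H W a).trans (forall₂_congr fun p _ => (isGenAt_iff he hφ hW a p).symm)

lemma resHom_comp_resHom {V V' V'' : X.Opens} (h : V' ≤ V) (h' : V'' ≤ V') :
    (resHom h').comp (resHom h) = resHom (h'.trans h) := by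
  ext a
  exact resFun_resFun h h' a

variable {he} in
lemma IsGenAt.mem_span_of_le {V₁ V₂ : Y.Opens} {hV₁ : V₁ ≤ φ ⁻¹ᵁ U} {W W₁ W₂ : X.Opens}
    {h₁ : W₁ ≤ W} {h₁' : W₁ ≤ ψ ⁻¹ᵁ V₁} (h₂' : W₂ ≤ ψ ⁻¹ᵁ V₂)
    (hW : W₂ ≤ W₁) (hV : V₂ ≤ V₁) {a : ι → Γ(X, W)} (ha : mapVec (resHom h₁) a ∈
      Submodule.span Γ(X, W₁) (mapVec (pull ψ h₁') '' (F.coord he hV₁ : Set (ι → Γ(Y, V₁))))) :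
    mapVec (resHom (hW.trans h₁)) a ∈ Submodule.span Γ(X, W₂)
      (mapVec (pull ψ h₂') '' (F.coord he (hV.trans hV₁) : Set (ι → Γ(Y, V₂)))) := by
  have := mapVec_mem_span (resHom hW) ha
  rw [mapVec_mapVec, resHom_comp_resHom] at this
  refine Submodule.span_mono ?_ this
  rintro _ ⟨_, ⟨b, hb, rfl⟩, rfl⟩
  refine ⟨mapVec (resHom hV) b, SubBundle.coord_res he hV hb, ?_⟩
  funext k
  exact (pull_resFun ψ h₂' hV (b k)).trans (resFun_pull ψ h₁' hW (b k)).symm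

variable {he} in
lemma IsGenAt.add {W : X.Opens} {a b : ι → Γ(X, W)} {p : X} (ha : IsGenAt F he ψ a p)
    (hb : IsGenAt F he ψ b p) : IsGenAt F he ψ (a + b) p := by
  obtain ⟨V₁, hV₁, W₁, h₁, h₁', hp₁, ha⟩ := ha
  obtain ⟨V₂, hV₂, W₂, h₂, h₂', hp₂, hb⟩ := hb
  have h₃ : W₁ ⊓ W₂ ≤ ψ ⁻¹ᵁ (V₁ ⊓ V₂) :=
    le_inf (inf_le_left.trans h₁') (inf_le_right.trans h₂')
  refine ⟨V₁ ⊓ V₂, inf_le_left.trans hV₁, W₁ ⊓ W₂, inf_le_left.trans h₁, h₃, ⟨hp₁, hp₂⟩, ?_⟩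
  rw [mapVec_add]
  exact add_mem (IsGenAt.mem_span_of_le h₃ inf_le_left inf_le_left ha)
    (IsGenAt.mem_span_of_le h₃ inf_le_right inf_le_right hb)

variable {he} in
lemma IsGenAt.smul {W : X.Opens} {a : ι → Γ(X, W)} {p : X} (t : Γ(X, W))
    (ha : IsGenAt F he ψ a p) : IsGenAt F he ψ (t • a) p := by
  obtain ⟨V₁, hV₁, W₁, h₁, h₁', hp₁, ha⟩ := ha
  refine ⟨V₁, hV₁, W₁, h₁, h₁', hp₁, ?_⟩
  rw [mapVec_smul]
  exact Submodule.smul_mem _ _ ha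

/-- Pullbacks of sections of a subbundle are sections of the pullback. -/
lemma SubBundle.IsPullback.mapVec_mem (hF : SubBundle.IsPullback ψ φ hφ F F') {W : X.Opens}
    {V : Y.Opens} (hV : V ≤ φ ⁻¹ᵁ U) (hW : W ≤ φ' ⁻¹ᵁ U) (h : W ≤ ψ ⁻¹ᵁ V) {b : ι → Γ(Y, V)}
    (hb : b ∈ F.coord he hV) : mapVec (pull ψ h) b ∈ F'.coord he hW := by
  rw [hF.mem_coord_iff he]
  intro p hp
  refine ⟨V, hV, W, le_rfl, h, hp, ?_⟩
  have : mapVec (resHom le_rfl) (mapVec (pull ψ h) b) = mapVec (pull ψ h) b := by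
    funext k
    exact resFun_self _
  rw [this]
  exact Submodule.subset_span ⟨b, hb, rfl⟩

variable {T : Scheme.{u}} {χ : T ⟶ X} {φ'' : T ⟶ Z} {hφ' : χ ≫ φ' = φ''}
  {hφ'' : (χ ≫ ψ) ≫ φ = φ''} {F'' : SubBundle (pb φ'' M) r}

omit [Fintype ι] in
lemma mapVec_pull_comp {V : Y.Opens} {W : X.Opens} {W' : T.Opens} (h : W ≤ ψ ⁻¹ᵁ V)
    (h' : W' ≤ χ ⁻¹ᵁ W) (h'' : W' ≤ (χ ≫ ψ) ⁻¹ᵁ V) (b : ι → Γ(Y, V)) :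
    mapVec (pull χ h') (mapVec (pull ψ h) b) = mapVec (pull (χ ≫ ψ) h'') b := by
  exact funext fun k => pull_pull χ ψ rfl h h' h'' (b k : Γ(Y, V))

/-- Pullbacks compose. -/
lemma SubBundle.IsPullback.comp (he : IsFrame e) (hF : SubBundle.IsPullback ψ φ hφ F F')
    (hF' : SubBundle.IsPullback χ φ' hφ' F' F'') (hU : ⊤ ≤ φ'' ⁻¹ᵁ U) :
    SubBundle.IsPullback (χ ≫ ψ) φ hφ'' F F'' := by
  refine SubBundle.isPullback_of_coord he hU fun W a => ?_
  constructor
  · intro ha p hp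
    obtain ⟨V, hV, W', h₁, h₂, hp', ha'⟩ := (hF'.mem_coord_iff he _ a).1 ha p hp
    -- A single section of `F'` is a combination of sections of `F` only after shrinking around `χ
    -- p`. The span induction makes the finitely many shrinkings one at a time, `IsGenAt` being
    -- stable under sums and multiples.
    have key : ∀ a' ∈ Submodule.span Γ(T, W') (mapVec (pull χ h₂) ''
        (F'.coord he hV : Set (ι → Γ(X, V)))), IsGenAt F he (χ ≫ ψ) a' p := by
      intro a' ha'
      induction ha' using Submodule.span_induction with
      | mem x hx =>
        obtain ⟨b, hb, rfl⟩ := hx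
        obtain ⟨V₁, hV₁, W₁, h₃, h₄, hp₁, hb'⟩ := (hF.mem_coord_iff he _ b).1 hb (χ p) (h₂ hp')
        have h₅ : W' ⊓ χ ⁻¹ᵁ W₁ ≤ χ ⁻¹ᵁ W₁ := inf_le_right
        have h₆ : W' ⊓ χ ⁻¹ᵁ W₁ ≤ (χ ≫ ψ) ⁻¹ᵁ V₁ := h₅.trans (preimage_le χ h₄)
        refine ⟨V₁, hV₁, W' ⊓ χ ⁻¹ᵁ W₁, inf_le_left, h₆, ⟨hp', hp₁⟩, ?_⟩
        have := mapVec_mem_span (pull χ h₅) hb'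
        have e1 : mapVec (pull χ h₅) (mapVec (resHom h₃) b) =
            mapVec (resHom inf_le_left) (mapVec (pull χ h₂) b) := by
          funext k
          exact (pull_resFun χ h₅ h₃ (b k)).trans (resFun_pull χ h₂ _ (b k)).symm
        rw [e1] at this
        refine Submodule.span_mono ?_ this
        rintro _ ⟨_, ⟨c, hc, rfl⟩, rfl⟩
        exact ⟨c, hc, (mapVec_pull_comp h₄ h₅ h₆ c).symm⟩
      | zero =>
        have h₅ : W' ≤ (χ ≫ ψ) ⁻¹ᵁ φ ⁻¹ᵁ U :=
          le_top.trans (hU.trans (preimage_eq_of_comp_eq hφ'' U).le)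
        refine ⟨φ ⁻¹ᵁ U, le_rfl, W', le_rfl, h₅, hp', ?_⟩
        rw [mapVec_zero]
        exact zero_mem _
      | add x y _ _ hx hy => exact hx.add hy
      | smul t x _ hx => exact hx.smul t
    obtain ⟨V₁, hV₁, W₁, h₃, h₄, hp₁, h₅⟩ := key _ ha'
    refine ⟨V₁, hV₁, W₁, h₃.trans h₁, h₄, hp₁, ?_⟩
    rwa [mapVec_mapVec, resHom_comp_resHom] at h₅
  · intro H
    apply SubBundle.coord_of_local he
    intro p hp
    obtain ⟨V, hV, W', h₁, h₂, hp', ha⟩ := H p hp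
    refine ⟨W', h₁, hp', Submodule.span_le.2 ?_ ha⟩
    rintro _ ⟨b, hb, rfl⟩
    have h3 : ψ ⁻¹ᵁ V ≤ φ' ⁻¹ᵁ U :=
      (preimage_le ψ hV).trans (preimage_eq_of_comp_eq hφ U).ge
    have := hF'.mapVec_mem he h3 (le_top.trans hU : W' ≤ _) h₂
      (hF.mapVec_mem he hV h3 le_rfl hb)
    rwa [mapVec_pull_comp le_rfl h₂ h₂] at this

/-- If `F'` and `F''` are pullbacks of `F`, then `F''` is the pullback of `F'`. -/
lemma SubBundle.IsPullback.of_comp (he : IsFrame e) (hF : SubBundle.IsPullback ψ φ hφ F F')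
    (hF'' : SubBundle.IsPullback (χ ≫ ψ) φ hφ'' F F'') (hU : ⊤ ≤ φ'' ⁻¹ᵁ U) :
    SubBundle.IsPullback χ φ' hφ' F' F'' := by
  refine SubBundle.isPullback_of_coord he hU fun W a => ?_
  constructor
  · intro ha p hp
    obtain ⟨V, hV, W', h₁, h₂, hp', ha'⟩ := (hF''.mem_coord_iff he _ a).1 ha p hp
    have h3 : ψ ⁻¹ᵁ V ≤ φ' ⁻¹ᵁ U :=
      (preimage_le ψ hV).trans (preimage_eq_of_comp_eq hφ U).ge
    refine ⟨ψ ⁻¹ᵁ V, h3, W', h₁, h₂, hp', Submodule.span_mono ?_ ha'⟩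
    rintro _ ⟨b, hb, rfl⟩
    exact ⟨_, hF.mapVec_mem he hV h3 le_rfl hb, mapVec_pull_comp le_rfl h₂ h₂ b⟩
  · intro H
    apply SubBundle.coord_of_local he
    intro p hp
    obtain ⟨V, hV, W', h₁, h₂, hp', ha⟩ := H p hp
    refine ⟨W', h₁, hp', Submodule.span_le.2 ?_ ha⟩
    rintro _ ⟨b, hb, rfl⟩
    apply SubBundle.coord_of_local he
    intro p' hp''
    obtain ⟨V₁, hV₁, W₁, h₃, h₄, hp₁, hb'⟩ := (hF.mem_coord_iff he _ b).1 hb (χ p') (h₂ hp'')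
    have h₅ : W' ⊓ χ ⁻¹ᵁ W₁ ≤ χ ⁻¹ᵁ W₁ := inf_le_right
    have h₆ : W' ⊓ χ ⁻¹ᵁ W₁ ≤ (χ ≫ ψ) ⁻¹ᵁ V₁ := h₅.trans (preimage_le χ h₄)
    refine ⟨W' ⊓ χ ⁻¹ᵁ W₁, inf_le_left, ⟨hp'', hp₁⟩, ?_⟩
    have := mapVec_mem_span (pull χ h₅) hb'
    have e1 : mapVec (pull χ h₅) (mapVec (resHom h₃) b) =
        mapVec (resHom inf_le_left) (mapVec (pull χ h₂) b) := by
      funext k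
      exact (pull_resFun χ h₅ h₃ (b k)).trans (resFun_pull χ h₂ _ (b k)).symm
    rw [e1] at this
    refine Submodule.span_le.2 ?_ this
    rintro _ ⟨_, ⟨c, hc, rfl⟩, rfl⟩
    rw [mapVec_pull_comp h₄ h₅ h₆ c]
    exact hF''.mapVec_mem he hV₁ _ h₆ hc

end Coordinates

end CoordinateVectors

/-! ### Free direct summands of `R ^ ι` and base change. -/

section ColSpan

variable {R R' ι : Type*} [CommRing R] [CommRing R'] {r q : ℕ}

/-- The span of the first `r` columns of a matrix. -/
def colSpan (P : Matrix ι (Fin r ⊕ Fin q) R) : Submodule R (ι → R) :=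
  Submodule.span R (Set.range fun k : Fin r => P.col (Sum.inl k))

/-- The span of the image of `G` under a change of rings. -/
def baseChange (θ : R →+* R') (G : Submodule R (ι → R)) : Submodule R' (ι → R') :=
  Submodule.span R' (mapVec θ '' (G : Set (ι → R)))

lemma mulVec_elim_zero_mem_colSpan (P : Matrix ι (Fin r ⊕ Fin q) R) (a : Fin r → R) :
    P.mulVec (Sum.elim a 0) ∈ colSpan P := by
  have : P.mulVec (Sum.elim a 0) = ∑ k, a k • P.col (Sum.inl k) := by
    funext i
    simp [Matrix.mulVec, dotProduct, mul_comm, Finset.sum_apply]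
  rw [this]
  exact Submodule.sum_mem _ fun k _ =>
    Submodule.smul_mem _ _ (Submodule.subset_span ⟨k, rfl⟩)

/-- `Q` computes coordinates in the basis of columns of `P`, so the summand is also the zero set of
the last `q` coordinates. -/
lemma mem_colSpan_iff [Fintype ι] [DecidableEq ι] {P : Matrix ι (Fin r ⊕ Fin q) R}
    {Q : Matrix (Fin r ⊕ Fin q) ι R} (hPQ : P * Q = 1) (hQP : Q * P = 1) {a : ι → R} :
    a ∈ colSpan P ↔ ∀ l, (Q.mulVec a) (Sum.inr l) = 0 := by
  constructor
  · intro ha l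
    induction ha using Submodule.span_induction with
    | mem x hx =>
      obtain ⟨k, rfl⟩ := hx
      have : Q.mulVec (P.col (Sum.inl k)) = (Q * P).col (Sum.inl k) := rfl
      rw [this, hQP]
      simp [Matrix.col]
    | zero => simp
    | add x y _ _ hx hy => simp [Matrix.mulVec_add, hx, hy]
    | smul t x _ hx => simp [Matrix.mulVec_smul, hx]
  · intro h
    have : a = P.mulVec (Sum.elim (fun k => (Q.mulVec a) (Sum.inl k)) 0) := by
      have h1 : Sum.elim (fun k => (Q.mulVec a) (Sum.inl k)) 0 = Q.mulVec a := by
        funext l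
        rcases l with l | l
        · rfl
        · exact (h l).symm
      rw [h1, Matrix.mulVec_mulVec, hPQ, Matrix.one_mulVec]
    rw [this]
    exact mulVec_elim_zero_mem_colSpan P _

lemma mapVec_mem_baseChange (θ : R →+* R') {G : Submodule R (ι → R)} {a : ι → R} (ha : a ∈ G) :
    mapVec θ a ∈ baseChange θ G := Submodule.subset_span ⟨a, ha, rfl⟩

lemma baseChange_le {θ : R →+* R'} {G : Submodule R (ι → R)} {G' : Submodule R' (ι → R')} :
    baseChange θ G ≤ G' ↔ ∀ a ∈ G, mapVec θ a ∈ G' := by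
  rw [baseChange, Submodule.span_le, Set.image_subset_iff]
  rfl

lemma baseChange_span (θ : R →+* R') (S : Set (ι → R)) :
    baseChange θ (Submodule.span R S) = Submodule.span R' (mapVec θ '' S) := by
  apply le_antisymm
  · exact baseChange_le.2 fun a ha => mapVec_mem_span θ ha
  · exact Submodule.span_mono (Set.image_mono Submodule.subset_span)

lemma colSpan_map (θ : R →+* R') (P : Matrix ι (Fin r ⊕ Fin q) R) :
    colSpan (P.map θ) = baseChange θ (colSpan P) := by
  rw [colSpan, colSpan, baseChange_span, ← Set.range_comp]
  rfl

lemma baseChange_baseChange {R'' : Type*} [CommRing R''] (θ : R →+* R') (η : R' →+* R'')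
    (G : Submodule R (ι → R)) : baseChange η (baseChange θ G) = baseChange (η.comp θ) G := by
  rw [baseChange.eq_1 θ, baseChange_span, Set.image_image, baseChange]
  rfl

lemma colSpan_mul [Fintype ι] (A : Matrix ι ι R) (P : Matrix ι (Fin r ⊕ Fin q) R) :
    colSpan (A * P) = (colSpan P).map A.mulVecLin := by
  rw [colSpan, colSpan, Submodule.map_span, ← Set.range_comp]
  rfl

/-- For surjective `ρ` the image of `G` is already closed under scalars, so taking the span adds
nothing. -/
lemma exists_mapVec_eq_of_mem_baseChange {G : Submodule R (ι → R)} {ρ : R →+* R'}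
    (hρ : Function.Surjective ρ) {a : ι → R'} (ha : a ∈ baseChange ρ G) :
    ∃ f ∈ G, mapVec ρ f = a := by
  induction ha using Submodule.span_induction with
  | mem x hx => exact hx
  | zero => exact ⟨0, zero_mem _, mapVec_zero ρ⟩
  | add x y _ _ hx hy =>
    obtain ⟨f, hf, rfl⟩ := hx
    obtain ⟨g, hg, rfl⟩ := hy
    exact ⟨f + g, add_mem hf hg, mapVec_add _ _ _⟩
  | smul t x _ hx =>
    obtain ⟨f, hf, rfl⟩ := hx
    obtain ⟨t, rfl⟩ := hρ t
    exact ⟨t • f, Submodule.smul_mem _ _ hf, mapVec_smul _ _ _⟩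

/-- `G` is a free direct summand of rank `r`. -/
def IsSplit [Fintype ι] [DecidableEq ι] (r : ℕ) (G : Submodule R (ι → R)) : Prop :=
  ∃ (q : ℕ) (P : Matrix ι (Fin r ⊕ Fin q) R) (Q : Matrix (Fin r ⊕ Fin q) ι R),
    P * Q = 1 ∧ Q * P = 1 ∧ G = colSpan P

variable [Fintype ι] [DecidableEq ι]

lemma IsSplit.baseChange {G : Submodule R (ι → R)} (hG : IsSplit r G) (θ : R →+* R') :
    IsSplit r (baseChange θ G) := by
  obtain ⟨q, P, Q, hPQ, hQP, rfl⟩ := hG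
  refine ⟨q, P.map θ, Q.map θ, ?_, ?_, (colSpan_map θ P).symm⟩
  · rw [← Matrix.map_mul, hPQ, Matrix.map_one _ (map_zero _) (map_one _)]
  · rw [← Matrix.map_mul, hQP, Matrix.map_one _ (map_zero _) (map_one _)]

lemma IsSplit.map {G : Submodule R (ι → R)} (hG : IsSplit r G) {A A' : Matrix ι ι R}
    (h : A * A' = 1) (h' : A' * A = 1) : IsSplit r (G.map A.mulVecLin) := by
  obtain ⟨q, P, Q, hPQ, hQP, rfl⟩ := hG
  refine ⟨q, A * P, Q * A', ?_, ?_, (colSpan_mul A P).symm⟩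
  · rw [Matrix.mul_assoc, ← Matrix.mul_assoc P, hPQ, Matrix.one_mul, h]
  · rw [Matrix.mul_assoc, ← Matrix.mul_assoc A', h', Matrix.one_mul, hQP]

/-- A multiple `a • y` that lies in a direct summand `G` is a multiple of an element of `G`. -/
lemma IsSplit.exists_smul_eq {G : Submodule R (ι → R)} (hG : IsSplit r G) {a : R} {y : ι → R}
    (hy : a • y ∈ G) : ∃ f ∈ G, a • y = a • f := by
  obtain ⟨q, P, Q, hPQ, hQP, rfl⟩ := hG
  rw [mem_colSpan_iff hPQ hQP] at hy
  -- The witness is the projection of `y` to `G` along the complement; its complementary coordinates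
  -- are killed by `a`.
  refine ⟨_, mulVec_elim_zero_mem_colSpan P fun k => (Q.mulVec y) (Sum.inl k), ?_⟩
  have h1 : a • Q.mulVec y = a • Sum.elim (fun k => (Q.mulVec y) (Sum.inl k)) 0 := by
    funext l
    rcases l with l | l
    · rfl
    · have := hy l
      rw [Matrix.mulVec_smul] at this
      simpa using this
  rw [← Matrix.mulVec_smul, ← h1, Matrix.mulVec_smul, Matrix.mulVec_mulVec, hPQ,
    Matrix.one_mulVec]

lemma IsSplit.finrank_eq {κ : Type*} [Field κ] {G : Submodule κ (ι → κ)} (hG : IsSplit r G) :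
    Module.finrank κ G = r := by
  obtain ⟨q, P, Q, hPQ, hQP, rfl⟩ := hG
  have h : LinearIndependent κ (fun k : Fin r => P.col (Sum.inl k)) := by
    have : Function.Injective P.mulVec := by
      intro x y hxy
      have := congr_arg Q.mulVec hxy
      simpa [Matrix.mulVec_mulVec, hQP] using this
    exact (Matrix.mulVec_injective_iff.1 this).comp _ Sum.inl_injective
  rw [colSpan, finrank_span_eq_card h, Fintype.card_fin]

end ColSpan

/-! ### Local bases of a subbundle as columns of an invertible matrix. -/

section LocalColumns

variable {Y Z : Scheme.{u}} {M : Z.Modules} {U : Z.Opens} {ι : Type} [Fintype ι]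
  [DecidableEq ι] {e : ι → Γ(M, U)} {r : ℕ} {φ : Y ⟶ Z}

lemma exists_mul_eq_one {R J : Type*} [CommRing R] [Fintype J] [DecidableEq J]
    (f : (J → R) ≃ₗ[R] (ι → R)) : ∃ (P : Matrix ι J R) (Q : Matrix J ι R),
      P * Q = 1 ∧ Q * P = 1 ∧ ∀ j, P.col j = f (Pi.single j 1) := by
  refine ⟨LinearMap.toMatrix' f.toLinearMap, LinearMap.toMatrix' f.symm.toLinearMap, ?_, ?_, ?_⟩
  · rw [← LinearMap.toMatrix'_comp]; simp
  · rw [← LinearMap.toMatrix'_comp]; simp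
  · intro j
    funext i
    simp [Matrix.col, LinearMap.toMatrix'_apply]

/-- Near each point, the coordinate vectors of a subbundle are the span of the first columns of an
invertible matrix. -/
lemma SubBundle.exists_coord_eq (F : SubBundle (pb φ M) r) (he : IsFrame e) {p : Y}
    (hp : p ∈ φ ⁻¹ᵁ U) : ∃ (V : Y.Opens) (hV : V ≤ φ ⁻¹ᵁ U) (q : ℕ)
      (P : Matrix ι (Fin r ⊕ Fin q) Γ(Y, V)) (Q : Matrix (Fin r ⊕ Fin q) ι Γ(Y, V)), p ∈ V ∧
      P * Q = 1 ∧ Q * P = 1 ∧ ∀ (V' : Y.Opens) (h : V' ≤ V),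
        F.coord he (h.trans hV) = colSpan (P.map (resHom h)) := by
  obtain ⟨U', hpU', q, e', he', hF⟩ := F.exists_frame p
  have hV : U' ⊓ φ ⁻¹ᵁ U ≤ φ ⁻¹ᵁ U := inf_le_right
  have hV' : U' ⊓ φ ⁻¹ᵁ U ≤ U' := inf_le_left
  obtain ⟨P, Q, hPQ, hQP, hP⟩ := exists_mul_eq_one ((he'.vec hV').trans (he.pbVec φ hV).symm)
  refine ⟨U' ⊓ φ ⁻¹ᵁ U, hV, q, P, Q, ⟨hpU', hp⟩, hPQ, hQP, fun V h => ?_⟩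
  have hcol : ∀ k, he.pbVec φ (h.trans hV) ((P.map (resHom h)).col k) =
      res (h.trans hV') (e' k) := by
    intro k
    have h1 := hP k
    have h2 : he.pbVec φ hV (P.col k) = res hV' (e' k) := by
      rw [h1, LinearEquiv.trans_apply, LinearEquiv.apply_symm_apply, IsFrame.vec_apply]
      simp [Pi.single_apply]
    have h3 := congr_arg (res h) h2
    rw [he.res_pbVec, res_res] at h3
    exact h3
  rw [SubBundle.coord, hF V (h.trans hV'), colSpan]
  simp only [← hcol]
  ext a
  rw [Submodule.mem_comap, LinearEquiv.coe_coe, ← he.mem_span_iff (h.trans hV), ← Set.range_comp]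
  rfl

end LocalColumns

/-! ### Subbundles over schemes with one point. -/

section OnePoint

lemma le_preimage_top {X Y : Scheme.{u}} (ψ : X ⟶ Y) (V : X.Opens) : V ≤ ψ ⁻¹ᵁ ⊤ :=
  fun _ _ => trivial

lemma mapVec_resHom_self {X : Scheme.{u}} {ι : Type*} {V : X.Opens} (a : ι → Γ(X, V)) :
    mapVec (resHom le_rfl) a = a := by
  funext k
  exact resFun_self _

variable {X Y Z : Scheme.{u}} {M : Z.Modules} {U : Z.Opens} {ι : Type} [Fintype ι]
  {e : ι → Γ(M, U)} {r : ℕ} {φ : Y ⟶ Z} {φ' : X ⟶ Z} {ψ : X ⟶ Y}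
  {hφ : ψ ≫ φ = φ'} {F : SubBundle (pb φ M) r} {F' : SubBundle (pb φ' M) r} (he : IsFrame e)

lemma eq_top_of_mem [Subsingleton X] {W : X.Opens} {p : X} (hp : p ∈ W) : W = ⊤ := by
  ext x
  simpa [Subsingleton.elim x p] using hp

lemma eq_bot_or_eq_top [Subsingleton X] (W : X.Opens) : W = ⊥ ∨ W = ⊤ := by
  by_cases h : ∃ p, p ∈ W
  · exact Or.inr (eq_top_of_mem h.choose_spec)
  · left
    ext x
    simpa using fun hx => h ⟨x, hx⟩

lemma subsingleton_sections_bot (N : X.Modules) : Subsingleton Γ(N, ⊥) :=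
  Module.subsingleton Γ(X, ⊥) _

/-- The pullback of a subbundle to a scheme with one point. -/
lemma SubBundle.IsPullback.coord_top [Subsingleton X] [Nonempty X]
    (hF : SubBundle.IsPullback ψ φ hφ F F') {V : Y.Opens} (hV : V ≤ φ ⁻¹ᵁ U)
    (h : ⊤ ≤ ψ ⁻¹ᵁ V) (hU : ⊤ ≤ φ' ⁻¹ᵁ U)
    (hres : ∀ (V' : Y.Opens) (h' : V' ≤ V),
      F.coord he (h'.trans hV) = baseChange (resHom h') (F.coord he hV)) :
    F'.coord he hU = baseChange (pull ψ h) (F.coord he hV) := by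
  apply le_antisymm
  · intro a ha
    obtain ⟨p⟩ := ‹Nonempty X›
    obtain ⟨V₁, hV₁, W', h₁, h₂, hp, ha'⟩ := (hF.mem_coord_iff he hU a).1 ha p trivial
    obtain rfl := eq_top_of_mem hp
    have h₃ : ⊤ ≤ ψ ⁻¹ᵁ (V₁ ⊓ V) := le_inf h₂ h
    have := IsGenAt.mem_span_of_le h₃ le_rfl inf_le_left ha'
    rw [mapVec_resHom_self] at this
    refine Submodule.span_le.2 ?_ this
    rintro _ ⟨b, hb, rfl⟩
    have hb' : b ∈ F.coord he (inf_le_right.trans hV) := hb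
    rw [hres _ inf_le_right] at hb'
    have h4 := mapVec_mem_baseChange (pull ψ h₃) hb'
    rw [baseChange_baseChange] at h4
    have h5 : (pull ψ h₃).comp (resHom inf_le_right) = pull ψ h :=
      RingHom.ext fun x => pull_resFun ψ h₃ inf_le_right x
    rwa [h5] at h4
  · exact baseChange_le.2 fun a ha => hF.mapVec_mem he hV hU h ha

lemma SubBundle.isSplit_coord_top [DecidableEq ι] [Subsingleton Y] [Nonempty Y]
    (F : SubBundle (pb φ M) r)
    (hU : ⊤ ≤ φ ⁻¹ᵁ U) : IsSplit r (F.coord he hU) := by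
  obtain ⟨p⟩ := ‹Nonempty Y›
  obtain ⟨V, hV, q, P, Q, hp, hPQ, hQP, hF⟩ := F.exists_coord_eq he (hU (by trivial : p ∈ ⊤))
  obtain rfl := eq_top_of_mem hp
  refine ⟨q, P, Q, hPQ, hQP, ?_⟩
  rw [hF ⊤ le_rfl]
  congr 1
  ext i j
  exact resFun_self _

/-- On a scheme with one point, a direct summand of the module of coordinate vectors comes from a
subbundle. -/
lemma exists_subBundle [DecidableEq ι] [Subsingleton Y] [Nonempty Y] (hU : ⊤ ≤ φ ⁻¹ᵁ U)
    {G : Submodule Γ(Y, ⊤) (ι → Γ(Y, ⊤))} (hG : IsSplit r G) :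
    ∃ F : SubBundle (pb φ M) r, F.coord he hU = G := by
  obtain ⟨q, P, Q, hPQ, hQP, rfl⟩ := hG
  have hV : ∀ V : Y.Opens, V ≤ φ ⁻¹ᵁ U := fun V => le_top.trans hU
  let s : ∀ k, Γ(pb φ M, ⊤) := fun k => he.pbVec φ hU (P.col k)
  have hs : IsFrame s := by
    -- The only open sets are `⊥`, over which all sections vanish, and `⊤`, so every sheaf condition
    -- reduces to a statement about global sections.
    intro V hV'
    rcases eq_bot_or_eq_top V with rfl | rfl
    · have := subsingleton_sections_bot (pb φ M)
      have : Subsingleton (Fin r ⊕ Fin q → Γ(Y, ⊥)) := inferInstance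
      exact ⟨fun _ _ _ => Subsingleton.elim _ _, fun _ => ⟨0, Subsingleton.elim _ _⟩⟩
    · have h1 : (fun a : Fin r ⊕ Fin q → Γ(Y, ⊤) => ∑ k, a k • res hV' (s k)) =
          he.pbVec φ hU ∘ P.mulVec := by
        funext a
        simp only [res_self, s, Function.comp, ← map_smul]
        rw [← map_sum]
        congr 1
        funext i
        simp [Matrix.mulVec, dotProduct, mul_comm]
      rw [h1]
      refine (he.pbVec φ hU).bijective.comp ⟨?_, fun a => ⟨Q.mulVec a, ?_⟩⟩
      · intro a b hab
        have := congr_arg Q.mulVec hab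
        simpa [Matrix.mulVec_mulVec, hQP] using this
      · simp [Matrix.mulVec_mulVec, hPQ]
  let F : SubBundle (pb φ M) r :=
    { sec := fun V => Submodule.span Γ(Y, V) (Set.range fun k : Fin r => res le_top (s (Sum.inl k)))
      res_mem := by
        intro V V' h x hx
        induction hx using Submodule.span_induction with
        | mem x hx =>
          obtain ⟨k, rfl⟩ := hx
          exact Submodule.subset_span ⟨k, (res_res _ _ _).symm⟩
        | zero => rw [res_zero]; exact zero_mem _
        | add x y _ _ hx hy => rw [res_add]; exact add_mem hx hy
        | smul t x _ hx => rw [res_smul]; exact Submodule.smul_mem _ _ hx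
      mem_of_local := by
        intro V x hx
        rcases eq_bot_or_eq_top V with rfl | rfl
        · have := subsingleton_sections_bot (pb φ M)
          rw [Subsingleton.elim x 0]
          exact zero_mem _
        · obtain ⟨p⟩ := ‹Nonempty Y›
          obtain ⟨V, h, hp, hx⟩ := hx p trivial
          obtain rfl := eq_top_of_mem hp
          rwa [res_self] at hx
      exists_frame := fun p => ⟨⊤, trivial, q, s, hs, fun V h => rfl⟩ }
  refine ⟨F, ?_⟩
  ext a
  rw [SubBundle.mem_coord, colSpan, ← he.mem_span_iff hU, ← Set.range_comp]
  simp only [F, res_self]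
  rfl

lemma SubBundle.isPullback_of_coord_top [Subsingleton X] [Subsingleton Y] (hU : ⊤ ≤ φ ⁻¹ᵁ U)
    (hU' : ⊤ ≤ φ' ⁻¹ᵁ U)
    (h : F'.coord he hU' = baseChange (pull ψ (le_preimage_top ψ _)) (F.coord he hU)) :
    SubBundle.IsPullback ψ φ hφ F F' := by
  refine SubBundle.isPullback_of_coord he hU' fun W a => ?_
  rcases eq_bot_or_eq_top W with rfl | rfl
  · have := subsingleton_sections_bot (pb φ' M)
    refine ⟨fun _ p hp => hp.elim, fun _ => ?_⟩
    rw [SubBundle.mem_coord, Subsingleton.elim (he.pbVec φ' _ a) 0]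
    exact zero_mem _
  · constructor
    · intro ha p _
      refine ⟨⊤, hU, ⊤, le_rfl, le_preimage_top ψ _, trivial, ?_⟩
      rw [mapVec_resHom_self]
      rw [h] at ha
      exact ha
    · intro H
      apply SubBundle.coord_of_local he
      intro p hp
      obtain ⟨V, hV, W', h₁, h₂, hp', ha⟩ := H p hp
      obtain rfl : V = ⊤ := eq_top_of_mem (p := ψ p) (h₂ hp')
      obtain rfl := eq_top_of_mem hp'
      refine ⟨⊤, le_rfl, trivial, ?_⟩
      rw [h]
      exact ha

end OnePoint

/-! ### Morphisms from `Spec R` into an affine open set. -/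

section RingLevel

variable {R R' : Type u} [CommRing R] [CommRing R'] {Y Z : Scheme.{u}}

/-- The ring of functions of `Spec R`. -/
def specSec (R : Type u) [CommRing R] : Γ(Spec (.of R), ⊤) ≃+* R :=
  (Scheme.ΓSpecIso (.of R)).commRingCatIsoToRingEquiv

/-- Pullback of functions to `Spec R`. -/
def evalR (φ : Spec (.of R) ⟶ Z) {U : Z.Opens} (h : ⊤ ≤ φ ⁻¹ᵁ U) : Γ(Z, U) →+* R :=
  (specSec R).toRingHom.comp (pull φ h)

/-- The morphism of spectra. -/
abbrev specMap (g : R →+* R') : Spec (.of R') ⟶ Spec (.of R) := Spec.map (CommRingCat.ofHom g)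

lemma specSec_pull (g : R →+* R') (a : Γ(Spec (.of R), ⊤)) :
    specSec R' (pull (specMap g) (le_preimage_top _ _) a) = g (specSec R a) := by
  have h := Scheme.ΓSpecIso_naturality (CommRingCat.ofHom g)
  have h2 := ConcreteCategory.congr_hom h a
  have : pull (specMap g) (le_preimage_top _ _) a = (specMap g).appTop a := by
    rw [pull_eq]
    exact resFun_self _
  rw [this]
  exact h2

lemma evalR_comp (φ : Spec (.of R) ⟶ Z) {φ' : Spec (.of R') ⟶ Z} (g : R →+* R')
    (hφ : specMap g ≫ φ = φ') {U : Z.Opens} (h : ⊤ ≤ φ ⁻¹ᵁ U) (h' : ⊤ ≤ φ' ⁻¹ᵁ U) :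
    evalR φ' h' = g.comp (evalR φ h) := by
  ext a
  change specSec R' (pull φ' h' a) = g (specSec R (pull φ h a))
  rw [← specSec_pull, pull_pull (specMap g) φ hφ h (le_preimage_top _ _) h']

lemma evalR_comp_pull (φ : Y ⟶ Z) (ψ : Spec (.of R) ⟶ Y) {φ' : Spec (.of R) ⟶ Z}
    (hφ : ψ ≫ φ = φ') {U : Z.Opens} {V : Y.Opens} (h : V ≤ φ ⁻¹ᵁ U) (h' : ⊤ ≤ ψ ⁻¹ᵁ V)
    (h'' : ⊤ ≤ φ' ⁻¹ᵁ U) : (evalR ψ h').comp (pull φ h) = evalR φ' h'' := by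
  ext a
  exact congr_arg (specSec R) (pull_pull ψ φ hφ h h' h'' a)

/-- A morphism landing in an affine open set factors through its spectrum. Together with
`exists_evalR_eq`, this makes `evalR` a bijection from such morphisms to ring maps `Γ(Z, U) →+* R`,
so that ring-theoretic lifts become lifts of morphisms. -/
lemma eq_specMap_fromSpec {U : Z.Opens} (hU : IsAffineOpen U) (φ : Spec (.of R) ⟶ Z)
    (h : ⊤ ≤ φ ⁻¹ᵁ U) : φ = specMap (evalR φ h) ≫ hU.fromSpec := by
  have h1 := IsAffineOpen.SpecMap_appLE_fromSpec φ hU (isAffineOpen_top (Spec (.of R))) h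
  rw [IsAffineOpen.fromSpec_top] at h1
  have h2 : specMap (evalR φ h) =
      Spec.map (Scheme.ΓSpecIso (.of R)).hom ≫ Spec.map (φ.appLE U ⊤ h) := by
    rw [← Spec.map_comp]
    rfl
  rw [h2, Category.assoc, h1, Scheme.isoSpec_Spec_inv, ← Category.assoc, ← Spec.map_comp]
  simp

lemma eq_of_evalR_eq {U : Z.Opens} (hU : IsAffineOpen U) {φ φ' : Spec (.of R) ⟶ Z}
    (h : ⊤ ≤ φ ⁻¹ᵁ U) (h' : ⊤ ≤ φ' ⁻¹ᵁ U) (heq : evalR φ h = evalR φ' h') : φ = φ' := by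
  rw [eq_specMap_fromSpec hU φ h, eq_specMap_fromSpec hU φ' h', heq]

lemma resFun_map_self {X : Scheme.{u}} {V W : X.Opens} (h : V ≤ W)
    (i : Opposite.op V ⟶ Opposite.op W) (b : Γ(X, V)) : resFun h (X.presheaf.map i b) = b := by
  have : i = (homOfLE i.unop.le).op := Subsingleton.elim _ _
  rw [this]
  exact (resFun_resFun i.unop.le h b).trans (resFun_self b)

lemma exists_evalR_eq {U : Z.Opens} (hU : IsAffineOpen U) (θ : Γ(Z, U) →+* R) :
    ∃ (φ : Spec (.of R) ⟶ Z) (h : ⊤ ≤ φ ⁻¹ᵁ U), evalR φ h = θ := by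
  have h0 : ⊤ ≤ hU.fromSpec ⁻¹ᵁ U := by rw [hU.fromSpec_preimage_self]
  have h1 : ⊤ ≤ (specMap θ ≫ hU.fromSpec) ⁻¹ᵁ U := fun x _ => h0 (show specMap θ x ∈ ⊤ from trivial)
  refine ⟨specMap θ ≫ hU.fromSpec, h1, ?_⟩
  have h2 : evalR (R := Γ(Z, U)) hU.fromSpec h0 = RingHom.id _ := by
    ext a
    change specSec Γ(Z, U) (pull hU.fromSpec h0 a) = a
    rw [pull_eq, hU.fromSpec_app_self]
    exact (congr_arg _ (resFun_map_self h0 _ _)).trans ((specSec Γ(Z, U)).apply_symm_apply a)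
  rw [evalR_comp (R := Γ(Z, U)) hU.fromSpec θ rfl h0 h1, h2, RingHom.comp_id]

end RingLevel

/-! ### Subbundles over `Spec R` as submodules of `R ^ ι`. -/

section Vecs

variable {R R' : Type u} [CommRing R] [CommRing R'] {Y Z : Scheme.{u}} {M : Z.Modules}
  {U : Z.Opens} {ι : Type} [Fintype ι] {e : ι → Γ(M, U)} {r : ℕ} {φ : Spec (.of R) ⟶ Z}
  {φ' : Spec (.of R') ⟶ Z} (F : SubBundle (pb φ M) r) {F' : SubBundle (pb φ' M) r} (he : IsFrame e)
  (hU : ⊤ ≤ φ ⁻¹ᵁ U)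

/-- The submodule of `R ^ ι` given by a subbundle over `Spec R`. -/
def SubBundle.vecs : Submodule R (ι → R) :=
  baseChange (specSec R).toRingHom (F.coord he hU)

variable {F he hU}

omit [Fintype ι] in
lemma mapVec_specSec_symm (a : ι → R) :
    mapVec (specSec R).toRingHom (mapVec (specSec R).symm.toRingHom a) = a := by
  funext k
  exact (specSec R).apply_symm_apply _

omit [Fintype ι] in
lemma mapVec_symm_specSec (a : ι → Γ(Spec (.of R), ⊤)) :
    mapVec (specSec R).symm.toRingHom (mapVec (specSec R).toRingHom a) = a := by
  funext k
  exact (specSec R).symm_apply_apply _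

omit [Fintype ι] in
lemma baseChange_symm_baseChange (G : Submodule Γ(Spec (.of R), ⊤) (ι → Γ(Spec (.of R), ⊤))) :
    baseChange (specSec R).symm.toRingHom (baseChange (specSec R).toRingHom G) = G := by
  apply le_antisymm
  · rw [baseChange_baseChange]
    refine baseChange_le.2 fun a ha => ?_
    rw [← mapVec_mapVec, mapVec_symm_specSec]
    exact ha
  · intro a ha
    rw [← mapVec_symm_specSec a]
    exact mapVec_mem_baseChange _ (mapVec_mem_baseChange _ ha)

omit [Fintype ι] in
lemma baseChange_specSec_symm (G : Submodule R (ι → R)) :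
    baseChange (specSec R).toRingHom (baseChange (specSec R).symm.toRingHom G) = G := by
  apply le_antisymm
  · rw [baseChange_baseChange]
    refine baseChange_le.2 fun a ha => ?_
    rw [← mapVec_mapVec, mapVec_specSec_symm]
    exact ha
  · intro a ha
    rw [← mapVec_specSec_symm a]
    exact mapVec_mem_baseChange _ (mapVec_mem_baseChange _ ha)

lemma SubBundle.baseChange_vecs :
    baseChange (specSec R).symm.toRingHom (F.vecs he hU) = F.coord he hU :=
  baseChange_symm_baseChange _

lemma SubBundle.mem_vecs_iff {a : ι → R} :
    a ∈ F.vecs he hU ↔ mapVec (specSec R).symm.toRingHom a ∈ F.coord he hU := by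
  constructor
  · intro ha
    rw [← SubBundle.baseChange_vecs]
    exact mapVec_mem_baseChange _ ha
  · intro ha
    rw [← mapVec_specSec_symm a]
    exact mapVec_mem_baseChange _ ha

lemma SubBundle.isSplit_vecs [DecidableEq ι] [Subsingleton (Spec (.of R))] [Nontrivial R]
    (F : SubBundle (pb φ M) r) : IsSplit r (F.vecs he hU) :=
  (F.isSplit_coord_top he hU).baseChange _

lemma exists_subBundle_vecs_eq [DecidableEq ι] [Subsingleton (Spec (.of R))] [Nontrivial R]
    (he : IsFrame e) (hU : ⊤ ≤ φ ⁻¹ᵁ U) {G : Submodule R (ι → R)} (hG : IsSplit r G) :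
    ∃ F : SubBundle (pb φ M) r, F.vecs he hU = G := by
  obtain ⟨F, hF⟩ := exists_subBundle he hU (hG.baseChange (specSec R).symm.toRingHom)
  refine ⟨F, ?_⟩
  rw [SubBundle.vecs, hF, baseChange_specSec_symm]

lemma SubBundle.IsPullback.vecs_eq [Subsingleton (Spec (.of R))] [Nontrivial R]
    {φ₀ : Y ⟶ Z} {ψ : Spec (.of R) ⟶ Y} {hφ : ψ ≫ φ₀ = φ} {F₀ : SubBundle (pb φ₀ M) r}
    (hF : SubBundle.IsPullback ψ φ₀ hφ F₀ F) {V : Y.Opens} (hV : V ≤ φ₀ ⁻¹ᵁ U)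
    (h : ⊤ ≤ ψ ⁻¹ᵁ V) (hres : ∀ (V' : Y.Opens) (h' : V' ≤ V),
      F₀.coord he (h'.trans hV) = baseChange (resHom h') (F₀.coord he hV)) :
    F.vecs he hU = baseChange (evalR ψ h) (F₀.coord he hV) := by
  rw [SubBundle.vecs, hF.coord_top he hV h hU hres, baseChange_baseChange]
  rfl

omit [Fintype ι] in
lemma baseChange_pull_specMap (g : R →+* R')
    (G : Submodule Γ(Spec (.of R), ⊤) (ι → Γ(Spec (.of R), ⊤))) :
    baseChange (specSec R').toRingHom (baseChange (pull (specMap g) (le_preimage_top _ _)) G) =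
      baseChange g (baseChange (specSec R).toRingHom G) := by
  rw [baseChange_baseChange, baseChange_baseChange]
  congr 1
  ext a
  exact specSec_pull g a

lemma SubBundle.IsPullback.vecs_eq_baseChange [Subsingleton (Spec (.of R))]
    [Subsingleton (Spec (.of R'))] [Nontrivial R'] {g : R →+* R'} {hφ : specMap g ≫ φ = φ'}
    (hF : SubBundle.IsPullback (specMap g) φ hφ F F') (hU' : ⊤ ≤ φ' ⁻¹ᵁ U) :
    F'.vecs he hU' = baseChange g (F.vecs he hU) := by
  rw [SubBundle.vecs, hF.coord_top he hU (le_preimage_top _ _) hU', baseChange_pull_specMap]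
  · rfl
  · intro V h'
    rcases eq_bot_or_eq_top V with rfl | rfl
    · have := subsingleton_sections_bot (pb φ M)
      ext a
      refine ⟨fun _ => ?_, fun _ => ?_⟩
      · rw [show a = 0 by funext k; exact Subsingleton.elim _ _]
        exact zero_mem _
      · rw [SubBundle.mem_coord, Subsingleton.elim (he.pbVec φ _ a) 0]
        exact zero_mem _
    · ext a
      constructor
      · intro ha
        rw [← mapVec_resHom_self a]
        exact mapVec_mem_baseChange _ ha
      · intro ha
        refine baseChange_le.2 (fun b hb => ?_) ha
        rw [mapVec_resHom_self]
        exact hb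

lemma SubBundle.isPullback_of_vecs [Subsingleton (Spec (.of R))] [Subsingleton (Spec (.of R'))]
    {g : R →+* R'} {hφ : specMap g ≫ φ = φ'} (hU' : ⊤ ≤ φ' ⁻¹ᵁ U)
    (h : F'.vecs he hU' = baseChange g (F.vecs he hU)) :
    SubBundle.IsPullback (specMap g) φ hφ F F' := by
  refine SubBundle.isPullback_of_coord_top he hU hU' ?_
  rw [← SubBundle.baseChange_vecs (F := F'), h, SubBundle.vecs, ← baseChange_pull_specMap,
    baseChange_symm_baseChange]

end Vecs

/-! ### Exactness of a chain of matrices under field extension. -/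

section FieldExtension

open Matrix

variable {K κ : Type*} [Field K] [Field κ] {d : ℕ}

lemma exists_comp_eq_of_ker_le {V V' V'' : Type*} [AddCommGroup V] [Module K V] [AddCommGroup V']
    [Module K V'] [AddCommGroup V''] [Module K V''] {f : V →ₗ[K] V'} {g : V →ₗ[K] V''}
    (h : ∀ x, f x = 0 → g x = 0) : ∃ C : V' →ₗ[K] V'', C ∘ₗ f = g := by
  obtain ⟨C, hC⟩ := LinearMap.exists_extend
    ((LinearMap.ker f).liftQ g h ∘ₗ f.quotKerEquivRange.symm.toLinearMap)
  refine ⟨C, LinearMap.ext fun x => ?_⟩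
  have h1 := LinearMap.congr_fun hC (f.rangeRestrict x)
  have h2 : f.quotKerEquivRange.symm (f.rangeRestrict x) = Submodule.Quotient.mk x := by
    rw [LinearEquiv.symm_apply_eq]
    rfl
  simp only [LinearMap.comp_apply, LinearEquiv.coe_coe, h2, Submodule.subtype_apply] at h1
  exact h1

/-- A relation between kernels of matrices persists under field extensions. -/
lemma exists_mul_eq_of_ker_le {A B : Matrix (Fin d) (Fin d) K}
    (h : ∀ x, A *ᵥ x = 0 → B *ᵥ x = 0) : ∃ C : Matrix (Fin d) (Fin d) K, C * A = B := by
  obtain ⟨C, hC⟩ := exists_comp_eq_of_ker_le (f := toLin' A) (g := toLin' B)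
    (by simpa using h)
  refine ⟨LinearMap.toMatrix' C, ?_⟩
  have := congr_arg LinearMap.toMatrix' hC
  rwa [LinearMap.toMatrix'_comp, LinearMap.toMatrix'_toLin', LinearMap.toMatrix'_toLin'] at this

lemma exists_mul_eq_of_range_le {A B : Matrix (Fin d) (Fin d) K}
    (h : ∀ x, ∃ y, A *ᵥ y = B *ᵥ x) : ∃ C : Matrix (Fin d) (Fin d) K, A * C = B := by
  choose y hy using fun j : Fin d => h (Pi.single j 1)
  refine ⟨fun i j => y j i, ?_⟩
  ext i j
  have := congr_fun (hy j) i
  rw [mulVec_single_one] at this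
  exact this

/-- With `P` a projection onto the kernel of `A`, one can solve `B D = P`, since the kernel lies in
the image of `B`, and `C A = 1 - P`, since `1 - P` kills the kernel. The resulting identity encodes
the inclusion in a form that any ring map preserves. -/
lemma exists_mul_add_mul_eq_one {A B : Matrix (Fin d) (Fin d) K}
    (h : ∀ x, A *ᵥ x = 0 → ∃ y, B *ᵥ y = x) :
    ∃ C D : Matrix (Fin d) (Fin d) K, C * A + B * D = 1 := by
  obtain ⟨Q, hQ⟩ := (LinearMap.ker (toLin' A)).exists_isCompl
  let P := (LinearMap.ker (toLin' A)).subtype ∘ₗ Submodule.projectionOnto _ _ hQ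
  obtain ⟨D, hD⟩ := exists_mul_eq_of_range_le (A := B) (B := LinearMap.toMatrix' P) (by
    intro x
    rw [LinearMap.toMatrix'_mulVec]
    exact h _ (Submodule.projectionOnto _ _ hQ x).2)
  obtain ⟨C, hC⟩ := exists_mul_eq_of_ker_le (A := A) (B := 1 - LinearMap.toMatrix' P) (by
    intro x hx
    have : P x = x := by
      have := Submodule.projectionOnto_apply_left hQ ⟨x, by simpa using hx⟩
      exact congr_arg Subtype.val this
    rw [sub_mulVec, one_mulVec, LinearMap.toMatrix'_mulVec, this, sub_self])
  exact ⟨C, D, by rw [hC, hD, sub_add_cancel]⟩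

/-- The endomorphisms given by the images of matrices under a ring homomorphism. -/
def endMap {A R : Type*} [CommRing A] [CommRing R] (θ : A →+* R) (M : ℕ → Matrix (Fin d) (Fin d) A)
    (k : ℕ) : Module.End R (Fin d → R) := ((M k).map θ).mulVecLin

lemma endMap_apply {A R : Type*} [CommRing A] [CommRing R] (θ : A →+* R)
    (M : ℕ → Matrix (Fin d) (Fin d) A) (k : ℕ) (x : Fin d → R) :
    endMap θ M k x = (M k).map θ *ᵥ x := rfl

/-- The axioms of `LinkedBundle` concern residue fields of `S`, whereas the argument takes place
over residue fields of the Grassmannian. Each axiom is rewritten as a matrix identity, which passes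
to the larger field. -/
lemma IsAmbientChain.of_fieldExtension {A : Type*} [CommRing A] {n : ℕ} (θ : A →+* K)
    (g : K →+* κ) {U W : ℕ → Matrix (Fin d) (Fin d) A}
    (h : IsAmbientChain n (endMap θ U) (endMap θ W)) :
    IsAmbientChain n (endMap (g.comp θ) U) (endMap (g.comp θ) W) := by
  have key0 : ∀ {P Q : Matrix (Fin d) (Fin d) A}, (∀ x, P.map θ *ᵥ (Q.map θ *ᵥ x) = 0) →
      ∀ x, P.map (g.comp θ) *ᵥ (Q.map (g.comp θ) *ᵥ x) = 0 := by
    intro P Q hPQ x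
    have h1 : P.map θ * Q.map θ = 0 := by
      apply Matrix.ext_of_mulVec_single
      intro i
      rw [← mulVec_mulVec, hPQ, zero_mulVec]
    have h2 := congr_arg (fun M => M.map g) h1
    simp only [Matrix.map_mul, Matrix.map_map] at h2
    rw [mulVec_mulVec]
    have h3 : P.map (g.comp θ) * Q.map (g.comp θ) = 0 := by
      rw [RingHom.coe_comp, h2]
      simp
    rw [h3, zero_mulVec]
  have key1 : ∀ {P Q : Matrix (Fin d) (Fin d) A},
      (∀ x, P.map θ *ᵥ x = 0 → ∃ y, Q.map θ *ᵥ y = x) →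
      ∀ x, P.map (g.comp θ) *ᵥ x = 0 → ∃ y, Q.map (g.comp θ) *ᵥ y = x := by
    intro P Q hPQ x hx
    obtain ⟨C, D, hCD⟩ := exists_mul_add_mul_eq_one hPQ
    have h2 := congr_arg (fun M => M.map g) hCD
    simp only [Matrix.map_mul, Matrix.map_map, Matrix.map_add _ (map_add g)] at h2
    rw [Matrix.map_one _ (map_zero g) (map_one g)] at h2
    refine ⟨D.map g *ᵥ x, ?_⟩
    have h3 := congr_arg (fun M => M *ᵥ x) h2
    simp only [add_mulVec, one_mulVec, ← mulVec_mulVec] at h3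
    rw [RingHom.coe_comp] at hx ⊢
    rwa [hx, mulVec_zero, zero_add] at h3
  have key2 : ∀ {P Q : Matrix (Fin d) (Fin d) A},
      (∀ x, P.map θ *ᵥ (Q.map θ *ᵥ x) = 0 → Q.map θ *ᵥ x = 0) →
      ∀ x, P.map (g.comp θ) *ᵥ (Q.map (g.comp θ) *ᵥ x) = 0 → Q.map (g.comp θ) *ᵥ x = 0 := by
    intro P Q hPQ x hx
    obtain ⟨C, hC⟩ := exists_mul_eq_of_ker_le (A := P.map θ * Q.map θ) (B := Q.map θ) (by
      intro x hx
      exact hPQ x (by rwa [mulVec_mulVec]))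
    have h2 := congr_arg (fun M => M.map g) hC
    simp only [Matrix.map_mul, Matrix.map_map] at h2
    rw [RingHom.coe_comp] at hx ⊢
    rw [← h2, ← mulVec_mulVec, ← mulVec_mulVec, hx, mulVec_zero]
  exact ⟨fun hi => key0 (h.up_down hi), fun hi => key0 (h.down_up hi),
    fun hi x => key1 (fun y => h.exists_down hi) x, fun hi x => key1 (fun y => h.exists_up hi) x,
    fun hi x => key2 (fun y => h.up_up hi) x, fun hi x => key2 (fun y => h.down_down hi) x⟩

end FieldExtension

/-! ### Matrices of the chain maps over a common affine open set. -/

section Chain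

variable {S : Scheme.{u}} {s : Γ(S, ⊤)} {n d r : ℕ} {𝓔 : LinkedBundle S s n d} {S₀ : S.Opens}
  {ε : ∀ i, Fin d → Γ(𝓔.E i, S₀)}

lemma LinkedBundle.exists_frames (𝓔 : LinkedBundle S s n d) (p : S) :
    ∃ (S₀ : S.Opens) (ε : ∀ i, Fin d → Γ(𝓔.E i, S₀)), p ∈ S₀ ∧ IsAffineOpen S₀ ∧
      ∀ i, IsFrame (ε i) := by
  choose U hU e he using fun i => 𝓔.isVectorBundle i p
  obtain ⟨S₀, hS₀, hp, hle⟩ := exists_isAffineOpen_mem_and_subset (X := S) (x := p)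
    (U := Finset.univ.inf U) (by
      rw [← SetLike.mem_coe, TopologicalSpace.Opens.coe_finset_inf]
      simpa using hU)
  have hle' : ∀ i, S₀ ≤ U i := fun i => le_trans hle (Finset.inf_le (Finset.mem_univ i))
  exact ⟨S₀, fun i k => res (hle' i) (e i k), hp, hS₀, fun i => (he i).restrict (hle' i)⟩

variable (hε : ∀ i, IsFrame (ε i))

/-- The matrices of the maps `f_i`. -/
def upM (hε : ∀ i, IsFrame (ε i)) (k : ℕ) : Matrix (Fin d) (Fin d) Γ(S, S₀) :=
  if h : k + 1 < n then
    (hε ⟨k, by omega⟩).matrix (hε ⟨k + 1, h⟩) (𝓔.up (i := ⟨k, by omega⟩) (j := ⟨k + 1, h⟩) rfl)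
  else 0

/-- The matrices of the maps `f^i`. -/
def downM (hε : ∀ i, IsFrame (ε i)) (k : ℕ) : Matrix (Fin d) (Fin d) Γ(S, S₀) :=
  if h : k + 1 < n then
    (hε ⟨k + 1, h⟩).matrix (hε ⟨k, by omega⟩) (𝓔.down (i := ⟨k, by omega⟩) (j := ⟨k + 1, h⟩) rfl)
  else 0

lemma upM_eq {k : ℕ} (h : k + 1 < n) : upM hε k = (hε ⟨k, by omega⟩).matrix (hε ⟨k + 1, h⟩)
    (𝓔.up (i := ⟨k, by omega⟩) (j := ⟨k + 1, h⟩) rfl) := dif_pos h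

lemma downM_eq {k : ℕ} (h : k + 1 < n) : downM hε k = (hε ⟨k + 1, h⟩).matrix (hε ⟨k, by omega⟩)
    (𝓔.down (i := ⟨k, by omega⟩) (j := ⟨k + 1, h⟩) rfl) := dif_pos h

lemma IsFrame.app_vec {M N : S.Modules} {ι ι' : Type} [Fintype ι] [Fintype ι']
    {e : ι → Γ(M, S₀)} {e' : ι' → Γ(N, S₀)} (he : IsFrame e) (he' : IsFrame e') (f : M ⟶ N)
    (a : ι → Γ(S, S₀)) :
    f.app S₀ (he.vec le_rfl a) = he'.vec le_rfl ((he.matrix he' f).mulVec a) := by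
  rw [IsFrame.vec_apply, hom_sum]
  have h1 : ∀ l, f.app S₀ (e l) = he'.vec le_rfl (fun k => he.matrix he' f k l) := by
    intro l
    exact ((he'.vec le_rfl).apply_symm_apply _).symm
  simp only [Scheme.Modules.Hom.app_smul, res_self, h1]
  simp only [← map_smul]
  rw [← map_sum]
  congr 1
  funext k
  simp [Matrix.mulVec, dotProduct, mul_comm]

lemma downM_mulVec_upM {k : ℕ} (h : k + 1 < n) (a : Fin d → Γ(S, S₀)) :
    (downM hε k).mulVec ((upM hε k).mulVec a) = resTop s S₀ • a := by
  apply ((hε ⟨k, by omega⟩).vec le_rfl).injective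
  rw [upM_eq hε h, downM_eq hε h, ← IsFrame.app_vec, ← IsFrame.app_vec, 𝓔.down_up, map_smul]

lemma downM_mul_upM {k : ℕ} (h : k + 1 < n) :
    downM hε k * upM hε k = resTop s S₀ • (1 : Matrix (Fin d) (Fin d) Γ(S, S₀)) := by
  apply Matrix.ext_of_mulVec_single
  intro i
  rw [← Matrix.mulVec_mulVec, downM_mulVec_upM hε h, Matrix.smul_mulVec, Matrix.one_mulVec]

end Chain

/-! ### Values at points, and the ambient chain on fibres where `s = 0`. -/

section Chain

variable {S : Scheme.{u}} {s : Γ(S, ⊤)} {n d r : ℕ} {𝓔 : LinkedBundle S s n d} {S₀ : S.Opens}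
  {ε : ∀ i, Fin d → Γ(𝓔.E i, S₀)} (hε : ∀ i, IsFrame (ε i))

lemma top_le_preimage_of_mem {X : Scheme.{u}} {p : X} {U : X.Opens} (hp : p ∈ U) :
    ⊤ ≤ X.fromSpecResidueField p ⁻¹ᵁ U := fun x _ => by
  change X.fromSpecResidueField p x ∈ U
  rwa [Scheme.fromSpecResidueField_apply]

/-- Evaluation of functions at a point. -/
def evalAt {X : Scheme.{u}} {p : X} {U : X.Opens} (hp : p ∈ U) : Γ(X, U) →+* X.residueField p :=
  evalR (R := X.residueField p) (X.fromSpecResidueField p) (top_le_preimage_of_mem hp)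

/-- Links the evaluation through `Spec κ(p)`, in which fibres are computed, with the one in the
condition `s = 0`; the comparison factors through the stalk. -/
lemma evalAt_eq_evaluation {X : Scheme.{u}} {p : X} {U : X.Opens} (hp : p ∈ U) :
    evalAt hp = (X.evaluation U p hp).hom := by
  have h0 : ⊤ ≤ X.fromSpecStalk p ⁻¹ᵁ U := fun x _ => by
    have h : X.fromSpecStalk p x ∈ Set.range (X.fromSpecStalk p) := ⟨x, rfl⟩
    rw [Scheme.range_fromSpecStalk] at h
    exact h.mem_open U.2 hp
  have h1 := evalR_comp (R := X.presheaf.stalk p) (R' := X.residueField p) (X.fromSpecStalk p)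
    (X.residue p).hom rfl h0 (top_le_preimage_of_mem hp)
  have h2 : evalR (R := X.presheaf.stalk p) (X.fromSpecStalk p) h0 =
      (X.presheaf.germ U p hp).hom := by
    ext a
    change specSec (X.presheaf.stalk p) (pull (X.fromSpecStalk p) h0 a) = _
    rw [pull_eq, Scheme.fromSpecStalk_app hp]
    exact (congr_arg _ (resFun_map_self h0 _ _)).trans
      ((specSec (X.presheaf.stalk p)).apply_symm_apply _)
  rw [h2] at h1
  exact h1

/-- Turns the exactness conditions on fibres into statements about the matrices evaluated at `p`. -/
lemma fibreMap_pbVec {p : S} (hp : p ∈ S₀) {M N : S.Modules} {e : Fin d → Γ(M, S₀)}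
    {e' : Fin d → Γ(N, S₀)} (he : IsFrame e) (he' : IsFrame e') (f : M ⟶ N)
    (a : Fin d → S.residueField p) :
    fibreMap p f (he.pbVec _ (top_le_preimage_of_mem hp)
        (mapVec (specSec (S.residueField p)).symm.toRingHom a)) =
      he'.pbVec _ (top_le_preimage_of_mem hp) (mapVec (specSec (S.residueField p)).symm.toRingHom
        (((he.matrix he' f).map (evalAt hp)).mulVec a)) := by
  rw [fibreMap, IsFrame.pbMap_pbVec he he', mapVec_mulVec]
  refine congr_arg _ (congr_arg₂ _ ?_ rfl)
  ext i j
  exact ((specSec (S.residueField p)).symm_apply_apply _).symm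

lemma pbVec_symm_inj {p : S} (hp : p ∈ S₀) {M : S.Modules} {e : Fin d → Γ(M, S₀)}
    (he : IsFrame e) : Function.Bijective fun a : Fin d → S.residueField p =>
      he.pbVec _ (top_le_preimage_of_mem hp)
        (mapVec (specSec (S.residueField p)).symm.toRingHom a) := by
  refine (he.pbVec _ _).bijective.comp ⟨fun a b hab => ?_,
    fun a => ⟨mapVec (specSec _).toRingHom a, ?_⟩⟩
  · have := congr_arg (mapVec (specSec (S.residueField p)).toRingHom) hab
    rwa [mapVec_specSec_symm, mapVec_specSec_symm] at this
  · exact mapVec_symm_specSec (R := S.residueField p) a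

/-- The chain on a fibre where `s = 0`. -/
lemma isAmbientChain_evalAt {p : S} (hp : p ∈ S₀) (hs : S.Γevaluation p s = 0) :
    IsAmbientChain n (endMap (evalAt hp) (upM hε)) (endMap (evalAt hp) (downM hε)) := by
  have hz : ∀ {M : S.Modules} {e : Fin d → Γ(M, S₀)} (he : IsFrame e)
      (a : Fin d → S.residueField p), he.pbVec _ (top_le_preimage_of_mem hp)
        (mapVec (specSec (S.residueField p)).symm.toRingHom a) = 0 ↔ a = 0 := by
    intro M e he a
    constructor
    · intro h
      apply (pbVec_symm_inj hp he).1
      simp only [h]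
      rw [mapVec_zero, map_zero]
    · rintro rfl
      rw [mapVec_zero, map_zero]
  have hu : ∀ {i : ℕ} (hi : i + 1 < n) (x : Fin d → S.residueField p),
      fibreMap p (𝓔.up (i := ⟨i, by omega⟩) (j := ⟨i + 1, hi⟩) rfl)
        ((hε ⟨i, by omega⟩).pbVec _ (top_le_preimage_of_mem hp)
          (mapVec (specSec (S.residueField p)).symm.toRingHom x)) =
      (hε ⟨i + 1, hi⟩).pbVec _ (top_le_preimage_of_mem hp)
          (mapVec (specSec (S.residueField p)).symm.toRingHom
            (endMap (evalAt hp) (upM hε) i x)) := by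
    intro i hi x
    rw [fibreMap_pbVec hp _ (hε ⟨i + 1, hi⟩), endMap_apply, upM_eq hε hi]
  have hw : ∀ {i : ℕ} (hi : i + 1 < n) (x : Fin d → S.residueField p),
      fibreMap p (𝓔.down (i := ⟨i, by omega⟩) (j := ⟨i + 1, hi⟩) rfl)
        ((hε ⟨i + 1, hi⟩).pbVec _ (top_le_preimage_of_mem hp)
          (mapVec (specSec (S.residueField p)).symm.toRingHom x)) =
      (hε ⟨i, by omega⟩).pbVec _ (top_le_preimage_of_mem hp)
          (mapVec (specSec (S.residueField p)).symm.toRingHom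
            (endMap (evalAt hp) (downM hε) i x)) := by
    intro i hi x
    rw [fibreMap_pbVec hp _ (hε ⟨i, by omega⟩), endMap_apply, downM_eq hε hi]
  refine ⟨?_, ?_, ?_, ?_, ?_, ?_⟩
  · intro i hi x
    have := (𝓔.exact_down_up (i := ⟨i, by omega⟩) (j := ⟨i + 1, hi⟩) rfl p hs).apply_apply_eq_zero
      ((hε ⟨i + 1, hi⟩).pbVec _ (top_le_preimage_of_mem hp)
          (mapVec (specSec (S.residueField p)).symm.toRingHom x))
    rwa [hw hi, hu hi, hz] at this
  · intro i hi x
    have := (𝓔.exact_up_down (i := ⟨i, by omega⟩) (j := ⟨i + 1, hi⟩) rfl p hs).apply_apply_eq_zero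
      ((hε ⟨i, by omega⟩).pbVec _ (top_le_preimage_of_mem hp)
          (mapVec (specSec (S.residueField p)).symm.toRingHom x))
    rwa [hu hi, hw hi, hz] at this
  · intro i hi x hx
    rw [← hz (hε ⟨i + 1, hi⟩), ← hu hi] at hx
    obtain ⟨y, hy⟩ := (𝓔.exact_down_up (i := ⟨i, by omega⟩) (j := ⟨i + 1, hi⟩) rfl p hs _).1 hx
    obtain ⟨y, rfl⟩ := (pbVec_symm_inj hp (hε ⟨i + 1, hi⟩)).2 y
    beta_reduce at hy
    rw [hw hi] at hy
    exact ⟨y, (pbVec_symm_inj hp (hε ⟨i, by omega⟩)).1 hy⟩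
  · intro i hi x hx
    rw [← hz (hε ⟨i, by omega⟩), ← hw hi] at hx
    obtain ⟨y, hy⟩ := (𝓔.exact_up_down (i := ⟨i, by omega⟩) (j := ⟨i + 1, hi⟩) rfl p hs _).1 hx
    obtain ⟨y, rfl⟩ := (pbVec_symm_inj hp (hε ⟨i, by omega⟩)).2 y
    beta_reduce at hy
    rw [hu hi] at hy
    exact ⟨y, (pbVec_symm_inj hp (hε ⟨i + 1, hi⟩)).1 hy⟩
  · intro i hi x hx
    have hi' : i + 1 < n := by omega
    rw [← hz (hε ⟨i + 1 + 1, hi⟩), ← hu (i := i + 1) hi, ← hu hi'] at hx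
    have := 𝓔.up_up (i := ⟨i, by omega⟩) (j := ⟨i + 1, hi'⟩) (k := ⟨i + 1 + 1, hi⟩) rfl rfl
      p hs _ hx
    rwa [hu hi', hz] at this
  · intro i hi x hx
    have hi' : i + 1 < n := by omega
    rw [← hz (hε ⟨i, by omega⟩), ← hw hi', ← hw (i := i + 1) hi] at hx
    have := 𝓔.down_down (i := ⟨i, by omega⟩) (j := ⟨i + 1, hi'⟩) (k := ⟨i + 1 + 1, hi⟩) rfl rfl p hs
      _ hx
    rwa [hw (i := i + 1) hi, hz] at this

lemma evalAt_comp_pull {X L : Scheme.{u}} (π : L ⟶ X) {q : L} {U : X.Opens} {V : L.Opens}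
    (hq : q ∈ V) (hV : V ≤ π ⁻¹ᵁ U) : (evalAt hq).comp (pull π hV) =
      (π.residueFieldMap q).hom.comp (evalAt (p := π q) (hV hq)) := by
  have h1 : ⊤ ≤ (L.fromSpecResidueField q ≫ π) ⁻¹ᵁ U :=
    (top_le_preimage_of_mem hq).trans (preimage_le _ hV)
  have h2 := evalR_comp (R := X.residueField (π q)) (R' := L.residueField q)
    (X.fromSpecResidueField (π q)) (π.residueFieldMap q).hom
    (Scheme.Hom.SpecMap_residueFieldMap_fromSpecResidueField π q)
    (top_le_preimage_of_mem (hV hq)) h1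
  exact (evalR_comp_pull (R := L.residueField q) π (L.fromSpecResidueField q) rfl hV
    (top_le_preimage_of_mem hq) h1).trans h2

/-- The chain on a geometric fibre where `s = 0`. -/
lemma isAmbientChain_evalAt_comp_pull {L : Scheme.{u}} (π : L ⟶ S) {q : L} {V : L.Opens}
    (hq : q ∈ V) (hV : V ≤ π ⁻¹ᵁ S₀) (hs : S.Γevaluation (π q) s = 0) :
    IsAmbientChain n (endMap ((evalAt hq).comp (pull π hV)) (upM hε))
      (endMap ((evalAt hq).comp (pull π hV)) (downM hε)) := by
  rw [evalAt_comp_pull π hq hV]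
  exact (isAmbientChain_evalAt hε (hV hq) hs).of_fieldExtension
    (g := (π.residueFieldMap q).hom)

end Chain

/-! ### Linked subbundles over `Spec R` as chains of submodules of `R ^ d`. -/

section Linked

variable {S : Scheme.{u}} {s : Γ(S, ⊤)} {n d r : ℕ} {𝓔 : LinkedBundle S s n d} {S₀ : S.Opens}
  {ε : ∀ i, Fin d → Γ(𝓔.E i, S₀)} (hε : ∀ i, IsFrame (ε i))

namespace LinkedSubBundle

variable {T : Scheme.{u}} {φ : T ⟶ S}

/-- The coordinate vectors of the sections of a linked subbundle. -/
def coord (𝓕 : LinkedSubBundle 𝓔 r φ) {V : T.Opens} (h : V ≤ φ ⁻¹ᵁ S₀) (k : ℕ) :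
    Submodule Γ(T, V) (Fin d → Γ(T, V)) :=
  if hk : k < n then (𝓕.F ⟨k, hk⟩).coord (hε _) h else ⊥

lemma coord_eq (𝓕 : LinkedSubBundle 𝓔 r φ) {V : T.Opens} (h : V ≤ φ ⁻¹ᵁ S₀) {k : ℕ}
    (hk : k < n) : 𝓕.coord hε h k = (𝓕.F ⟨k, hk⟩).coord (hε _) h := dif_pos hk

lemma coord_up (𝓕 : LinkedSubBundle 𝓔 r φ) {V : T.Opens} (h : V ≤ φ ⁻¹ᵁ S₀) {k : ℕ}
    (hk : k + 1 < n) {a : Fin d → Γ(T, V)} (ha : a ∈ 𝓕.coord hε h k) :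
    ((upM hε k).map (pull φ h)).mulVec a ∈ 𝓕.coord hε h (k + 1) := by
  rw [coord_eq hε _ _ hk, SubBundle.mem_coord, upM_eq hε hk, ← IsFrame.pbMap_pbVec]
  rw [coord_eq hε _ _ (by omega)] at ha
  exact 𝓕.up_mem _ _ _ ha

lemma coord_down (𝓕 : LinkedSubBundle 𝓔 r φ) {V : T.Opens} (h : V ≤ φ ⁻¹ᵁ S₀) {k : ℕ}
    (hk : k + 1 < n) {a : Fin d → Γ(T, V)} (ha : a ∈ 𝓕.coord hε h (k + 1)) :
    ((downM hε k).map (pull φ h)).mulVec a ∈ 𝓕.coord hε h k := by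
  rw [coord_eq hε _ _ (by omega), SubBundle.mem_coord, downM_eq hε hk, ← IsFrame.pbMap_pbVec]
  rw [coord_eq hε _ _ hk] at ha
  exact 𝓕.down_mem _ _ _ ha

variable {R R' : Type u} [CommRing R] [CommRing R'] {φ : Spec (.of R) ⟶ S}
  {φ' : Spec (.of R') ⟶ S} (hU : ⊤ ≤ φ ⁻¹ᵁ S₀)

/-- The submodules of `R ^ d` given by a linked subbundle over `Spec R`. -/
def vecs (𝓕 : LinkedSubBundle 𝓔 r φ) (k : ℕ) : Submodule R (Fin d → R) :=
  baseChange (specSec R).toRingHom (𝓕.coord hε hU k)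

lemma vecs_eq (𝓕 : LinkedSubBundle 𝓔 r φ) {k : ℕ} (hk : k < n) :
    𝓕.vecs hε hU k = (𝓕.F ⟨k, hk⟩).vecs (hε _) hU := by
  rw [vecs, coord_eq hε 𝓕 hU hk]; rfl

lemma mem_vecs_iff {𝓕 : LinkedSubBundle 𝓔 r φ} {k : ℕ} (hk : k < n) {a : Fin d → R} :
    a ∈ 𝓕.vecs hε hU k ↔ mapVec (specSec R).symm.toRingHom a ∈ 𝓕.coord hε hU k := by
  rw [vecs_eq hε hU 𝓕 hk, coord_eq hε 𝓕 hU hk, SubBundle.mem_vecs_iff]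

lemma mapVec_specSec_symm_mulVec (M : Matrix (Fin d) (Fin d) Γ(S, S₀)) (a : Fin d → R) :
    mapVec (specSec R).symm.toRingHom ((M.map (evalR φ hU)).mulVec a) =
      (M.map (pull φ hU)).mulVec (mapVec (specSec R).symm.toRingHom a) := by
  rw [mapVec_mulVec]
  congr 1
  ext i j
  exact (specSec R).symm_apply_apply _

lemma vecs_up (𝓕 : LinkedSubBundle 𝓔 r φ) {k : ℕ} (hk : k + 1 < n) {a : Fin d → R}
    (ha : a ∈ 𝓕.vecs hε hU k) :
    ((upM hε k).map (evalR φ hU)).mulVec a ∈ 𝓕.vecs hε hU (k + 1) := by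
  rw [mem_vecs_iff hε hU hk, mapVec_specSec_symm_mulVec]
  exact 𝓕.coord_up hε hU hk ((mem_vecs_iff hε hU (by omega)).1 ha)

lemma vecs_down (𝓕 : LinkedSubBundle 𝓔 r φ) {k : ℕ} (hk : k + 1 < n) {a : Fin d → R}
    (ha : a ∈ 𝓕.vecs hε hU (k + 1)) :
    ((downM hε k).map (evalR φ hU)).mulVec a ∈ 𝓕.vecs hε hU k := by
  rw [mem_vecs_iff hε hU (by omega), mapVec_specSec_symm_mulVec]
  exact 𝓕.coord_down hε hU hk ((mem_vecs_iff hε hU hk).1 ha)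

lemma isSplit_vecs [Subsingleton (Spec (.of R))] [Nontrivial R] (𝓕 : LinkedSubBundle 𝓔 r φ)
    {k : ℕ} (hk : k < n) : IsSplit r (𝓕.vecs hε hU k) := by
  rw [vecs_eq hε hU 𝓕 hk]
  exact SubBundle.isSplit_vecs _

/-- A linked chain of direct summands over a ring with one prime gives a linked subbundle. -/
lemma exists_vecs_eq [Subsingleton (Spec (.of R))] [Nontrivial R]
    {G : ℕ → Submodule R (Fin d → R)} (hG : ∀ k < n, IsSplit r (G k))
    (hup : ∀ k, k + 1 < n → ∀ a ∈ G k, ((upM hε k).map (evalR φ hU)).mulVec a ∈ G (k + 1))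
    (hdown : ∀ k, k + 1 < n → ∀ a ∈ G (k + 1), ((downM hε k).map (evalR φ hU)).mulVec a ∈ G k) :
    ∃ 𝓕 : LinkedSubBundle 𝓔 r φ, ∀ k < n, 𝓕.vecs hε hU k = G k := by
  choose F hF using fun i : Fin n => exists_subBundle_vecs_eq (hε i) hU (hG i i.2)
  have hmem : ∀ (i : Fin n) (a : Fin d → Γ(Spec (.of R), ⊤)),
      (hε i).pbVec φ hU a ∈ (F i).sec ⊤ ↔ mapVec (specSec R).toRingHom a ∈ G i := by
    intro i a
    rw [← hF, SubBundle.mem_vecs_iff, mapVec_symm_specSec]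
    rfl
  have hmul : ∀ (M : Matrix (Fin d) (Fin d) Γ(S, S₀)) (a : Fin d → Γ(Spec (.of R), ⊤)),
      mapVec (specSec R).toRingHom ((M.map (pull φ hU)).mulVec a) =
        (M.map (evalR φ hU)).mulVec (mapVec (specSec R).toRingHom a) := by
    intro M a
    rw [mapVec_mulVec]
    rfl
  refine ⟨⟨F, ?_, ?_⟩, ?_⟩
  · rintro ⟨i, hi⟩ ⟨j, hj⟩ h V x hx
    obtain rfl : i + 1 = j := h
    rcases eq_bot_or_eq_top V with rfl | rfl
    · have := subsingleton_sections_bot (pb φ (𝓔.E ⟨i + 1, hj⟩))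
      rw [Subsingleton.elim ((pbMap φ (𝓔.up (i := ⟨i, hi⟩) (j := ⟨i + 1, hj⟩) rfl)).app _ x) 0]
      exact zero_mem _
    · obtain ⟨a, rfl⟩ := ((hε ⟨i, hi⟩).pbVec φ hU).surjective x
      rw [IsFrame.pbMap_pbVec _ (hε ⟨i + 1, hj⟩), hmem, hmul]
      rw [hmem] at hx
      have := hup i hj _ hx
      rwa [upM_eq hε hj] at this
  · rintro ⟨i, hi⟩ ⟨j, hj⟩ h V x hx
    obtain rfl : i + 1 = j := h
    rcases eq_bot_or_eq_top V with rfl | rfl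
    · have := subsingleton_sections_bot (pb φ (𝓔.E ⟨i, hi⟩))
      rw [Subsingleton.elim ((pbMap φ (𝓔.down (i := ⟨i, hi⟩) (j := ⟨i + 1, hj⟩) rfl)).app _ x) 0]
      exact zero_mem _
    · obtain ⟨a, rfl⟩ := ((hε ⟨i + 1, hj⟩).pbVec φ hU).surjective x
      rw [IsFrame.pbMap_pbVec _ (hε ⟨i, hi⟩), hmem, hmul]
      rw [hmem] at hx
      have := hdown i hj _ hx
      rwa [downM_eq hε hj] at this
  · intro k hk
    rw [vecs_eq hε hU _ hk]
    exact hF ⟨k, hk⟩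

variable {hU} {𝓕 : LinkedSubBundle 𝓔 r φ} {𝓕' : LinkedSubBundle 𝓔 r φ'} {g : R →+* R'}
  {hφ : specMap g ≫ φ = φ'} (hU' : ⊤ ≤ φ' ⁻¹ᵁ S₀)

lemma IsPullback.vecs_eq_baseChange [Subsingleton (Spec (.of R))] [Subsingleton (Spec (.of R'))]
    [Nontrivial R'] (h : LinkedSubBundle.IsPullback (specMap g) hφ 𝓕 𝓕') {k : ℕ} (hk : k < n) :
    𝓕'.vecs hε hU' k = baseChange g (𝓕.vecs hε hU k) := by
  rw [vecs_eq hε _ _ hk, vecs_eq hε _ _ hk]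
  exact (h ⟨k, hk⟩).vecs_eq_baseChange hU'

lemma isPullback_of_vecs [Subsingleton (Spec (.of R))] [Subsingleton (Spec (.of R'))]
    (h : ∀ k < n, 𝓕'.vecs hε hU' k = baseChange g (𝓕.vecs hε hU k)) :
    LinkedSubBundle.IsPullback (specMap g) hφ 𝓕 𝓕' := by
  rintro ⟨k, hk⟩
  have := h k hk
  rw [vecs_eq hε _ _ hk, vecs_eq hε _ _ hk] at this
  exact SubBundle.isPullback_of_vecs (hU := hU) hU' this

end LinkedSubBundle

end Linked

/-! ### The rings `κ[ε]/(ε³)` and `κ[ε]/(ε²)`. -/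

section Truncated

open Polynomial

variable (κ : Type u) [Field κ]

/-- The ring `κ[ε]/(ε³)`. -/
abbrev Trunc : Type u := κ[X] ⧸ Ideal.span {(X : κ[X]) ^ 3}

/-- The class `ε` of the variable. -/
def truncEps : Trunc κ := Ideal.Quotient.mk _ X

/-- The inclusion of the constants. -/
def truncC : κ →+* Trunc κ := (Ideal.Quotient.mk _).comp C

/-- The reduction modulo `ε`. -/
def truncEval : Trunc κ →+* κ :=
  Ideal.Quotient.lift _ (evalRingHom 0) fun a ha => by
    obtain ⟨b, rfl⟩ := Ideal.mem_span_singleton.1 ha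
    simp

variable {κ}

lemma truncEval_truncC (a : κ) : truncEval κ (truncC κ a) = a := by
  simp [truncEval, truncC]

lemma truncEps_pow_three : truncEps κ ^ 3 = 0 := by
  rw [truncEps, ← map_pow]
  exact Ideal.Quotient.eq_zero_iff_mem.2 (Ideal.mem_span_singleton_self _)

lemma truncEval_truncEps : truncEval κ (truncEps κ) = 0 := by
  simp [truncEval, truncEps]

lemma truncEps_dvd_of_truncEval_eq_zero {a : Trunc κ} (ha : truncEval κ a = 0) :
    truncEps κ ∣ a := by
  obtain ⟨f, rfl⟩ := Ideal.Quotient.mk_surjective a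
  have : f.eval 0 = 0 := by simpa [truncEval] using ha
  rw [← coeff_zero_eq_eval_zero, ← X_dvd_iff] at this
  exact map_dvd _ this

lemma truncEval_eq_zero_of_mul {a : Trunc κ} (ha : truncEps κ ^ 2 * a = 0) :
    truncEval κ a = 0 := by
  obtain ⟨f, rfl⟩ := Ideal.Quotient.mk_surjective a
  rw [truncEps, ← map_pow, ← map_mul, Ideal.Quotient.eq_zero_iff_mem,
    Ideal.mem_span_singleton, pow_succ] at ha
  have h1 : X ∣ f := (mul_dvd_mul_iff_left (pow_ne_zero 2 X_ne_zero)).1 ha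
  rw [X_dvd_iff, coeff_zero_eq_eval_zero] at h1
  simpa [truncEval] using h1

/-- The kernel of `q` is maximal and consists of nilpotents, so every prime contains it and hence
equals it. -/
lemma subsingleton_spec {R : Type u} [CommRing R] {q : R →+* κ} (hq' : Function.Surjective q)
    (hq : ∀ a, q a = 0 → IsNilpotent a) : Subsingleton (Spec (.of R)) := by
  have key : ∀ p : PrimeSpectrum R, p.asIdeal = RingHom.ker q := by
    intro p
    refine ((RingHom.ker_isMaximal_of_surjective q hq').eq_of_le p.2.ne_top fun a ha => ?_).symm
    obtain ⟨m, hm⟩ := hq a ha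
    exact p.2.mem_of_pow_mem m (by rw [hm]; exact zero_mem _)
  exact ⟨fun p p' => PrimeSpectrum.ext ((key p).trans (key p').symm)⟩

variable (κ) in
/-- The rings `κ[ε]/(ε³) → κ[ε]/(ε²) → κ`. -/
lemma exists_truncations : ∃ (R R' : Type u) (_ : CommRing R) (_ : CommRing R') (c : κ →+* R)
    (q : R →+* κ) (ρ : R →+* R') (q' : R' →+* κ) (t : R), (∀ a, q (c a) = a) ∧ q'.comp ρ = q ∧
    Function.Surjective ρ ∧ RingHom.ker ρ = Ideal.span {t ^ 2} ∧ t ^ 3 = 0 ∧ q t = 0 ∧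
    (∀ a, t ^ 2 * a = 0 → q a = 0) ∧ Subsingleton (Spec (.of R)) ∧
    Subsingleton (Spec (.of R')) := by
  have hnil : ∀ a, truncEval κ a = 0 → IsNilpotent a := by
    intro a ha
    obtain ⟨b, rfl⟩ := truncEps_dvd_of_truncEval_eq_zero ha
    exact ⟨3, by rw [mul_pow, truncEps_pow_three, zero_mul]⟩
  refine ⟨Trunc κ, Trunc κ ⧸ Ideal.span {truncEps κ ^ 2}, inferInstance, inferInstance, truncC κ,
    truncEval κ, Ideal.Quotient.mk _, Ideal.Quotient.lift _ (truncEval κ) fun a ha => ?_,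
    truncEps κ, truncEval_truncC, rfl, Ideal.Quotient.mk_surjective, Ideal.mk_ker,
    truncEps_pow_three, truncEval_truncEps, fun _ => truncEval_eq_zero_of_mul,
    subsingleton_spec (fun a => ⟨_, truncEval_truncC a⟩) hnil,
    subsingleton_spec (q := Ideal.Quotient.lift _ (truncEval κ) fun a ha => ?_)
      (fun a => ⟨Ideal.Quotient.mk _ (truncC κ a), truncEval_truncC a⟩) fun a ha => ?_⟩
  · obtain ⟨b, rfl⟩ := Ideal.mem_span_singleton.1 ha
    simp [truncEval_truncEps]
  · obtain ⟨b, rfl⟩ := Ideal.mem_span_singleton.1 ha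
    simp [truncEval_truncEps]
  · obtain ⟨a, rfl⟩ := Ideal.Quotient.mk_surjective a
    exact (hnil a ha).map (Ideal.Quotient.mk (Ideal.span {truncEps κ ^ 2}))

end Truncated

/-! ### The subspace `(1 + ε φ) F`. -/

section DeformationAlgebra

open Matrix

variable {κ R : Type*} [Field κ] [CommRing R] {d n r : ℕ} {c : κ →+* R} {q : R →+* κ} {ε : R}

/-- The image under `1 + ε φ` of the base change of `F`. -/
def deform (c : κ →+* R) (ε : R) (F : Submodule κ (Fin d → κ))
    (φ : Module.End κ (Fin d → κ)) : Submodule R (Fin d → R) :=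
  (baseChange c F).map (1 + ε • (LinearMap.toMatrix' φ).map c).mulVecLin

lemma one_add_smul_mulVec (φ : Module.End κ (Fin d → κ)) (v : Fin d → κ) :
    (1 + ε • (LinearMap.toMatrix' φ).map c) *ᵥ mapVec c v = mapVec c v + ε • mapVec c (φ v) := by
  rw [add_mulVec, one_mulVec, smul_mulVec, ← mapVec_mulVec, LinearMap.toMatrix'_mulVec]

lemma mem_deform {F : Submodule κ (Fin d → κ)} (φ : Module.End κ (Fin d → κ)) {v : Fin d → κ}
    (hv : v ∈ F) : mapVec c v + ε • mapVec c (φ v) ∈ deform c ε F φ := by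
  rw [← one_add_smul_mulVec]
  exact Submodule.mem_map_of_mem (mapVec_mem_baseChange c hv)

lemma smul_mem_deform (hε : ε ^ 2 = 0) {F : Submodule κ (Fin d → κ)}
    (φ : Module.End κ (Fin d → κ)) {v : Fin d → κ} (hv : v ∈ F) :
    ε • mapVec c v ∈ deform c ε F φ := by
  have := Submodule.smul_mem _ ε (mem_deform (c := c) (ε := ε) φ hv)
  rwa [smul_add, smul_smul, ← sq, hε, zero_smul, add_zero] at this

lemma deform_le {F : Submodule κ (Fin d → κ)} {φ : Module.End κ (Fin d → κ)}
    {G : Submodule R (Fin d → R)} (h : ∀ v ∈ F, mapVec c v + ε • mapVec c (φ v) ∈ G) :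
    deform c ε F φ ≤ G := by
  rw [deform, Submodule.map_le_iff_le_comap, baseChange_le]
  intro v hv
  rw [Submodule.mem_comap, mulVecLin_apply, one_add_smul_mulVec]
  exact h v hv

/-- `1 + ε φ` is invertible with inverse `1 - ε φ`. -/
lemma isSplit_deform (hε : ε ^ 2 = 0) {F : Submodule κ (Fin d → κ)} (hF : IsSplit r F)
    (φ : Module.End κ (Fin d → κ)) : IsSplit r (deform c ε F φ) := by
  set Φ := (LinearMap.toMatrix' φ).map c
  have h : (ε • Φ) * (ε • Φ) = 0 := by
    rw [smul_mul_smul_comm, ← sq, hε, zero_smul]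
  refine (hF.baseChange c).map (A' := 1 - ε • Φ) ?_ ?_
  · rw [add_mul, one_mul, mul_sub, mul_one, h, sub_zero, sub_add_cancel]
  · rw [sub_mul, one_mul, mul_add, mul_one, h, add_zero, add_sub_cancel_right]

/-- `M (v + ε φ v)` is the sum of `M v + ε γ (M v)` and `ε (M φ v - γ M v)`, and multiples `ε x`
with `x ∈ G` lie in the deformation of `G` because `ε ^ 2 = 0`. This is what the conditions of
`IsDeformation` are made for. -/
lemma mulVec_mem_deform (hε : ε ^ 2 = 0) {F G : Submodule κ (Fin d → κ)}
    {φ γ : Module.End κ (Fin d → κ)} {M : Matrix (Fin d) (Fin d) κ}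
    (hM : ∀ x ∈ F, M *ᵥ x ∈ G) (h : ∀ x ∈ F, M *ᵥ φ x - γ (M *ᵥ x) ∈ G) {a : Fin d → R}
    (ha : a ∈ deform c ε F φ) : M.map c *ᵥ a ∈ deform c ε G γ := by
  have : deform c ε F φ ≤ (deform c ε G γ).comap (M.map c).mulVecLin := by
    refine deform_le fun v hv => ?_
    rw [Submodule.mem_comap, mulVecLin_apply, mulVec_add, mulVec_smul, ← mapVec_mulVec,
      ← mapVec_mulVec]
    have h1 := add_mem (mem_deform (c := c) (ε := ε) γ (hM v hv))
      (smul_mem_deform (c := c) hε γ (h v hv))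
    rw [add_assoc, ← smul_add, ← mapVec_add, add_sub_cancel] at h1
    exact h1
  exact this ha

lemma baseChange_deform (hqc : ∀ a, q (c a) = a) (hqε : q ε = 0) (F : Submodule κ (Fin d → κ))
    (φ : Module.End κ (Fin d → κ)) : baseChange q (deform c ε F φ) = F := by
  have hv : ∀ v : Fin d → κ, mapVec q (mapVec c v) = v := fun v => funext fun k => hqc _
  have key : ∀ v, mapVec q (mapVec c v + ε • mapVec c (φ v)) = v := by
    intro v
    rw [mapVec_add, mapVec_smul, hqε, zero_smul, add_zero, hv]
  apply le_antisymm
  · rw [baseChange_le]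
    have : deform c ε F φ ≤ (⊤ : Submodule R (Fin d → R)) := le_top
    intro a ha
    obtain ⟨b, hb, rfl⟩ := ha
    induction hb using Submodule.span_induction with
    | mem x hx =>
      obtain ⟨v, hv, rfl⟩ := hx
      rw [mulVecLin_apply, one_add_smul_mulVec, key]
      exact hv
    | zero => rw [map_zero, mapVec_zero]; exact zero_mem _
    | add x y _ _ hx hy => rw [map_add, mapVec_add]; exact add_mem hx hy
    | smul t x _ hx => rw [map_smul, mapVec_smul]; exact Submodule.smul_mem _ _ hx
  · intro v hv
    rw [← key v]
    exact mapVec_mem_baseChange q (mem_deform φ hv)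

end DeformationAlgebra

/-! ### Infinitesimal lifting along smooth morphisms. -/

section Smooth

/-- Smooth ring maps have the infinitesimal lifting property. -/
lemma exists_lift_of_smooth {A B R R' : Type*} [CommRing A] [CommRing B] [CommRing R] [CommRing R']
    {f : A →+* B} (hf : f.Smooth) {ρ : R →+* R'} (hρ : Function.Surjective ρ)
    (hρ' : IsNilpotent (RingHom.ker ρ)) {θ : B →+* R'} {η : A →+* R}
    (h : ρ.comp η = θ.comp f) : ∃ θ' : B →+* R, ρ.comp θ' = θ ∧ θ'.comp f = η := by
  algebraize [f, η, ρ.comp η]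
  let g : R →ₐ[A] R' := { ρ with commutes' := fun _ => rfl }
  let t : B →ₐ[A] R' := { θ with commutes' := fun x => (RingHom.congr_fun h x).symm }
  have := hf.1
  let θ' := Algebra.FormallySmooth.liftOfSurjective t g hρ hρ'
  refine ⟨θ'.toRingHom, ?_, ?_⟩
  · ext x
    exact Algebra.FormallySmooth.liftOfSurjective_apply t g hρ hρ' x
  · ext x
    exact θ'.commutes x

/-- The ring map on the affine charts differs from the one for `W.ι ≫ π` only by the isomorphism
between functions on `U` and on its preimage in `W`. -/
lemma smooth_pull {X S : Scheme.{u}} {π : X ⟶ S} {W U : X.Opens} {S₀ : S.Opens}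
    (hW : Smooth (W.ι ≫ π)) (hUW : U ≤ W) (hU : IsAffineOpen U) (hS₀ : IsAffineOpen S₀)
    (h : U ≤ π ⁻¹ᵁ S₀) : (pull π h).Smooth := by
  have hV : IsAffineOpen (W.ι ⁻¹ᵁ U) := by
    refine hU.preimage_of_isOpenImmersion W.ι ?_
    simpa using hUW
  have h1 := hW.smooth_appLE hS₀ hV (fun x hx => h hx)
  have h2 := Scheme.Hom.appLE_comp_appLE W.ι π S₀ U (W.ι ⁻¹ᵁ U) h le_rfl
  rw [← h2] at h1
  have h3 : IsIso (W.ι.appLE U (W.ι ⁻¹ᵁ U) le_rfl) := by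
    rw [Scheme.Hom.appLE_eq_app]
    exact W.ι.isIso_app U (by simpa using hUW)
  rwa [CommRingCat.hom_comp, RingHom.Smooth.respectsIso.cancel_right_isIso] at h1

end Smooth

/-! ### Exactness of the universal subbundle at smooth points over `s = 0`. -/

section SmoothPoint

open Matrix

variable {S : Scheme.{u}} {s : Γ(S, ⊤)} {n d r : ℕ} {𝓔 : LinkedBundle S s n d} {S₀ : S.Opens}
  {ε : ∀ i, Fin d → Γ(𝓔.E i, S₀)} (hε : ∀ i, IsFrame (ε i)) {LG : Scheme.{u}} {π : LG ⟶ S}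
  {𝓤 : LinkedSubBundle 𝓔 r π} {U : LG.Opens}
  {κ : Type u} [Field κ] {z : Spec (.of κ) ⟶ LG} (hz : ⊤ ≤ z ⁻¹ᵁ U)
  {𝓕 : LinkedSubBundle 𝓔 r (z ≫ π)} (h0 : ⊤ ≤ (z ≫ π) ⁻¹ᵁ S₀)

include hz in
/-- A first order deformation of a linked subspace gives a morphism to the linked Grassmannian. -/
lemma IsDeformation.exists_hom (hLG : IsLinkedGrassmannian 𝓔 r π 𝓤)
    (h𝓕 : 𝓤.IsPullback z rfl 𝓕) {φ : ℕ → Module.End κ (Fin d → κ)}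
    (hφ : IsDeformation n (endMap (evalR (z ≫ π) h0) (upM hε))
      (endMap (evalR (z ≫ π) h0) (downM hε)) (𝓕.vecs hε h0) φ)
    {R : Type u} [CommRing R] [Subsingleton (Spec (.of R))] [Nontrivial R] {c : κ →+* R}
    {q : R →+* κ} {t : R} (hqc : q.comp c = RingHom.id κ) (hqt : q t = 0) (ht : t ^ 2 = 0) :
    ∃ (ψ : Spec (.of R) ⟶ LG) (_ : ⊤ ≤ ψ ⁻¹ᵁ U) (h2 : ⊤ ≤ (ψ ≫ π) ⁻¹ᵁ S₀)
      (𝓕' : LinkedSubBundle 𝓔 r (ψ ≫ π)), evalR (ψ ≫ π) h2 = c.comp (evalR (z ≫ π) h0) ∧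
      𝓤.IsPullback ψ rfl 𝓕' ∧ ∀ k < n, 𝓕'.vecs hε h2 k = deform c t (𝓕.vecs hε h0 k) (φ k) := by
  have : Subsingleton (Spec (.of κ)) :=
    inferInstanceAs (Subsingleton (PrimeSpectrum κ))
  obtain ⟨φ', hφ'⟩ : ∃ φ', φ' = specMap c ≫ z ≫ π := ⟨_, rfl⟩
  have h2 : ⊤ ≤ φ' ⁻¹ᵁ S₀ := by
    subst hφ'
    exact fun x _ => h0 (show specMap c x ∈ ⊤ from trivial)
  have h3 : evalR φ' h2 = c.comp (evalR (z ≫ π) h0) := evalR_comp _ c hφ'.symm h0 h2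
  have hmap : ∀ M : Matrix (Fin d) (Fin d) Γ(S, S₀),
      M.map (evalR φ' h2) = (M.map (evalR (z ≫ π) h0)).map c := by
    intro M
    rw [h3, Matrix.map_map]
    rfl
  obtain ⟨𝓕', h𝓕'⟩ := LinkedSubBundle.exists_vecs_eq hε h2
    (G := fun k => deform c t (𝓕.vecs hε h0 k) (φ k))
    (fun k hk => isSplit_deform ht (𝓕.isSplit_vecs hε h0 hk) _)
    (by
      intro k hk a ha
      rw [hmap]
      exact mulVec_mem_deform ht (fun x hx => 𝓕.vecs_up hε h0 hk hx) (fun x hx => hφ.up hk hx) ha)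
    (by
      intro k hk a ha
      rw [hmap]
      exact mulVec_mem_deform ht (fun x hx => 𝓕.vecs_down hε h0 hk hx)
        (fun x hx => hφ.down hk hx) ha)
  obtain ⟨ψ, ⟨hψ, h𝓤⟩, -⟩ := hLG.existsUnique_hom φ' 𝓕'
  have hid : specMap q ≫ specMap c = 𝟙 _ := by
    rw [← Spec.map_comp, ← CommRingCat.ofHom_comp, hqc]
    exact Spec.map_id _
  have hq' : specMap q ≫ φ' = z ≫ π := by
    rw [hφ', ← Category.assoc, hid, Category.id_comp]
  -- Reducing the deformation gives back `𝓕`, so uniqueness of the classifying morphism shows that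
  -- `ψ` extends `z`.
  have hzψ : specMap q ≫ ψ = z := by
    refine (hLG.existsUnique_hom (z ≫ π) 𝓕).unique ⟨?_, fun i => ?_⟩ ⟨rfl, h𝓕⟩
    · rw [Category.assoc, hψ, hq']
    · have hpb : LinkedSubBundle.IsPullback (specMap q) hq' 𝓕' 𝓕 := by
        refine LinkedSubBundle.isPullback_of_vecs hε (hU := h2) h0 fun k hk => ?_
        rw [h𝓕' k hk, baseChange_deform (fun a => RingHom.congr_fun hqc a) hqt]
      exact (h𝓤 i).comp (hε i) (hpb i) h0
  -- `Spec R` has a single point and `ψ` extends `z`, so its image is the point in the image of `z`.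
  have hψU : ⊤ ≤ ψ ⁻¹ᵁ U := by
    intro x _
    have y : Spec (.of κ) := Classical.arbitrary (PrimeSpectrum κ)
    have hy : z y ∈ U := hz (show y ∈ ⊤ from trivial)
    rw [← hzψ, Scheme.Hom.comp_apply, Subsingleton.elim (specMap q y) x] at hy
    exact hy
  subst hψ
  refine ⟨ψ, hψU, h2, 𝓕', h3, h𝓤, fun k hk => ?_⟩
  exact h𝓕' k hk

include hz in
/-- At a smooth point over `s = 0`, the universal subbundle is exact. -/
theorem isExactChain_of_smooth (hLG : IsLinkedGrassmannian 𝓔 r π 𝓤)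
    (h𝓕 : 𝓤.IsPullback z rfl 𝓕) (hU : IsAffineOpen U) (hUS : U ≤ π ⁻¹ᵁ S₀)
    (hsm : (pull π hUS).Smooth)
    (hamb : IsAmbientChain n (endMap (evalR (z ≫ π) h0) (upM hε))
      (endMap (evalR (z ≫ π) h0) (downM hε))) :
    IsExactChain n (endMap (evalR (z ≫ π) h0) (upM hε))
      (endMap (evalR (z ≫ π) h0) (downM hε)) (𝓕.vecs hε h0) := by
  have : Subsingleton (Spec (.of κ)) :=
    inferInstanceAs (Subsingleton (PrimeSpectrum κ))
  have hsub : IsSubchain n (endMap (evalR (z ≫ π) h0) (upM hε))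
      (endMap (evalR (z ≫ π) h0) (downM hε)) (𝓕.vecs hε h0) :=
    ⟨fun hi _ hx => 𝓕.vecs_up hε h0 hi hx, fun hi _ hx => 𝓕.vecs_down hε h0 hi hx⟩
  have hr : ∀ i < n, Module.finrank κ (𝓕.vecs hε h0 i) = r := fun i hi =>
    (𝓕.isSplit_vecs hε h0 hi).finrank_eq
  refine hsub.isExactChain hamb hr fun {i} hi {v} hv hv0 => ?_
  by_contra hv'
  obtain ⟨φ, hφ, v', hv'F, hφv, hφv'⟩ := hamb.exists_obstructed_deformation hsub hr hi hv hv0 hv'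
  obtain ⟨R, R', _, _, c, q, ρ, q₂, t, hqc, hq₂, hρ, hker, ht, hqt, htq, _, _⟩ :=
    exists_truncations κ
  have hq₂c : ∀ a, q₂ ((ρ.comp c) a) = a := fun a => (RingHom.congr_fun hq₂ (c a)).trans (hqc a)
  have hq₂t : q₂ (ρ t) = 0 := (RingHom.congr_fun hq₂ t).trans hqt
  have : Nontrivial R := q.domain_nontrivial
  have : Nontrivial R' := q₂.domain_nontrivial
  obtain ⟨ψ₂, hψ₂, h2, 𝓕₂, he₂, h𝓕₂, hv₂⟩ := IsDeformation.exists_hom hε hz h0 hLG h𝓕 hφ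
    (c := ρ.comp c) (q := q₂) (t := ρ t) (RingHom.ext hq₂c) hq₂t
    (by
      rw [← map_pow, ← RingHom.mem_ker, hker]
      exact Ideal.mem_span_singleton_self _)
  -- The morphism to `S` is kept constant, equal to that of `z` composed with the inclusion of
  -- constants `c`; only the point of the Grassmannian is lifted. The kernel of `ρ` is `(t²)`, whose
  -- square is zero.
  obtain ⟨θ, hθ, hθ'⟩ := exists_lift_of_smooth hsm hρ (θ := evalR ψ₂ hψ₂)
    (η := c.comp (evalR (z ≫ π) h0))
    (by
      rw [hker]
      refine ⟨2, ?_⟩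
      rw [Ideal.span_singleton_pow, Ideal.zero_eq_bot, Ideal.span_singleton_eq_bot]
      rw [← pow_mul, pow_succ, ht, zero_mul])
    (by
      rw [← RingHom.comp_assoc, ← he₂]
      exact (evalR_comp_pull π ψ₂ rfl hUS hψ₂ h2).symm)
  obtain ⟨ψ₃, hψ₃, rfl⟩ := exists_evalR_eq hU θ
  have h3 : ⊤ ≤ (ψ₃ ≫ π) ⁻¹ᵁ S₀ := hψ₃.trans (preimage_le ψ₃ hUS)
  have he₃ : evalR (ψ₃ ≫ π) h3 = c.comp (evalR (z ≫ π) h0) := by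
    rw [← hθ', evalR_comp_pull π ψ₃ rfl hUS hψ₃ h3]
  obtain ⟨𝓕₃, h𝓕₃, -⟩ := hLG.existsUnique_pullback (ψ₃ ≫ π) ψ₃ rfl
  have hψ : specMap ρ ≫ ψ₃ = ψ₂ := by
    have h4 : ⊤ ≤ (specMap ρ ≫ ψ₃) ⁻¹ᵁ U := fun x _ => hψ₃ (show specMap ρ x ∈ ⊤ from trivial)
    refine eq_of_evalR_eq hU h4 hψ₂ ?_
    rw [evalR_comp ψ₃ ρ rfl hψ₃ h4, hθ]
  have hpb : ∀ k < n, 𝓕₂.vecs hε h2 k = baseChange ρ (𝓕₃.vecs hε h3 k) := by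
    subst hψ
    have : LinkedSubBundle.IsPullback (specMap ρ) (Category.assoc _ _ _).symm 𝓕₃ 𝓕₂ :=
      fun i => (h𝓕₃ i).of_comp (hε i) (h𝓕₂ i) h2
    exact fun k hk => LinkedSubBundle.IsPullback.vecs_eq_baseChange hε h2 this hk
  -- `x + t φ x` belongs to the first order deformation, hence lifts to the second order one. The
  -- lift is determined up to the kernel `(t²)` of `ρ`, which accounts for `y`.
  have hdef : ∀ k < n, ∀ x ∈ 𝓕.vecs hε h0 k, ∃ y : Fin d → R,
      (fun j => c (x j)) + t • (fun j => c (φ k x j)) + t ^ 2 • y ∈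
        𝓕₃.vecs hε h3 k := by
    intro k hk x hx
    have h5 := mem_deform (c := ρ.comp c) (ε := ρ t) (φ k) hx
    rw [← hv₂ k hk, hpb k hk] at h5
    obtain ⟨f, hf, hf'⟩ := exists_mapVec_eq_of_mem_baseChange hρ h5
    have h6 : ∀ j, ∃ y, f j - (c (x j) + t * c (φ k x j)) = t ^ 2 * y := by
      intro j
      rw [← dvd_def, ← Ideal.mem_span_singleton, ← hker, RingHom.mem_ker, map_sub, sub_eq_zero]
      exact (congr_fun hf' j).trans (by simp [mapVec])
    choose y hy using h6
    refine ⟨y, ?_⟩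
    convert hf using 1
    funext j
    simp only [Pi.add_apply, Pi.smul_apply, smul_eq_mul, ← hy]
    ring
  subst hφv
  refine false_of_lift c q hqc ht htq (u := (upM hε i).map (evalR (z ≫ π) h0))
    (w := (downM hε i).map (evalR (z ≫ π) h0)) (G := 𝓕.vecs hε h0 (i + 1))
    (F' := 𝓕₃.vecs hε h3 i) (G' := 𝓕₃.vecs hε h3 (i + 1)) (hamb.down_up hi) ?_
    (fun y hy => (𝓕₃.isSplit_vecs hε h3 hi).exists_smul_eq hy) ?_ hv0 rfl hφv'
    (hdef i (by omega) v hv) (hdef (i + 1) hi _ hv'F) ?_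
  · intro x hx
    have := 𝓕₃.vecs_up hε h3 hi hx
    rw [he₃] at this
    rw [Matrix.map_map]
    exact this
  · intro f hf
    have h5 := mapVec_mem_baseChange ρ hf
    rw [← hpb _ hi, hv₂ _ hi] at h5
    have h6 := mapVec_mem_baseChange q₂ h5
    rw [baseChange_deform hq₂c hq₂t, mapVec_mapVec, hq₂] at h6
    exact h6
  · intro x hx hxv
    exact hv' ⟨x, hx, hxv⟩

end SmoothPoint

/-! ### A determinant criterion for generators of a free direct summand. -/

section ColDet

open Matrix

variable {R R' ι : Type*} [CommRing R] [CommRing R'] [Fintype ι] [DecidableEq ι] {r q : ℕ}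

/-- The determinant that expresses `r` elements of `colSpan P` in terms of the columns of `P`,
where `Q` is the inverse of `P`. -/
def colDet (Q : Matrix (Fin r ⊕ Fin q) ι R) (A : Fin r → ι → R) : R :=
  (Matrix.of fun i k : Fin r => (Q *ᵥ A k) (Sum.inl i)).det

omit [DecidableEq ι] in
lemma map_colDet (θ : R →+* R') (Q : Matrix (Fin r ⊕ Fin q) ι R) (A : Fin r → ι → R) :
    θ (colDet Q A) = colDet (Q.map θ) (fun k => mapVec θ (A k)) := by
  rw [colDet, colDet, RingHom.map_det]
  congr 1
  ext i k
  simp only [Matrix.of_apply, ← mapVec_mulVec]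
  rfl

/-- `C` expresses the `A k` in the basis of columns. If they generate, `C` has a right inverse,
which suffices for a square matrix; conversely `C⁻¹` recovers the basis. -/
lemma span_eq_colSpan_iff {P : Matrix ι (Fin r ⊕ Fin q) R} {Q : Matrix (Fin r ⊕ Fin q) ι R}
    (hPQ : P * Q = 1) (hQP : Q * P = 1) {A : Fin r → ι → R} (hA : ∀ k, A k ∈ colSpan P) :
    Submodule.span R (Set.range A) = colSpan P ↔ IsUnit (colDet Q A) := by
  set C : Matrix (Fin r) (Fin r) R := fun i k => (Q *ᵥ A k) (Sum.inl i) with hC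
  have hAC : ∀ k, A k = ∑ i, C i k • P.col (Sum.inl i) := by
    intro k
    have h1 : A k = P *ᵥ (Q *ᵥ A k) := by rw [mulVec_mulVec, hPQ, one_mulVec]
    have h2 : ∀ w : Fin r ⊕ Fin q → R, (∀ l, w (Sum.inr l) = 0) →
        P *ᵥ w = ∑ i, w (Sum.inl i) • P.col (Sum.inl i) := by
      intro w hw
      funext j
      simp [mulVec, dotProduct, mul_comm, hw]
    exact h1.trans (h2 _ ((mem_colSpan_iff hPQ hQP).1 (hA k)))
  have hdet : IsUnit (colDet Q A) ↔ IsUnit C := (Matrix.isUnit_iff_isUnit_det C).symm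
  rw [hdet]
  constructor
  · intro h
    have h1 : ∀ i, ∃ D : Fin r → R, ∑ k, D k • A k = P.col (Sum.inl i) := by
      intro i
      rw [← Submodule.mem_span_range_iff_exists_fun, h]
      exact Submodule.subset_span ⟨i, rfl⟩
    choose D hD using h1
    have h2 : C * Matrix.of (fun k i => D i k) = 1 := by
      ext j i
      have h3 := congr_fun (congr_arg (Q *ᵥ ·) (hD i)) (Sum.inl j)
      have h4 : Q *ᵥ P.col (Sum.inl i) = (Q * P).col (Sum.inl i) := rfl
      simp only [h4, hQP, mulVec_sum, mulVec_smul, Finset.sum_apply, Pi.smul_apply] at h3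
      rw [Matrix.mul_apply]
      simp only [Matrix.of_apply, hC]
      rw [Finset.sum_congr rfl fun k _ => mul_comm _ _]
      refine h3.trans ?_
      simp [Matrix.col, Matrix.one_apply]
    exact IsUnit.of_mul_eq_one _ h2
  · rintro ⟨C', hC'⟩
    apply le_antisymm
    · rw [Submodule.span_le]
      rintro _ ⟨k, rfl⟩
      exact hA k
    · rw [colSpan, Submodule.span_le]
      rintro _ ⟨i, rfl⟩
      beta_reduce
      have h1 : P.col (Sum.inl i) = ∑ k, (↑C'⁻¹ : Matrix (Fin r) (Fin r) R) k i • A k := by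
        have h2 : ∀ j, ∑ k, C j k * (↑C'⁻¹ : Matrix (Fin r) (Fin r) R) k i =
            (1 : Matrix (Fin r) (Fin r) R) j i := by
          intro j
          rw [← Matrix.mul_apply, ← hC', Units.mul_inv]
        simp only [hAC, Finset.smul_sum, smul_smul]
        rw [Finset.sum_comm]
        simp only [← Finset.sum_smul]
        rw [Finset.sum_congr rfl fun j _ => by
          rw [Finset.sum_congr rfl fun k _ => mul_comm _ _, h2 j]]
        simp [Matrix.one_apply]
      rw [SetLike.mem_coe, h1]
      exact Submodule.sum_mem _ fun k _ =>
        Submodule.smul_mem _ _ (Submodule.subset_span ⟨k, rfl⟩)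

end ColDet

lemma subsingleton_spec_of_field (κ : Type u) [Field κ] : Subsingleton (Spec (.of κ)) :=
  inferInstanceAs (Subsingleton (PrimeSpectrum κ))

/-! ### Values in the residue field, and restriction of a subbundle to a point. -/

section Lifting

variable {Y Z : Scheme.{u}} {M : Z.Modules} {U : Z.Opens} {ι : Type} [Fintype ι]
  {e : ι → Γ(M, U)} {r : ℕ} {φ : Y ⟶ Z} {p : Y}

lemma evalAt_resFun {V V' : Y.Opens} (hp : p ∈ V') (h : V' ≤ V) (a : Γ(Y, V)) :
    evalAt hp (resHom h a) = evalAt (h hp) a :=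
  congr_arg (specSec (Y.residueField p)) (pull_resFun _ (top_le_preimage_of_mem hp) h a)

omit [Fintype ι] in
lemma mapVec_evalAt_resHom {V V' : Y.Opens} (hp : p ∈ V') (h : V' ≤ V) (a : ι → Γ(Y, V)) :
    mapVec (evalAt hp) (mapVec (resHom h) a) = mapVec (evalAt (h hp)) a :=
  funext fun k => evalAt_resFun hp h (a k)

/-- Elements of the residue field are values of functions. -/
lemma exists_evalAt_eq {V : Y.Opens} (hp : p ∈ V) (t : Y.residueField p) :
    ∃ (V' : Y.Opens) (_ : V' ≤ V) (hp' : p ∈ V') (a : Γ(Y, V')), evalAt hp' a = t := by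
  obtain ⟨b, rfl⟩ := Y.residue_surjective p t
  obtain ⟨W, hW, a, rfl⟩ := TopCat.Presheaf.exists_germ_eq Y.presheaf b
  have hp' : p ∈ W ⊓ V := ⟨hW, hp⟩
  refine ⟨W ⊓ V, inf_le_right, hp', resHom inf_le_left a, ?_⟩
  rw [evalAt_resFun hp', evalAt_eq_evaluation]
  rfl

/-- The neighbourhood is the basic open set of `a`. -/
lemma isUnit_of_evalAt_ne_zero {V : Y.Opens} (hp : p ∈ V) {a : Γ(Y, V)} (ha : evalAt hp a ≠ 0) :
    ∃ (V' : Y.Opens) (h : V' ≤ V), p ∈ V' ∧ IsUnit (resHom h a) := by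
  refine ⟨Y.basicOpen a, Y.basicOpen_le a, ?_, ?_⟩
  · rw [evalAt_eq_evaluation] at ha
    by_contra h
    exact ha ((Y.evaluation_eq_zero_iff_notMem_basicOpen p hp a).2 h)
  · exact RingedSpace.isUnit_res_basicOpen Y.toRingedSpace a

variable {F : SubBundle (pb φ M) r} {F' : SubBundle (pb (Y.fromSpecResidueField p ≫ φ) M) r}
  (he : IsFrame e)

lemma SubBundle.vecs_fromSpecResidueField
    (hF : SubBundle.IsPullback (Y.fromSpecResidueField p) φ rfl F F')
    {V : Y.Opens} (hV : V ≤ φ ⁻¹ᵁ U) (hp : p ∈ V)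
    (hU : ⊤ ≤ (Y.fromSpecResidueField p ≫ φ) ⁻¹ᵁ U) (hres : ∀ (V' : Y.Opens) (h' : V' ≤ V),
      F.coord he (h'.trans hV) = baseChange (resHom h') (F.coord he hV)) :
    SubBundle.vecs (R := Y.residueField p) F' he hU =
      baseChange (evalAt hp) (F.coord he hV) := by
  have h1 := subsingleton_spec_of_field (Y.residueField p)
  exact @SubBundle.IsPullback.vecs_eq _ _ _ _ _ _ _ _ _ _ _ _ he hU h1 _ _ _ _ _ hF _ hV
    (top_le_preimage_of_mem hp) hres

end Lifting

/-! ### From generators of a fibre to generators in a neighbourhood. -/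

section LocalGenerators

variable {Y Z : Scheme.{u}} {M : Z.Modules} {U : Z.Opens} {ι : Type} [Fintype ι] [DecidableEq ι]
  {e : ι → Γ(M, U)} {r : ℕ} {φ : Y ⟶ Z} {p : Y}
  {F : SubBundle (pb φ M) r} {F' : SubBundle (pb (Y.fromSpecResidueField p ≫ φ) M) r}
  (he : IsFrame e)

omit [Fintype ι] [DecidableEq ι] in
lemma mapVec_resHom_resHom {X : Scheme.{u}} {V V' V'' : X.Opens} (h : V' ≤ V) (h' : V'' ≤ V')
    (a : ι → Γ(X, V)) :
    mapVec (resHom h') (mapVec (resHom h) a) = mapVec (resHom (h'.trans h)) a := by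
  rw [mapVec_mapVec, resHom_comp_resHom]

/-- Near each point, the coordinate vectors of a subbundle are compatible with restriction. -/
lemma SubBundle.exists_coord_res (F : SubBundle (pb φ M) r) (he : IsFrame e)
    (hp : p ∈ φ ⁻¹ᵁ U) : ∃ (V : Y.Opens) (hV : V ≤ φ ⁻¹ᵁ U) (q : ℕ)
      (P : Matrix ι (Fin r ⊕ Fin q) Γ(Y, V)) (Q : Matrix (Fin r ⊕ Fin q) ι Γ(Y, V)), p ∈ V ∧
      P * Q = 1 ∧ Q * P = 1 ∧ F.coord he hV = colSpan P ∧
      ∀ (V' : Y.Opens) (h : V' ≤ V),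
        F.coord he (h.trans hV) = baseChange (resHom h) (F.coord he hV) := by
  obtain ⟨V, hV, q, P, Q, hp, hPQ, hQP, hF⟩ := F.exists_coord_eq he hp
  have h0 : F.coord he hV = colSpan P := by
    refine (hF V le_rfl).trans (congr_arg _ ?_)
    ext i j
    exact resFun_self _
  exact ⟨V, hV, q, P, Q, hp, hPQ, hQP, h0, fun V' h => by rw [hF V' h, h0, colSpan_map]⟩

/-- Vectors in the fibre of a subbundle lift to sections near the point. -/
lemma SubBundle.exists_mapVec_evalAt_eq
    (hF : SubBundle.IsPullback (Y.fromSpecResidueField p) φ rfl F F')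
    (hU : ⊤ ≤ (Y.fromSpecResidueField p ≫ φ) ⁻¹ᵁ U) {v : ι → Y.residueField p}
    (hv : v ∈ SubBundle.vecs (R := Y.residueField p) F' he hU) :
    ∃ (V : Y.Opens) (hV : V ≤ φ ⁻¹ᵁ U) (hp : p ∈ V) (a : ι → Γ(Y, V)),
      a ∈ F.coord he hV ∧ mapVec (evalAt hp) a = v := by
  have hpU : p ∈ φ ⁻¹ᵁ U := by
    have x : Spec (Y.residueField p) := Classical.arbitrary (PrimeSpectrum (Y.residueField p))
    have := hU (show x ∈ ⊤ from trivial)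
    change φ (Y.fromSpecResidueField p x) ∈ U at this
    rwa [Scheme.fromSpecResidueField_apply] at this
  obtain ⟨V, hV, q, P, Q, hp, hPQ, hQP, h0, hres⟩ := F.exists_coord_res he hpU
  have hv' : v ∈ baseChange (evalAt hp) (F.coord he hV) :=
    (SubBundle.vecs_fromSpecResidueField he hF hV hp hU hres).le hv
  clear hv
  induction hv' using Submodule.span_induction with
  | mem x hx =>
    obtain ⟨a, ha, rfl⟩ := hx
    exact ⟨V, hV, hp, a, ha, rfl⟩
  | zero => exact ⟨V, hV, hp, 0, zero_mem _, mapVec_zero _⟩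
  | add x y _ _ hx hy =>
    obtain ⟨V₁, hV₁, hp₁, a, ha, rfl⟩ := hx
    obtain ⟨V₂, hV₂, hp₂, b, hb, rfl⟩ := hy
    have hp' : p ∈ V₁ ⊓ V₂ := ⟨hp₁, hp₂⟩
    refine ⟨V₁ ⊓ V₂, inf_le_left.trans hV₁, hp',
      mapVec (resHom inf_le_left) a + mapVec (resHom inf_le_right) b,
      add_mem (SubBundle.coord_res he _ ha) (SubBundle.coord_res he _ hb), ?_⟩
    rw [mapVec_add, mapVec_evalAt_resHom hp', mapVec_evalAt_resHom hp']
  | smul t x _ hx =>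
    obtain ⟨V₁, hV₁, hp₁, a, ha, rfl⟩ := hx
    obtain ⟨V₂, hV₂, hp₂, b, rfl⟩ := exists_evalAt_eq hp₁ t
    refine ⟨V₂, hV₂.trans hV₁, hp₂, b • mapVec (resHom hV₂) a,
      Submodule.smul_mem _ _ (SubBundle.coord_res he _ ha), ?_⟩
    rw [mapVec_smul, mapVec_evalAt_resHom hp₂]

/-- Sections of a subbundle that span the fibre at `p` span the subbundle near `p`. -/
lemma SubBundle.exists_span_eq
    (hF : SubBundle.IsPullback (Y.fromSpecResidueField p) φ rfl F F')
    (hU : ⊤ ≤ (Y.fromSpecResidueField p ≫ φ) ⁻¹ᵁ U) {V : Y.Opens} (hV : V ≤ φ ⁻¹ᵁ U)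
    (hp : p ∈ V) {A : Fin r → ι → Γ(Y, V)} (hA : ∀ k, A k ∈ F.coord he hV)
    (hspan : Submodule.span (Y.residueField p) (Set.range fun k => mapVec (evalAt hp) (A k)) =
      SubBundle.vecs (R := Y.residueField p) F' he hU) :
    ∃ (V' : Y.Opens) (h : V' ≤ V), p ∈ V' ∧ ∀ (V'' : Y.Opens) (h' : V'' ≤ V'),
      F.coord he ((h'.trans h).trans hV) =
        Submodule.span Γ(Y, V'') (Set.range fun k => mapVec (resHom (h'.trans h)) (A k)) := by
  obtain ⟨V₀, hV₀, q, P, Q, hp₀, hPQ, hQP, h0, hres⟩ := F.exists_coord_res he (hV hp)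
  replace hspan := hspan.trans (SubBundle.vecs_fromSpecResidueField he hF hV₀ hp₀ hU hres)
  rw [h0, ← colSpan_map] at hspan
  have hmap : ∀ {R : Type u} [CommRing R] (θ : Γ(Y, V₀) →+* R),
      P.map θ * Q.map θ = 1 ∧ Q.map θ * P.map θ = 1 := by
    intro R _ θ
    rw [← Matrix.map_mul, ← Matrix.map_mul, hPQ, hQP, Matrix.map_one _ (map_zero θ) (map_one θ),
      Matrix.map_one _ (map_zero θ) (map_one θ)]
    exact ⟨rfl, rfl⟩
  have hp₁ : p ∈ V ⊓ V₀ := ⟨hp, hp₀⟩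
  have hle : V ⊓ V₀ ≤ V := inf_le_left
  have hle₀ : V ⊓ V₀ ≤ V₀ := inf_le_right
  have hA₁ : ∀ (V'' : Y.Opens) (h : V'' ≤ V ⊓ V₀) k,
      mapVec (resHom (h.trans hle)) (A k) ∈ colSpan (P.map (resHom (h.trans hle₀))) := by
    intro V'' h k
    rw [colSpan_map, ← h0, ← hres]
    exact SubBundle.coord_res he (h.trans hle) (hA k)
  -- Over the residue field the given vectors generate, so the value of their determinant is a unit.
  -- It then becomes invertible near `p`, and remains so on every smaller open set.
  have hev : evalAt hp₁ (colDet (Q.map (resHom hle₀)) fun k => mapVec (resHom hle) (A k)) ≠ 0 := by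
    rw [map_colDet]
    simp only [mapVec_evalAt_resHom hp₁]
    have hQ : (Q.map (resHom hle₀)).map (evalAt hp₁) = Q.map (evalAt hp₀) := by
      ext i j
      exact evalAt_resFun hp₁ hle₀ _
    have hA₂ : ∀ k, mapVec (evalAt hp) (A k) ∈ colSpan (P.map (evalAt hp₀)) := by
      intro k
      rw [← hspan]
      exact Submodule.subset_span ⟨k, rfl⟩
    rw [hQ]
    exact ((span_eq_colSpan_iff (hmap _).1 (hmap _).2 hA₂).1 hspan).ne_zero
  obtain ⟨V', h, hp', hunit⟩ := isUnit_of_evalAt_ne_zero hp₁ hev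
  refine ⟨V', h.trans hle, hp', fun V'' h' => ?_⟩
  have h1 := hunit.map (resHom h')
  rw [map_colDet, map_colDet] at h1
  have hQ : ((Q.map (resHom hle₀)).map (resHom h)).map (resHom h') =
      Q.map (resHom ((h'.trans h).trans hle₀)) := by
    ext i j
    change resFun h' (resFun h (resFun hle₀ _)) = _
    rw [resFun_resFun, resFun_resFun]
    rfl
  simp only [mapVec_resHom_resHom] at h1
  rw [hQ] at h1
  have h2 := (span_eq_colSpan_iff (hmap _).1 (hmap _).2 (hA₁ V'' (h'.trans h))).2 h1
  rw [h2, colSpan_map, ← h0, ← hres]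

end LocalGenerators

/-! ### Generators of a linked subbundle at various positions. -/

section Transport

variable {S : Scheme.{u}} {s : Γ(S, ⊤)} {n d r : ℕ} {𝓔 : LinkedBundle S s n d} {S₀ : S.Opens}
  {ε : ∀ i, Fin d → Γ(𝓔.E i, S₀)} (hε : ∀ i, IsFrame (ε i))

/-- The matrix of the transport from position `i` to position `j`. -/
def transportM (i j : ℕ) : Matrix (Fin d) (Fin d) Γ(S, S₀) := transport (upM hε) (downM hε) i j

lemma map_transportM {R : Type*} [CommRing R] (θ : Γ(S, S₀) →+* R) (i j : ℕ) (x : Fin d → R) :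
    ((transportM hε i j).map θ).mulVec x =
      transport (endMap θ (upM hε)) (endMap θ (downM hε)) i j x := by
  let f : Matrix (Fin d) (Fin d) Γ(S, S₀) →* Module.End R (Fin d → R) :=
    (Matrix.toLinAlgEquiv' (R := R) (n := Fin d)).toRingEquiv.toRingHom.toMonoidHom.comp
      (θ.mapMatrix (m := Fin d)).toMonoidHom
  have := map_transport (upM hε) (downM hε) f i j
  exact LinearMap.congr_fun this x

lemma LinkedSubBundle.coord_transport {T : Scheme.{u}} {φ : T ⟶ S} (𝓕 : LinkedSubBundle 𝓔 r φ)
    {V : T.Opens} (h : V ≤ φ ⁻¹ᵁ S₀) {i j : ℕ} (hi : i < n) (hj : j < n) {a : Fin d → Γ(T, V)}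
    (ha : a ∈ 𝓕.coord hε h i) :
    ((transportM hε i j).map (pull φ h)).mulVec a ∈ 𝓕.coord hε h j := by
  rw [map_transportM]
  exact transport_induction _ _ (P := fun j (f : Module.End _ _) => f a ∈ 𝓕.coord hε h j) hi ha
    (fun j f hj hf => 𝓕.coord_up hε h hj hf) (fun j f hj hf => 𝓕.coord_down hε h hj hf) hj

/-- If the fibre at `p` of a linked subbundle is generated by vectors at certain positions, then
so is the linked subbundle near `p`. -/
lemma LinkedSubBundle.exists_generators {T : Scheme.{u}} {φ : T ⟶ S} {p : T}
    {𝓕 : LinkedSubBundle 𝓔 r φ} {𝓕' : LinkedSubBundle 𝓔 r (T.fromSpecResidueField p ≫ φ)}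
    (h𝓕 : 𝓕.IsPullback (T.fromSpecResidueField p) rfl 𝓕') (hp : p ∈ φ ⁻¹ᵁ S₀)
    (hU : ⊤ ≤ (T.fromSpecResidueField p ≫ φ) ⁻¹ᵁ S₀) {pos : Fin r → ℕ}
    {v : Fin r → Fin d → T.residueField p} (hpos : ∀ k, pos k < n)
    (hv : ∀ k, v k ∈ LinkedSubBundle.vecs (R := T.residueField p) hε hU 𝓕' (pos k))
    (hspan : ∀ j < n, LinkedSubBundle.vecs (R := T.residueField p) hε hU 𝓕' j =
      Submodule.span (T.residueField p) (Set.range fun k =>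
        ((transportM hε (pos k) j).map
          (evalR (R := T.residueField p) (T.fromSpecResidueField p ≫ φ) hU)).mulVec (v k))) :
    ∃ (V : T.Opens) (hV : V ≤ φ ⁻¹ᵁ S₀) (a : Fin r → Fin d → Γ(T, V)), p ∈ V ∧
      IsAffineOpen V ∧ (∀ k, a k ∈ 𝓕.coord hε hV (pos k)) ∧
      ∀ j < n, ∀ (V' : T.Opens) (h : V' ≤ V), 𝓕.coord hε (h.trans hV) j =
        Submodule.span Γ(T, V') (Set.range fun k => mapVec (resHom h)
          (((transportM hε (pos k) j).map (pull φ hV)).mulVec (a k))) := by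
  have hlift : ∀ k, ∃ (V : T.Opens) (hV : V ≤ φ ⁻¹ᵁ S₀) (hp : p ∈ V) (a : Fin d → Γ(T, V)),
      a ∈ 𝓕.coord hε hV (pos k) ∧ mapVec (evalAt hp) a = v k := by
    intro k
    have h1 := (LinkedSubBundle.vecs_eq (R := T.residueField p) hε hU 𝓕' (hpos k)).le (hv k)
    obtain ⟨V, hV, hp, a, ha, hav⟩ :=
      SubBundle.exists_mapVec_evalAt_eq (hε _) (h𝓕 ⟨pos k, hpos k⟩) hU h1
    exact ⟨V, hV, hp, a, by rwa [LinkedSubBundle.coord_eq hε _ _ (hpos k)], hav⟩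
  choose V hV hpV a ha hav using hlift
  let W : T.Opens := Finset.univ.inf V ⊓ φ ⁻¹ᵁ S₀
  have hWV : ∀ k, W ≤ V k := fun k => inf_le_left.trans (Finset.inf_le (Finset.mem_univ k))
  have hW : W ≤ φ ⁻¹ᵁ S₀ := inf_le_right
  have hpW : p ∈ W := by
    refine ⟨?_, hp⟩
    rw [TopologicalSpace.Opens.coe_finset_inf]
    simpa using hpV
  let b : Fin r → Fin d → Γ(T, W) := fun k => mapVec (resHom (hWV k)) (a k)
  have hb : ∀ k, b k ∈ 𝓕.coord hε hW (pos k) := by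
    intro k
    have h1 := ha k
    rw [LinkedSubBundle.coord_eq hε _ _ (hpos k)] at h1 ⊢
    exact SubBundle.coord_res _ _ h1
  have hbv : ∀ k, mapVec (evalAt hpW) (b k) = v k := by
    intro k
    rw [← hav k]
    exact mapVec_evalAt_resHom hpW _ _
  have hθ : (evalAt hpW).comp (pull φ hW) =
      evalR (R := T.residueField p) (T.fromSpecResidueField p ≫ φ) hU :=
    evalR_comp_pull (R := T.residueField p) φ (T.fromSpecResidueField p) rfl hW
      (top_le_preimage_of_mem hpW) hU
  have hspan' : ∀ j : Fin n, ∃ (V' : T.Opens) (h : V' ≤ W), p ∈ V' ∧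
      ∀ (V'' : T.Opens) (h' : V'' ≤ V'), (𝓕.F j).coord (hε j) ((h'.trans h).trans hW) =
        Submodule.span Γ(T, V'') (Set.range fun k => mapVec (resHom (h'.trans h))
          (((transportM hε (pos k) j).map (pull φ hW)).mulVec (b k))) := by
    intro j
    refine SubBundle.exists_span_eq (hε j) (h𝓕 j) hU hW hpW (fun k => ?_) ?_
    · have := 𝓕.coord_transport hε hW (hpos k) j.2 (hb k)
      rwa [LinkedSubBundle.coord_eq hε _ _ j.2] at this
    · refine Eq.trans ?_ ((hspan j j.2).symm.trans
        (LinkedSubBundle.vecs_eq (R := T.residueField p) hε hU 𝓕' j.2))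
      congr 2
      funext k
      rw [mapVec_mulVec, hbv, Matrix.map_map, ← hθ]
      rfl
  choose V' hV' hpV' hspan'' using hspan'
  -- Each position gives its own neighbourhood; as there are finitely many, one affine neighbourhood
  -- serves all of them.
  obtain ⟨W', hW'a, hpW', hle⟩ := exists_isAffineOpen_mem_and_subset (X := T) (x := p)
    (U := Finset.univ.inf V' ⊓ W) (by
      refine ⟨?_, hpW⟩
      rw [TopologicalSpace.Opens.coe_finset_inf]
      simpa using hpV')
  have hle' : W' ≤ Finset.univ.inf V' ⊓ W := hle
  have hW'V : ∀ j, W' ≤ V' j := fun j =>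
    (hle'.trans inf_le_left).trans (Finset.inf_le (Finset.mem_univ j))
  have hW' : W' ≤ W := hle'.trans inf_le_right
  refine ⟨W', hW'.trans hW, fun k => mapVec (resHom hW') (b k), hpW', hW'a, fun k => ?_,
    fun j hj V'' h => ?_⟩
  · have h1 := hb k
    rw [LinkedSubBundle.coord_eq hε _ _ (hpos k)] at h1 ⊢
    exact SubBundle.coord_res _ _ h1
  rw [LinkedSubBundle.coord_eq hε _ _ hj, hspan'' ⟨j, hj⟩ V'' (h.trans (hW'V _))]
  congr 2
  funext k
  rw [mapVec_mulVec, mapVec_mulVec, mapVec_resHom_resHom]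
  congr 1
  · ext i l
    change resFun _ (pull φ hW _) = resFun _ (pull φ _ _)
    rw [resFun_pull, resFun_pull]
  · exact (mapVec_resHom_resHom (hWV k) (h.trans hW') (a k)).symm.trans
      (mapVec_resHom_resHom hW' h (b k)).symm

end Transport

/-! ### Gram matrices of a linked alternating form, and their behaviour under transport. -/

section Gram

open Matrix

/-- With `N` the strictly upper triangular part, `G = N - Nᵀ`, and `N` and `Nᵀ` define the same
quadratic form. No division by `2` is involved. -/
lemma dotProduct_mulVec_self_eq_zero {R : Type*} [CommRing R] {d : ℕ}
    {G : Matrix (Fin d) (Fin d) R} (hG : ∀ k, G k k = 0) (hG' : ∀ k l, G k l = -G l k)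
    (a : Fin d → R) : a ⬝ᵥ (G *ᵥ a) = 0 := by
  let N : Matrix (Fin d) (Fin d) R := Matrix.of fun k l => if k < l then G k l else 0
  have h : G = N - Nᵀ := by
    ext k l
    simp only [N, Matrix.sub_apply, Matrix.transpose_apply, Matrix.of_apply]
    rcases lt_trichotomy k l with h | rfl | h
    · rw [if_pos h, if_neg h.not_gt, sub_zero]
    · simp [hG]
    · rw [if_neg h.not_gt, if_pos h, zero_sub, hG']
  rw [h, sub_mulVec, dotProduct_sub, mulVec_transpose, dotProduct_comm a (a ᵥ* N),
    dotProduct_mulVec, sub_self]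

variable {S : Scheme.{u}} {s : Γ(S, ⊤)} {n d c : ℕ} {𝓔 : LinkedBundle S s n d} {S₀ : S.Opens}
  {ε : ∀ i, Fin d → Γ(𝓔.E i, S₀)} (hε : ∀ i, IsFrame (ε i)) (ω : LinkedAlternatingForm 𝓔 c)

lemma Pairing.pair_vec {M N : S.Modules} (B : Pairing M N) {e : Fin d → Γ(M, S₀)}
    {e' : Fin d → Γ(N, S₀)} (he : IsFrame e) (he' : IsFrame e') (a b : Fin d → Γ(S, S₀)) :
    B.pair S₀ (he.vec le_rfl a) (he'.vec le_rfl b) = a ⬝ᵥ (B.gram e e' *ᵥ b) := by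
  simp only [IsFrame.vec_apply, res_self, map_sum, LinearMap.sum_apply, map_smul,
    LinearMap.smul_apply, dotProduct, mulVec, smul_eq_mul, Finset.mul_sum]
  rw [Finset.sum_comm]
  refine Finset.sum_congr rfl fun k _ => Finset.sum_congr rfl fun l _ => ?_
  simp only [Pairing.gram]
  ring

/-- The Gram matrices of a linked alternating form. -/
def gramM (ε : ∀ i, Fin d → Γ(𝓔.E i, S₀)) (i j : ℕ) : Matrix (Fin d) (Fin d) Γ(S, S₀) :=
  if h : i < n ∧ j < n then (ω.B ⟨i, h.1⟩ ⟨j, h.2⟩).gram (ε _) (ε _) else 0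

variable {ω}

lemma gramM_eq {i j : ℕ} (hi : i < n) (hj : j < n) :
    gramM ω ε i j = (ω.B ⟨i, hi⟩ ⟨j, hj⟩).gram (ε _) (ε _) := dif_pos ⟨hi, hj⟩

lemma ext_of_dotProduct_mulVec {R : Type*} [CommRing R] {M N : Matrix (Fin d) (Fin d) R}
    (h : ∀ a b, a ⬝ᵥ (M *ᵥ b) = a ⬝ᵥ (N *ᵥ b)) : M = N := by
  ext k l
  simpa using h (Pi.single k 1) (Pi.single l 1)

/-- The scalar is a power of `s` with exponent `0` or `1`, depending on the index of the form. Only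
its existence matters later, because vanishing is all that has to be transported. -/
lemma upM_transpose_mul_gramM {i j : ℕ} (hi : i + 1 < n) (hj : j < n) :
    ∃ t : Γ(S, S₀), (upM hε i)ᵀ * gramM ω ε (i + 1) j = t • gramM ω ε i j := by
  refine ⟨resTop s S₀ ^ epsLower c ⟨i + 1, hi⟩ (⟨j, hj⟩ : Fin n),
    ext_of_dotProduct_mulVec fun a b => ?_⟩
  have := ω.up_left (i := ⟨i, by omega⟩) (i' := ⟨i + 1, hi⟩) rfl ⟨j, hj⟩ S₀
    ((hε _).vec le_rfl a) ((hε _).vec le_rfl b)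
  rw [IsFrame.app_vec _ (hε ⟨i + 1, hi⟩), Pairing.pair_vec, Pairing.pair_vec,
    ← upM_eq hε hi, ← gramM_eq hi hj, ← gramM_eq (by omega) hj] at this
  rw [smul_mulVec, dotProduct_smul, smul_eq_mul, ← this, ← mulVec_mulVec, dotProduct_mulVec,
    ← mulVec_transpose, transpose_transpose]

lemma downM_transpose_mul_gramM {i j : ℕ} (hi : i + 1 < n) (hj : j < n) :
    ∃ t : Γ(S, S₀), (downM hε i)ᵀ * gramM ω ε i j = t • gramM ω ε (i + 1) j := by
  refine ⟨resTop s S₀ ^ epsUpper c ⟨i, by omega⟩ (⟨j, hj⟩ : Fin n),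
    ext_of_dotProduct_mulVec fun a b => ?_⟩
  have := ω.down_left (i := ⟨i, by omega⟩) (i' := ⟨i + 1, hi⟩) rfl ⟨j, hj⟩ S₀
    ((hε _).vec le_rfl a) ((hε _).vec le_rfl b)
  rw [IsFrame.app_vec _ (hε ⟨i, by omega⟩), Pairing.pair_vec, Pairing.pair_vec,
    ← downM_eq hε hi, ← gramM_eq (by omega) hj, ← gramM_eq hi hj] at this
  rw [smul_mulVec, dotProduct_smul, smul_eq_mul, ← this, ← mulVec_mulVec, dotProduct_mulVec,
    ← mulVec_transpose, transpose_transpose]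

lemma gramM_mul_upM {i j : ℕ} (hi : i < n) (hj : j + 1 < n) :
    ∃ t : Γ(S, S₀), gramM ω ε i (j + 1) * upM hε j = t • gramM ω ε i j := by
  refine ⟨resTop s S₀ ^ epsLower c (⟨i, hi⟩ : Fin n) ⟨j + 1, hj⟩,
    ext_of_dotProduct_mulVec fun a b => ?_⟩
  have := ω.up_right ⟨i, hi⟩ (j := ⟨j, by omega⟩) (j' := ⟨j + 1, hj⟩) rfl S₀
    ((hε _).vec le_rfl a) ((hε _).vec le_rfl b)
  rw [IsFrame.app_vec _ (hε ⟨j + 1, hj⟩), Pairing.pair_vec, Pairing.pair_vec,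
    ← upM_eq hε hj, ← gramM_eq hi hj, ← gramM_eq hi (by omega)] at this
  rw [smul_mulVec, dotProduct_smul, smul_eq_mul, ← this, ← mulVec_mulVec]

lemma gramM_mul_downM {i j : ℕ} (hi : i < n) (hj : j + 1 < n) :
    ∃ t : Γ(S, S₀), gramM ω ε i j * downM hε j = t • gramM ω ε i (j + 1) := by
  refine ⟨resTop s S₀ ^ epsUpper c (⟨i, hi⟩ : Fin n) ⟨j, by omega⟩,
    ext_of_dotProduct_mulVec fun a b => ?_⟩
  have := ω.down_right ⟨i, hi⟩ (j := ⟨j, by omega⟩) (j' := ⟨j + 1, hj⟩) rfl S₀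
    ((hε _).vec le_rfl a) ((hε _).vec le_rfl b)
  rw [IsFrame.app_vec _ (hε ⟨j, by omega⟩), Pairing.pair_vec, Pairing.pair_vec,
    ← downM_eq hε hj, ← gramM_eq hi (by omega), ← gramM_eq hi hj] at this
  rw [smul_mulVec, dotProduct_smul, smul_eq_mul, ← this, ← mulVec_mulVec]

/-- The form on transported vectors is a multiple of the form on the original vectors. -/
lemma exists_transportM_gramM {i j i' j' : ℕ} (hi : i < n) (hj : j < n) (hi' : i' < n)
    (hj' : j' < n) : ∃ t : Γ(S, S₀), (transportM hε i i')ᵀ * gramM ω ε i' j' * transportM hε j j' =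
      t • gramM ω ε i j := by
  have h1 : ∃ t : Γ(S, S₀), (transportM hε i i')ᵀ * gramM ω ε i' j' = t • gramM ω ε i j' := by
    refine transport_induction (upM hε) (downM hε)
      (P := fun k M => ∃ t : Γ(S, S₀), Mᵀ * gramM ω ε k j' = t • gramM ω ε i j') hi ⟨1, by simp⟩
      ?_ ?_ hi'
    · rintro k M hk ⟨t, ht⟩
      obtain ⟨t', ht'⟩ := upM_transpose_mul_gramM hε (ω := ω) hk hj'
      exact ⟨t' * t, by rw [transpose_mul, Matrix.mul_assoc, ht', Matrix.mul_smul, ht, smul_smul]⟩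
    · rintro k M hk ⟨t, ht⟩
      obtain ⟨t', ht'⟩ := downM_transpose_mul_gramM hε (ω := ω) hk hj'
      exact ⟨t' * t, by rw [transpose_mul, Matrix.mul_assoc, ht', Matrix.mul_smul, ht, smul_smul]⟩
  have h2 : ∃ t : Γ(S, S₀), gramM ω ε i j' * transportM hε j j' = t • gramM ω ε i j := by
    refine transport_induction (upM hε) (downM hε)
      (P := fun k M => ∃ t : Γ(S, S₀), gramM ω ε i k * M = t • gramM ω ε i j) hj ⟨1, by simp⟩
      ?_ ?_ hj'
    · rintro k M hk ⟨t, ht⟩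
      obtain ⟨t', ht'⟩ := gramM_mul_upM hε (ω := ω) hi hk
      exact ⟨t' * t, by rw [← Matrix.mul_assoc, ht', Matrix.smul_mul, ht, smul_smul]⟩
    · rintro k M hk ⟨t, ht⟩
      obtain ⟨t', ht'⟩ := gramM_mul_downM hε (ω := ω) hi hk
      exact ⟨t' * t, by rw [← Matrix.mul_assoc, ht', Matrix.smul_mul, ht, smul_smul]⟩
  obtain ⟨t, ht⟩ := h1
  obtain ⟨t', ht'⟩ := h2
  exact ⟨t * t', by rw [ht, Matrix.smul_mul, ht', smul_smul]⟩

lemma gramM_self_apply {i : ℕ} (hi : i < n) (k : Fin d) : gramM ω ε i i k k = 0 := by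
  rw [gramM_eq hi hi]
  exact ω.alternating _ _ _

/-- For `i = j` this is the polarization of the alternating condition; otherwise it is the
antisymmetry of the form. -/
lemma gramM_antisymm {i j : ℕ} (hi : i < n) (hj : j < n) (k l : Fin d) :
    gramM ω ε i j k l = -gramM ω ε j i l k := by
  rw [gramM_eq hi hj, gramM_eq hj hi]
  by_cases hij : i = j
  · subst hij
    have h := ω.alternating ⟨i, hi⟩ S₀ (ε _ k + ε _ l)
    simp only [map_add, LinearMap.add_apply, ω.alternating, zero_add, add_zero] at h
    rw [eq_neg_iff_add_eq_zero, add_comm]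
    exact h
  · exact ω.antisymm _ _ (by simpa using hij) _ _ _

/-- The form over a ring `R` that is given by Gram matrices. -/
def gramForm {R : Type*} [CommRing R] (ω : LinkedAlternatingForm 𝓔 c)
    (ε : ∀ i, Fin d → Γ(𝓔.E i, S₀)) (θ : Γ(S, S₀) →+* R) (i j : ℕ) (a b : Fin d → R) : R :=
  a ⬝ᵥ ((gramM ω ε i j).map θ *ᵥ b)

variable {R R' : Type*} [CommRing R] [CommRing R'] (θ : Γ(S, S₀) →+* R)

lemma map_gramForm (η : R →+* R') (i j : ℕ) (a b : Fin d → R) :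
    η (gramForm ω ε θ i j a b) = gramForm ω ε (η.comp θ) i j (mapVec η a) (mapVec η b) := by
  rw [gramForm, map_dotProduct', mapVec_mulVec, Matrix.map_map]
  rfl

lemma gramForm_self {i : ℕ} (hi : i < n) (a : Fin d → R) : gramForm ω ε θ i i a a = 0 := by
  refine dotProduct_mulVec_self_eq_zero (fun k => ?_) (fun k l => ?_) a
  · rw [Matrix.map_apply, gramM_self_apply hi, map_zero]
  · rw [Matrix.map_apply, Matrix.map_apply, gramM_antisymm hi hi, map_neg]

lemma gramForm_antisymm {i j : ℕ} (hi : i < n) (hj : j < n) (a b : Fin d → R) :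
    gramForm ω ε θ i j a b = -gramForm ω ε θ j i b a := by
  have h : (gramM ω ε i j).map θ = -((gramM ω ε j i).map θ)ᵀ := by
    ext k l
    simp [gramM_antisymm hi hj k l]
  rw [gramForm, gramForm, h, neg_mulVec, dotProduct_neg, mulVec_transpose, dotProduct_comm,
    dotProduct_mulVec]

/-- The point on which the number of equations rests: the `n ^ 2` pairings of transported generators
impose nothing beyond the pairings of the generators at their own positions. -/
lemma exists_gramForm_transportM {i j i' j' : ℕ} (hi : i < n) (hj : j < n) (hi' : i' < n)
    (hj' : j' < n) : ∃ t, ∀ a b : Fin d → R, gramForm ω ε θ i' j'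
      ((transportM hε i i').map θ *ᵥ a) ((transportM hε j j').map θ *ᵥ b) =
        t * gramForm ω ε θ i j a b := by
  obtain ⟨t, ht⟩ := exists_transportM_gramM hε (ω := ω) hi hj hi' hj'
  refine ⟨θ t, fun a b => ?_⟩
  have h := congr_arg (fun M => a ⬝ᵥ (M.map θ *ᵥ b)) ht
  have h2 : (t • gramM ω ε i j).map θ = θ t • (gramM ω ε i j).map θ := by
    ext k l
    simp
  simp only [Matrix.map_mul, h2, smul_mulVec, dotProduct_smul, smul_eq_mul] at h
  rw [gramForm, gramForm, ← h, ← mulVec_mulVec, ← mulVec_mulVec, Matrix.transpose_map,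
    dotProduct_mulVec a, vecMul_transpose]

lemma gramForm_eq_zero_of_mem_span {i j : ℕ} {A B : Set (Fin d → R)}
    (h : ∀ a ∈ A, ∀ b ∈ B, gramForm ω ε θ i j a b = 0) {a b : Fin d → R}
    (ha : a ∈ Submodule.span R A) (hb : b ∈ Submodule.span R B) :
    gramForm ω ε θ i j a b = 0 := by
  induction ha using Submodule.span_induction with
  | mem x hx =>
    induction hb using Submodule.span_induction with
    | mem y hy => exact h x hx y hy
    | zero => simp [gramForm]
    | add y z _ _ hy hz =>
      rw [gramForm] at hy hz ⊢
      rw [mulVec_add, dotProduct_add, hy, hz, add_zero]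
    | smul t y _ hy =>
      rw [gramForm] at hy ⊢
      rw [mulVec_smul, dotProduct_smul, hy, smul_zero]
  | zero => simp [gramForm]
  | add y z _ _ hy hz =>
    rw [gramForm] at hy hz ⊢
    rw [add_dotProduct, hy, hz, add_zero]
  | smul t y _ hy =>
    rw [gramForm] at hy ⊢
    rw [smul_dotProduct, hy, smul_zero]

end Gram

/-! ### Generators of the fibre at a smooth point. -/

section FibreGenerators

open Matrix

variable {S : Scheme.{u}} {s : Γ(S, ⊤)} {n d r : ℕ} {𝓔 : LinkedBundle S s n d} {S₀ : S.Opens}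
  {ε : ∀ i, Fin d → Γ(𝓔.E i, S₀)} (hε : ∀ i, IsFrame (ε i))

/-- A linked subspace that is exact, or that lives over a point where `s` is invertible, is
generated by `r` vectors at suitable positions. -/
lemma LinkedSubBundle.exists_generators_of_field {κ : Type u} [Field κ] {φ : Spec (.of κ) ⟶ S}
    (𝓕 : LinkedSubBundle 𝓔 r φ) (h0 : ⊤ ≤ φ ⁻¹ᵁ S₀) (hn : 0 < n)
    (H : IsExactChain n (endMap (evalR φ h0) (upM hε)) (endMap (evalR φ h0) (downM hε))
      (𝓕.vecs hε h0) ∨ evalR φ h0 (resTop s S₀) ≠ 0) :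
    ∃ (pos : Fin r → ℕ) (v : Fin r → Fin d → κ), (∀ k, pos k < n) ∧
      (∀ k, v k ∈ 𝓕.vecs hε h0 (pos k)) ∧ ∀ j < n, 𝓕.vecs hε h0 j =
        Submodule.span κ (Set.range fun k =>
          ((transportM hε (pos k) j).map (evalR φ h0)).mulVec (v k)) := by
  have := subsingleton_spec_of_field κ
  have hr : ∀ i < n, Module.finrank κ (𝓕.vecs hε h0 i) = r := fun i hi =>
    (𝓕.isSplit_vecs hε h0 hi).finrank_eq
  simp only [map_transportM]
  rcases H with H | H
  · exact H.exists_generators hr hn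
  · have hsub : IsSubchain n (endMap (evalR φ h0) (upM hε)) (endMap (evalR φ h0) (downM hε))
        (𝓕.vecs hε h0) :=
      ⟨fun hi _ hx => 𝓕.vecs_up hε h0 hi hx, fun hi _ hx => 𝓕.vecs_down hε h0 hi hx⟩
    refine hsub.exists_generators_of_isUnit H (fun i hi x => ?_) hr hn
    have h1 := congr_arg (fun M => (M.map (evalR φ h0)).mulVec x) (downM_mul_upM hε hi)
    have h2 : (resTop s S₀ • (1 : Matrix (Fin d) (Fin d) Γ(S, S₀))).map (evalR φ h0) =
        evalR φ h0 (resTop s S₀) • 1 := by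
      ext k l
      simp [Matrix.one_apply, apply_ite (evalR φ h0)]
    simp only [Matrix.map_mul, h2, smul_mulVec, one_mulVec, ← mulVec_mulVec] at h1
    exact h1

/-- At a smooth point of the linked Grassmannian, the fibre of the universal subbundle is
generated by `r` vectors at suitable positions. -/
theorem IsLinkedGrassmannian.exists_fibre_generators {LG : Scheme.{u}} {π : LG ⟶ S}
    {𝓤 : LinkedSubBundle 𝓔 r π} (hLG : IsLinkedGrassmannian 𝓔 r π 𝓤) {p : LG}
    (hsm : IsSmoothPoint π p) (hp : p ∈ π ⁻¹ᵁ S₀) (hS₀ : IsAffineOpen S₀) (hn : 0 < n)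
    {𝓕 : LinkedSubBundle 𝓔 r (LG.fromSpecResidueField p ≫ π)}
    (h𝓕 : 𝓤.IsPullback (LG.fromSpecResidueField p) rfl 𝓕)
    (h0 : ⊤ ≤ (LG.fromSpecResidueField p ≫ π) ⁻¹ᵁ S₀) :
    ∃ (pos : Fin r → ℕ) (v : Fin r → Fin d → LG.residueField p), (∀ k, pos k < n) ∧
      (∀ k, v k ∈ LinkedSubBundle.vecs (R := LG.residueField p) hε h0 𝓕 (pos k)) ∧
      ∀ j < n, LinkedSubBundle.vecs (R := LG.residueField p) hε h0 𝓕 j =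
        Submodule.span (LG.residueField p) (Set.range fun k =>
          ((transportM hε (pos k) j).map (evalR (R := LG.residueField p)
            (LG.fromSpecResidueField p ≫ π) h0)).mulVec (v k)) := by
  obtain ⟨W, hpW, hW⟩ := hsm
  obtain ⟨U, hU, hpU, hUle⟩ := exists_isAffineOpen_mem_and_subset (X := LG) (x := p)
    (U := W ⊓ π ⁻¹ᵁ S₀) ⟨hpW, hp⟩
  have hUle' : U ≤ W ⊓ π ⁻¹ᵁ S₀ := hUle
  have hUS : U ≤ π ⁻¹ᵁ S₀ := hUle'.trans inf_le_right
  have heq : (evalAt hpU).comp (pull π hUS) =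
      evalR (R := LG.residueField p) (LG.fromSpecResidueField p ≫ π) h0 :=
    evalR_comp_pull (R := LG.residueField p) π (LG.fromSpecResidueField p) rfl hUS
      (top_le_preimage_of_mem hpU) h0
  refine LinkedSubBundle.exists_generators_of_field (κ := LG.residueField p) hε 𝓕 h0 hn ?_
  -- Where `s` vanishes, smoothness gives exactness; where it does not, the chain maps are
  -- isomorphisms on the fibre and smoothness plays no role.
  by_cases hs : S.Γevaluation (π p) s = 0
  · left
    have hamb := isAmbientChain_evalAt_comp_pull hε π hpU hUS hs
    rw [heq] at hamb
    exact isExactChain_of_smooth (κ := LG.residueField p) hε (top_le_preimage_of_mem hpU) h0 hLG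
      h𝓕 hU hUS (smooth_pull hW (hUle'.trans inf_le_left) hU hS₀ hUS) hamb
  · right
    intro h
    replace h := (congr_arg (fun f => f (resTop s S₀)) heq).trans h
    rw [evalAt_comp_pull π hpU hUS] at h
    have h1 : evalAt (p := π p) (hUS hpU) (resTop s S₀) = 0 :=
      (map_eq_zero (π.residueFieldMap p).hom).1 h
    refine hs (Eq.trans ?_ h1)
    exact (congr_arg (fun f => f s) (evalAt_eq_evaluation (p := π p) (U := ⊤) trivial)).symm.trans
      (evalAt_resFun (p := π p) (hUS hpU) le_top s).symm

end FibreGenerators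

/-! ### Isotropy in terms of the generators. -/

section Isotropic

open Matrix

lemma eq_zero_of_local {X : Scheme.{u}} {U : X.Opens} {a : Γ(X, U)}
    (h : ∀ p ∈ U, ∃ (V : X.Opens) (hV : V ≤ U), p ∈ V ∧ resHom hV a = 0) : a = 0 := by
  refine TopCat.Presheaf.section_ext X.sheaf U a 0 fun p hp => ?_
  obtain ⟨V, hV, hpV, ha⟩ := h p hp
  have h1 := TopCat.Presheaf.germ_res_apply X.presheaf (homOfLE hV) p hpV a
  have h2 : X.presheaf.map (homOfLE hV).op a = 0 := ha
  rw [h2, map_zero] at h1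
  exact h1.symm.trans (map_zero (X.presheaf.germ U p hp).hom).symm

variable {S : Scheme.{u}} {s : Γ(S, ⊤)} {n d r c : ℕ} {𝓔 : LinkedBundle S s n d} {S₀ : S.Opens}
  {ε : ∀ i, Fin d → Γ(𝓔.E i, S₀)} (hε : ∀ i, IsFrame (ε i)) {ω : LinkedAlternatingForm 𝓔 c}
  {X T : Scheme.{u}} {π : X ⟶ S} {𝓤 : LinkedSubBundle 𝓔 r π} {ψ : T ⟶ X}
  {𝓕 : LinkedSubBundle 𝓔 r (ψ ≫ π)}

/-- `𝓤` is generated over `U` by the sections `b k` at the positions `pos k`. -/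
def LinkedSubBundle.IsGeneratedBy (𝓤 : LinkedSubBundle 𝓔 r π) {U : X.Opens} (hU : U ≤ π ⁻¹ᵁ S₀)
    (pos : Fin r → ℕ) (b : Fin r → Fin d → Γ(X, U)) : Prop :=
  ∀ j < n, ∀ (V : X.Opens) (h : V ≤ U), 𝓤.coord hε (h.trans hU) j =
    Submodule.span Γ(X, V) (Set.range fun k => mapVec (resHom h)
      (((transportM hε (pos k) j).map (pull π hU)).mulVec (b k)))

variable {U : X.Opens} {hU : U ≤ π ⁻¹ᵁ S₀} {pos : Fin r → ℕ} {b : Fin r → Fin d → Γ(X, U)}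

/-- The pullback of a generated linked subbundle is generated by the pullbacks of the
generators. -/
lemma LinkedSubBundle.IsGeneratedBy.exists_mem_span (hgen : 𝓤.IsGeneratedBy hε hU pos b)
    (h𝓕 : 𝓤.IsPullback ψ rfl 𝓕) (hψ : ⊤ ≤ ψ ⁻¹ᵁ U) {W : T.Opens} (hW : W ≤ (ψ ≫ π) ⁻¹ᵁ S₀)
    {j : Fin n} {a : Fin d → Γ(T, W)} (ha : a ∈ (𝓕.F j).coord (hε j) hW) {p : T} (hp : p ∈ W) :
    ∃ (W₁ : T.Opens) (_ : W₁ ≤ W), p ∈ W₁ ∧ ∀ (W₂ : T.Opens) (_ : W₂ ≤ W₁) (h₂ : W₂ ≤ W),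
      mapVec (resHom h₂) a ∈ Submodule.span Γ(T, W₂) (Set.range fun k =>
        ((transportM hε (pos k) j).map (pull (ψ ≫ π) (h₂.trans hW))).mulVec
          (mapVec (pull ψ (le_top.trans hψ)) (b k))) := by
  obtain ⟨V, hV, W₁, h₁, h₁', hp₁, ha₁⟩ := ((h𝓕 j).mem_coord_iff (hε j) hW a).1 ha p hp
  refine ⟨W₁, h₁, hp₁, fun W₂ h h₂ => ?_⟩
  have h₃ : W₂ ≤ ψ ⁻¹ᵁ (V ⊓ U) := le_inf (h.trans h₁') (le_top.trans hψ)
  refine Submodule.span_le.2 ?_ (IsGenAt.mem_span_of_le h₃ h inf_le_left ha₁)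
  rintro _ ⟨x, hx, rfl⟩
  have hx' : x ∈ 𝓤.coord hε ((inf_le_right : V ⊓ U ≤ U).trans hU) j := by
    rwa [LinkedSubBundle.coord_eq hε _ _ j.2]
  rw [hgen j j.2 _ inf_le_right] at hx'
  refine Submodule.span_mono ?_ (mapVec_mem_span (pull ψ h₃) hx')
  rintro _ ⟨_, ⟨k, rfl⟩, rfl⟩
  refine ⟨k, ?_⟩
  beta_reduce
  rw [mapVec_mulVec, mapVec_mulVec]
  congr 1
  · ext i l
    refine Eq.trans ?_ (pull_resFun ψ h₃ inf_le_right _).symm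
    exact (pull_pull ψ π rfl hU _ _ _).symm
  · funext i
    exact (pull_resFun ψ h₃ inf_le_right _).symm

/-- The pullback of a generated linked subbundle is isotropic if the pairings of the generators
vanish. -/
lemma LinkedSubBundle.IsGeneratedBy.isIsotropic (hgen : 𝓤.IsGeneratedBy hε hU pos b)
    (hpos : ∀ k, pos k < n) (h𝓕 : 𝓤.IsPullback ψ rfl 𝓕) (hψ : ⊤ ≤ ψ ⁻¹ᵁ U)
    (hb : ∀ k l, pull ψ hψ (gramForm ω ε (pull π hU) (pos k) (pos l) (b k) (b l)) = 0) :
    𝓕.IsIsotropic ω := by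
  intro i j
  have hS : ⊤ ≤ (ψ ≫ π) ⁻¹ᵁ S₀ := hψ.trans (preimage_le ψ hU)
  obtain ⟨B', hB'⟩ := (ω.B i j).exists_isPullback (hε i) (hε j) (ψ ≫ π) hS
  refine ⟨B', hB', fun W x hx y hy => ?_⟩
  have hW : W ≤ (ψ ≫ π) ⁻¹ᵁ S₀ := le_top.trans hS
  obtain ⟨x, rfl⟩ := ((hε i).pbVec (ψ ≫ π) hW).surjective x
  obtain ⟨y, rfl⟩ := ((hε j).pbVec (ψ ≫ π) hW).surjective y
  rw [hB'.pair_pbVec, ← gramM_eq i.2 j.2]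
  change gramForm ω ε (pull (ψ ≫ π) hW) i j x y = 0
  -- Sections of the pullback are combinations of the transported generators only locally, so the
  -- vanishing is checked near each point.
  refine eq_zero_of_local fun p hp => ?_
  obtain ⟨W₁, h₁, hp₁, hx'⟩ := hgen.exists_mem_span hε h𝓕 hψ hW hx hp
  obtain ⟨W₂, h₂, hp₂, hy'⟩ := hgen.exists_mem_span hε h𝓕 hψ hW hy hp
  have h₃ : W₁ ⊓ W₂ ≤ W := inf_le_left.trans h₁
  refine ⟨W₁ ⊓ W₂, h₃, ⟨hp₁, hp₂⟩, ?_⟩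
  have hcomp : (resHom h₃).comp (pull (ψ ≫ π) hW) = pull (ψ ≫ π) (h₃.trans hW) := by
    ext a
    exact resFun_pull _ _ _ _
  rw [map_gramForm, hcomp]
  refine gramForm_eq_zero_of_mem_span _ ?_ (hx' _ inf_le_left h₃) (hy' _ inf_le_right h₃)
  rintro _ ⟨k, rfl⟩ _ ⟨l, rfl⟩
  obtain ⟨t, ht⟩ := exists_gramForm_transportM hε (ω := ω) (pull (ψ ≫ π) (h₃.trans hW)) (hpos k)
    (hpos l) i.2 j.2
  have hcomp' : (pull ψ (le_top.trans hψ : W₁ ⊓ W₂ ≤ _)).comp (pull π hU) =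
      pull (ψ ≫ π) (h₃.trans hW) := by
    ext a
    exact pull_pull ψ π rfl _ _ _ a
  have h4 : pull ψ (le_top.trans hψ : W₁ ⊓ W₂ ≤ _)
      (gramForm ω ε (pull π hU) (pos k) (pos l) (b k) (b l)) = 0 := by
    rw [← resFun_pull ψ hψ le_top, hb]
    exact map_zero (resHom _)
  beta_reduce
  rw [ht, ← hcomp', ← map_gramForm, h4, mul_zero]

/-- The pairings of sections of an isotropic pullback vanish. -/
lemma LinkedSubBundle.IsIsotropic.pull_gramForm_eq_zero (hiso : 𝓕.IsIsotropic ω)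
    (h𝓕 : 𝓤.IsPullback ψ rfl 𝓕) {i j : ℕ} (hi : i < n) (hj : j < n) {a b : Fin d → Γ(X, U)}
    (ha : a ∈ 𝓤.coord hε hU i) (hb : b ∈ 𝓤.coord hε hU j) :
    pull ψ le_rfl (gramForm ω ε (pull π hU) i j a b) = 0 := by
  rw [LinkedSubBundle.coord_eq hε _ _ hi] at ha
  rw [LinkedSubBundle.coord_eq hε _ _ hj] at hb
  have hW : ψ ⁻¹ᵁ U ≤ (ψ ≫ π) ⁻¹ᵁ S₀ := preimage_le ψ hU
  obtain ⟨B', hB', hz⟩ := hiso ⟨i, hi⟩ ⟨j, hj⟩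
  have h1 := hz _ _ ((h𝓕 ⟨i, hi⟩).mapVec_mem (hε _) hU hW le_rfl ha) _
    ((h𝓕 ⟨j, hj⟩).mapVec_mem (hε _) hU hW le_rfl hb)
  have hcomp : (pull ψ (le_rfl : ψ ⁻¹ᵁ U ≤ _)).comp (pull π hU) = pull (ψ ≫ π) hW := by
    ext a
    exact pull_pull ψ π rfl _ _ _ a
  rw [map_gramForm, hcomp, gramForm, gramM_eq hi hj, ← h1]
  exact (hB'.pair_pbVec (hε _) (hε _) hW _ _).symm

end Isotropic

/-! ### The equations of the linked alternating Grassmannian. -/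

section Equations

variable {S : Scheme.{u}} {s : Γ(S, ⊤)} {n d r c : ℕ} {𝓔 : LinkedBundle S s n d} {S₀ : S.Opens}
  {ε : ∀ i, Fin d → Γ(𝓔.E i, S₀)} (hε : ∀ i, IsFrame (ε i)) {ω : LinkedAlternatingForm 𝓔 c}
  {LG : Scheme.{u}} {π : LG ⟶ S} {𝓤 : LinkedSubBundle 𝓔 r π} {U : LG.Opens}
  {hU : U ≤ π ⁻¹ᵁ S₀} {pos : Fin r → ℕ} {b : Fin r → Fin d → Γ(LG, U)}

lemma card_sigma_fin (r : ℕ) : Fintype.card (Σ j : Fin r, Fin j) = r.choose 2 := by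
  rw [Fintype.card_sigma]
  simp only [Fintype.card_fin]
  rw [Fin.sum_univ_eq_sum_range (fun i => i), Finset.sum_range_id, Nat.choose_two_right]

/-- If the universal subbundle is generated by `r` sections at suitable positions, then the
pairings of these sections cut out the linked alternating Grassmannian. -/
theorem LinkedSubBundle.IsGeneratedBy.isLocallyCutOutBy (hgen : 𝓤.IsGeneratedBy hε hU pos b)
    (hpos : ∀ k, pos k < n) (hb : ∀ k, b k ∈ 𝓤.coord hε hU (pos k))
    (hLG : IsLinkedGrassmannian 𝓔 r π 𝓤) {LAG : Scheme.{u}} {ι : LAG ⟶ LG}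
    (hLAG : IsLinkedAlternatingGrassmannian ω 𝓤 ι) (hUa : IsAffineOpen U) {p : LG} (hp : p ∈ U) :
    IsLocallyCutOutBy ι p (r.choose 2) := by
  -- The index type is the set of pairs `k < l`, with `l` the first component.
  let g : (Σ j : Fin r, Fin j) → Γ(LG, U) := fun x => gramForm ω ε (pull π hU)
    (pos ⟨x.2, x.2.2.trans x.1.2⟩) (pos x.1) (b ⟨x.2, x.2.2.trans x.1.2⟩) (b x.1)
  let e := Fintype.equivFinOfCardEq (card_sigma_fin r)
  refine ⟨⟨U, hUa⟩, hp, g ∘ e.symm, ?_⟩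
  rw [e.symm.surjective.range_comp]
  have hpull : ∀ x, pull ι (le_rfl : ι ⁻¹ᵁ U ≤ _) x = ι.app U x := fun x =>
    (pull_eq ι le_rfl x).trans (resFun_self _)
  apply le_antisymm
  · set I := Ideal.span (Set.range g) with hI
    have hlt : ∀ k l, k < l →
        gramForm ω ε (pull π hU) (pos k) (pos l) (b k) (b l) ∈ I := fun k l hkl =>
      Ideal.subset_span ⟨⟨l, ⟨k, hkl⟩⟩, rfl⟩
    have hmem : ∀ k l, gramForm ω ε (pull π hU) (pos k) (pos l) (b k) (b l) ∈ I := by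
      intro k l
      rcases lt_trichotomy k l with h | rfl | h
      · exact hlt k l h
      · rw [gramForm_self _ (hpos k)]
        exact zero_mem _
      · rw [gramForm_antisymm _ (hpos k) (hpos l)]
        exact neg_mem (hlt l k h)
    -- Over the closed subscheme of `U` defined by `I` the universal subbundle is isotropic, so this
    -- subscheme maps to `LAG` over `LG`. A function that vanishes on `LAG` therefore vanishes on
    -- it, that is, lies in `I`.
    obtain ⟨ψ, hψ, hψI⟩ := exists_evalR_eq hUa (Ideal.Quotient.mk I)
    have hpull0 : ∀ x ∈ I, pull ψ hψ x = 0 := by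
      intro x hx
      apply (specSec _).injective
      rw [map_zero]
      exact (RingHom.congr_fun hψI x).trans (Ideal.Quotient.eq_zero_iff_mem.2 hx)
    obtain ⟨𝓕, h𝓕, -⟩ := hLG.existsUnique_pullback (ψ ≫ π) ψ rfl
    obtain ⟨χ, hχ⟩ := (hLAG.factors_iff ψ 𝓕 h𝓕).2
      (hgen.isIsotropic hε hpos h𝓕 hψ fun k l => hpull0 _ (hmem k l))
    intro x hx
    have hx0 : pull ι (le_rfl : ι ⁻¹ᵁ U ≤ _) x = 0 := (hpull x).trans hx
    have h1 : ⊤ ≤ χ ⁻¹ᵁ ι ⁻¹ᵁ U := hψ.trans (preimage_eq_of_comp_eq hχ U).le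
    have h2 := pull_pull χ ι hχ le_rfl h1 hψ x
    rw [hx0, map_zero] at h2
    rw [← Ideal.Quotient.eq_zero_iff_mem, ← hψI]
    exact (congr_arg (specSec _) h2.symm).trans (map_zero _)
  · rw [Ideal.span_le]
    rintro _ ⟨x, rfl⟩
    -- Conversely `ι` factors through itself, so the restriction of the universal subbundle to `LAG`
    -- is isotropic and the pairings of its sections vanish there.
    obtain ⟨𝓕, h𝓕, -⟩ := hLG.existsUnique_pullback (ι ≫ π) ι rfl
    have hiso := (hLAG.factors_iff ι 𝓕 h𝓕).1 ⟨𝟙 _, Category.id_comp _⟩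
    exact (hpull _).symm.trans
      (hiso.pull_gramForm_eq_zero hε h𝓕 (hpos _) (hpos _) (hb _) (hb _))

end Equations

end LinkedGrassmannian

end

open LinkedGrassmannian
theorem theorem1p1 {S : Scheme.{u}} {s : Γ(S, ⊤)} {n d r c : ℕ} (hr : r < d)
    (𝓔 : LinkedBundle S s n d) (ω : LinkedAlternatingForm 𝓔 c)
    {LG : Scheme.{u}} {π : LG ⟶ S} {𝓤 : LinkedSubBundle 𝓔 r π}
    (hLG : IsLinkedGrassmannian 𝓔 r π 𝓤)
    {LAG : Scheme.{u}} {ι : LAG ⟶ LG} (hLAG : IsLinkedAlternatingGrassmannian ω 𝓤 ι)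
    (z : LAG) (hz : IsSmoothPoint π (ι z)) :
    IsLocallyCutOutBy ι (ι z) (r.choose 2) := by
  obtain ⟨S₀, ε, hp, hS₀, hε⟩ := 𝓔.exists_frames (π (ι z))
  -- The index `c` satisfies `2 ≤ c ≤ 2 n`, so the chain is not empty.
  have hn : 0 < n := by
    have := ω.two_le.trans ω.le_two_mul
    omega
  have hU : ⊤ ≤ (LG.fromSpecResidueField (ι z) ≫ π) ⁻¹ᵁ S₀ :=
    top_le_preimage_of_mem (U := π ⁻¹ᵁ S₀) hp
  obtain ⟨𝓕, h𝓕, -⟩ := hLG.existsUnique_pullback _ (LG.fromSpecResidueField (ι z)) rfl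
  obtain ⟨pos, v, hpos, hv, hspan⟩ := hLG.exists_fibre_generators hε hz hp hS₀ hn h𝓕 hU
  obtain ⟨V, hV, b, hpV, hVa, hb, hgen⟩ :=
    LinkedSubBundle.exists_generators hε h𝓕 hp hU hpos hv hspan
  exact LinkedSubBundle.IsGeneratedBy.isLocallyCutOutBy hε hgen hpos hb hLG hLAG hVa hpV
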